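/- Let $Y$ be a complex manifold and let $\iota: X\hookrightarrow Y$ be the inclusion of a compact complex submanifold. Let $\mathcal I\subset\mathcal O_Y$ be the ideal sheaf of $X$, and let $X_1=(X,\mathcal O_Y/\mathcal I^2)$ be the first-order thickening of $X$ in $Y$; write $\mathcal O_{X_1}=\mathcal O_Y/\mathcal I^2$. A vector bundle over $X_1$ is a locally free sheaf of $\mathcal O_{X_1}$-modules of finite rank, and $\iota^*E_1=E_1\otimes_{\mathcal O_{X_1}}\mathcal O_X$ denotes its restriction to $X$ (we write $\iota$ also for $X\to X_1$). Let $T_X$ and $T_Y$ be the holomorphic tangent bundles, $T_{Y|X}=\iota^*T_Y$, and let $N_{X/Y}=T_{Y|X}/T_X$ be the normal bundle. The Kodaira–Spencer invariant $\kappa_{X/Y}\in H^1(X,\operatorname{Hom}(N_{X/Y},T_X))$ is the class of the cocycle $\Psi_i-\Psi_j$, where $\{U_i\}$ is a sufficiently fine open cover of $X$ and $\Psi_i\in\Gamma(U_i,\operatorname{Hom}(N_{X/Y},T_{Y|X}))$ are holomorphic splittings of the projection $T_{Y|X}\to N_{X/Y}$ over $U_i$. For a holomorphic vector bundle $E\to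 X$ with holomorphic trivializations $e_i$ over the sets $U_i$ of an open cover and transition functions $g_{ij}=e_ie_j^{-1}$, the Atiyah class $\operatorname{At}(E)\in H^1(X,\Omega^1_X\otimes\operatorname{End}E)$ is the class of the cocycle $e_i^{-1}\,dg_{ij}\,e_j$, which in the trivialization $e_\lambda$ reads $g_{\lambda i}\,dg_{i\lambda}-g_{\lambda j}\,dg_{j\lambda}$. Put $$\operatorname{At}(E)\cdot\kappa_{X/Y}=\operatorname{tr}_{T_X}\bigl(\operatorname{At}(E)\cup\kappa_{X/Y}\bigr)\in H^2(X,N_{X/Y}^*\otimes\operatorname{End}E),$$ where $\cup$ is the cup product and $\operatorname{tr}_{T_X}:(\Omega^1_X\otimes\operatorname{End}E)\otimes\operatorname{Hom}(N_{X/Y},T_X)\to N_{X/Y}^*\otimes\operatorname{End}E$ is the contraction of $\Omega^1_X$ with $T_X$. **Theorem.** For every holomorphic vector bundle $E\to X$, there is a vector bundle $E_1$ over $X_1$ with $\iota^*E_1\cong E$ if and only if $\operatorname{At}(E)\cdot\kappa_{X/Y}=0$ in $H^2(X,N_{X/Y}^*\otimes\operatorname{End}E)$. -/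

import Mathlib

open scoped Manifold ContDiff Topology Bundle
open TopologicalSpace Bundle CategoryTheory Opposite
universe u

noncomputable section

/-- A sheaf of abelian groups on `X`, presented as a sheaf of functions `s` with values
`s x ∈ V x` (every sheaf has this form, with `V x` its stalks).  It is specified by saying, for
every point `p`, which `s` are admissible at `p`; this depends only on the germ of `s` at `p`.
The sections over `U` are the functions on `U` admissible at every point of `U`.  They are
represented here by total functions, whose values outside `U` are irrelevant. -/
structure SectionSheaf {X : Type*} [TopologicalSpace X] (V : X → Type*)
    [∀ x, AddCommGroup (V x)] where
  germs : ∀ _ : X, AddSubgroup (∀ x, V x)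
  congr : ∀ {p : X} {s t : ∀ x, V x}, (∀ᶠ x in 𝓝 p, s x = t x) → s ∈ germs p → t ∈ germs p

namespace SectionSheaf

section Cech

variable {X : Type*} [TopologicalSpace X] {V : X → Type*} [∀ x, AddCommGroup (V x)]
  (S : SectionSheaf V)

/-- `s` restricts to a section of the sheaf over `U`. -/
def IsSection (U : Set X) (s : ∀ x, V x) : Prop := ∀ p ∈ U, s ∈ S.germs p

/-! ### Čech cohomology

The Čech group is `Ȟⁿ(X, S) = colim Hⁿ(𝒰, S)`, the colimit over all open covers `𝒰` of `X`
under refinement.  Covers of the form `(U x)_{x ∈ X}` with `U x` an open neighbourhood of `x`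
are cofinal among all covers, and between two of them there is the canonical refinement
`W x ⊆ U x`.  A cochain is stored as a family of total functions of which only the values on
the relevant intersections `U x ∩ U y ∩ ...` matter; then passing to a finer cover does not
change the family, so the colimit of the cocycle groups is their union, the colimit of the
coboundary groups is their union, and `Ȟⁿ` is the quotient of the two (directed colimits are
exact).  A family that vanishes on all intersections is a coboundary, so the irrelevant values
do not contribute.  For paracompact Hausdorff `X` this is the usual sheaf cohomology. -/

/-- Čech `1`-cocycles `c x y ∈ S(U x ∩ U y)` on some cover. -/
def cocycles₁ : AddSubgroup (X → X → ∀ x, V x) where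
  carrier := {c | ∃ U : ∀ x : X, OpenNhdsOf x,
    (∀ x y, S.IsSection ((U x : Set X) ∩ U y) (c x y)) ∧
    ∀ x y z, ∀ p ∈ (U x : Set X) ∩ U y ∩ U z, c y z p - c x z p + c x y p = 0}
  zero_mem' := ⟨fun _ => ⊤, fun _ _ p _ => (S.germs p).zero_mem, by simp⟩
  add_mem' := by
    rintro a b ⟨U, hU, hU'⟩ ⟨W, hW, hW'⟩
    refine ⟨fun x => U x ⊓ W x, fun x y p hp => (S.germs p).add_mem
      (hU x y p ⟨hp.1.1, hp.2.1⟩) (hW x y p ⟨hp.1.2, hp.2.2⟩), fun x y z p hp => ?_⟩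
    have h1 := hU' x y z p ⟨⟨hp.1.1.1, hp.1.2.1⟩, hp.2.1⟩
    have h2 := hW' x y z p ⟨⟨hp.1.1.2, hp.1.2.2⟩, hp.2.2⟩
    have h3 := congrArg₂ (· + ·) h1 h2
    simp only [add_zero] at h3
    rw [← h3]
    simp only [Pi.add_apply]
    abel
  neg_mem' := by
    rintro a ⟨U, hU, hU'⟩
    refine ⟨U, fun x y p hp => (S.germs p).neg_mem (hU x y p hp), fun x y z p hp => ?_⟩
    have h3 := congrArg (- ·) (hU' x y z p hp)
    simp only [neg_zero] at h3
    rw [← h3]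
    simp only [Pi.neg_apply]
    abel

/-- Čech `1`-coboundaries `c x y = b y - b x` on some cover, where `b x ∈ S(U x)`. -/
def coboundaries₁ : AddSubgroup (X → X → ∀ x, V x) where
  carrier := {c | ∃ (U : ∀ x : X, OpenNhdsOf x) (b : X → ∀ x, V x),
    (∀ x, S.IsSection (U x : Set X) (b x)) ∧
    ∀ x y, ∀ p ∈ (U x : Set X) ∩ U y, c x y p = b y p - b x p}
  zero_mem' := ⟨fun _ => ⊤, 0, fun _ p _ => (S.germs p).zero_mem, by simp⟩
  add_mem' := by
    rintro a b ⟨U, c, hU, hU'⟩ ⟨W, d, hW, hW'⟩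
    refine ⟨fun x => U x ⊓ W x, c + d, fun x p hp => (S.germs p).add_mem
      (hU x p hp.1) (hW x p hp.2), fun x y p hp => ?_⟩
    simp only [Pi.add_apply]
    rw [hU' x y p ⟨hp.1.1, hp.2.1⟩, hW' x y p ⟨hp.1.2, hp.2.2⟩]
    abel
  neg_mem' := by
    rintro a ⟨U, c, hU, hU'⟩
    refine ⟨U, -c, fun x p hp => (S.germs p).neg_mem (hU x p hp), fun x y p hp => ?_⟩
    simp only [Pi.neg_apply]
    rw [hU' x y p hp]
    abel

/-- Čech `2`-cocycles `c x y z ∈ S(U x ∩ U y ∩ U z)` on some cover. -/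
def cocycles₂ : AddSubgroup (X → X → X → ∀ x, V x) where
  carrier := {c | ∃ U : ∀ x : X, OpenNhdsOf x,
    (∀ x y z, S.IsSection ((U x : Set X) ∩ U y ∩ U z) (c x y z)) ∧
    ∀ x y z w, ∀ p ∈ (U x : Set X) ∩ U y ∩ U z ∩ U w,
      c y z w p - c x z w p + c x y w p - c x y z p = 0}
  zero_mem' := ⟨fun _ => ⊤, fun _ _ _ p _ => (S.germs p).zero_mem, by simp⟩
  add_mem' := by
    rintro a b ⟨U, hU, hU'⟩ ⟨W, hW, hW'⟩
    refine ⟨fun x => U x ⊓ W x, fun x y z p hp => (S.germs p).add_mem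
      (hU x y z p ⟨⟨hp.1.1.1, hp.1.2.1⟩, hp.2.1⟩) (hW x y z p ⟨⟨hp.1.1.2, hp.1.2.2⟩, hp.2.2⟩),
      fun x y z w p hp => ?_⟩
    have h1 := hU' x y z w p ⟨⟨⟨hp.1.1.1.1, hp.1.1.2.1⟩, hp.1.2.1⟩, hp.2.1⟩
    have h2 := hW' x y z w p ⟨⟨⟨hp.1.1.1.2, hp.1.1.2.2⟩, hp.1.2.2⟩, hp.2.2⟩
    have h3 := congrArg₂ (· + ·) h1 h2
    simp only [add_zero] at h3
    rw [← h3]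
    simp only [Pi.add_apply]
    abel
  neg_mem' := by
    rintro a ⟨U, hU, hU'⟩
    refine ⟨U, fun x y z p hp => (S.germs p).neg_mem (hU x y z p hp), fun x y z w p hp => ?_⟩
    have h3 := congrArg (- ·) (hU' x y z w p hp)
    simp only [neg_zero] at h3
    rw [← h3]
    simp only [Pi.neg_apply]
    abel

/-- Čech `2`-coboundaries `c x y z = b y z - b x z + b x y` on some cover, where
`b x y ∈ S(U x ∩ U y)`. -/
def coboundaries₂ : AddSubgroup (X → X → X → ∀ x, V x) where
  carrier := {c | ∃ (U : ∀ x : X, OpenNhdsOf x) (b : X → X → ∀ x, V x),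
    (∀ x y, S.IsSection ((U x : Set X) ∩ U y) (b x y)) ∧
    ∀ x y z, ∀ p ∈ (U x : Set X) ∩ U y ∩ U z, c x y z p = b y z p - b x z p + b x y p}
  zero_mem' := ⟨fun _ => ⊤, 0, fun _ _ p _ => (S.germs p).zero_mem, by simp⟩
  add_mem' := by
    rintro a b ⟨U, c, hU, hU'⟩ ⟨W, d, hW, hW'⟩
    refine ⟨fun x => U x ⊓ W x, c + d, fun x y p hp => (S.germs p).add_mem
      (hU x y p ⟨hp.1.1, hp.2.1⟩) (hW x y p ⟨hp.1.2, hp.2.2⟩), fun x y z p hp => ?_⟩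
    simp only [Pi.add_apply]
    rw [hU' x y z p ⟨⟨hp.1.1.1, hp.1.2.1⟩, hp.2.1⟩, hW' x y z p ⟨⟨hp.1.1.2, hp.1.2.2⟩, hp.2.2⟩]
    abel
  neg_mem' := by
    rintro a ⟨U, c, hU, hU'⟩
    refine ⟨U, -c, fun x y p hp => (S.germs p).neg_mem (hU x y p hp), fun x y z p hp => ?_⟩
    simp only [Pi.neg_apply]
    rw [hU' x y z p hp]
    abel

/-- `Ȟ¹(X, S)`. -/
def H1 : Type _ := S.cocycles₁ ⧸ S.coboundaries₁.addSubgroupOf S.cocycles₁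

instance : AddCommGroup S.H1 :=
  inferInstanceAs (AddCommGroup (S.cocycles₁ ⧸ S.coboundaries₁.addSubgroupOf S.cocycles₁))

/-- `Ȟ²(X, S)`. -/
def H2 : Type _ := S.cocycles₂ ⧸ S.coboundaries₂.addSubgroupOf S.cocycles₂

instance : AddCommGroup S.H2 :=
  inferInstanceAs (AddCommGroup (S.cocycles₂ ⧸ S.coboundaries₂.addSubgroupOf S.cocycles₂))

/-- The class of a `1`-cocycle. -/
def H1.mk (c : S.cocycles₁) : S.H1 :=
  (QuotientAddGroup.mk c : S.cocycles₁ ⧸ S.coboundaries₁.addSubgroupOf S.cocycles₁)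

/-- The class of a `2`-cocycle. -/
def H2.mk (c : S.cocycles₂) : S.H2 :=
  (QuotientAddGroup.mk c : S.cocycles₂ ⧸ S.coboundaries₂.addSubgroupOf S.cocycles₂)

end Cech

section Cup

variable {X : Type*} [TopologicalSpace X]
  {V₁ V₂ V₃ : X → Type*} [∀ x, AddCommGroup (V₁ x)] [∀ x, AddCommGroup (V₂ x)]
  [∀ x, AddCommGroup (V₃ x)]
  (S₁ : SectionSheaf V₁) (S₂ : SectionSheaf V₂) (S₃ : SectionSheaf V₃)

/-- A biadditive pairing of sheaves `S₁ × S₂ → S₃`. -/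
structure Pairing where
  toFun : ∀ x, V₁ x →+ V₂ x →+ V₃ x
  map_germs : ∀ {p : X} {s : ∀ x, V₁ x} {t : ∀ x, V₂ x}, s ∈ S₁.germs p → t ∈ S₂.germs p →
    (fun x => toFun x (s x) (t x)) ∈ S₃.germs p

variable {S₁ S₂ S₃} (μ : Pairing S₁ S₂ S₃)

namespace Pairing

/-- The cup product of cochains, `(a ∪ b) x y z = μ (a x y) (b y z)`. -/
def cochain (a : X → X → ∀ x, V₁ x) (b : X → X → ∀ x, V₂ x) : X → X → X → ∀ x, V₃ x :=
  fun x y z p => μ.toFun p (a x y p) (b y z p)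

lemma cochain_mem (a : S₁.cocycles₁) (b : S₂.cocycles₁) :
    μ.cochain a.1 b.1 ∈ S₃.cocycles₂ := by
  obtain ⟨a, U, hU, hU'⟩ := a
  obtain ⟨b, W, hW, hW'⟩ := b
  refine ⟨fun x => U x ⊓ W x, fun x y z p hp => μ.map_germs
    (hU x y p ⟨hp.1.1.1, hp.1.2.1⟩) (hW y z p ⟨hp.1.2.2, hp.2.2⟩), fun x y z w p hp => ?_⟩
  have h1 := hU' x y z p ⟨⟨hp.1.1.1.1, hp.1.1.2.1⟩, hp.1.2.1⟩
  have h2 := hW' y z w p ⟨⟨hp.1.1.2.2, hp.1.2.2⟩, hp.2.2⟩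
  have e1 : a x z p = a y z p + a x y p := by rw [← sub_eq_zero, ← neg_eq_zero, ← h1]; abel
  have e2 : b y w p = b z w p + b y z p := by rw [← sub_eq_zero, ← neg_eq_zero, ← h2]; abel
  simp only [cochain, e1, e2, map_add, AddMonoidHom.add_apply]
  abel

/-- The cup product `Ȟ¹(X, S₁) × Ȟ¹(X, S₂) → Ȟ²(X, S₃)` with respect to a pairing. -/
def cup : S₁.H1 → S₂.H1 → S₃.H2 :=
  Quotient.map₂ (fun a b => ⟨μ.cochain a.1 b.1, μ.cochain_mem a b⟩) (by
    intro a a' haa b b' hbb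
    rw [← Quotient.eq_iff_equiv] at haa hbb ⊢
    have haa' := (QuotientAddGroup.eq (s := S₁.coboundaries₁.addSubgroupOf S₁.cocycles₁)).1 haa
    have hbb' := (QuotientAddGroup.eq (s := S₂.coboundaries₁.addSubgroupOf S₂.cocycles₁)).1 hbb
    refine (QuotientAddGroup.eq (s := S₃.coboundaries₂.addSubgroupOf S₃.cocycles₂)).2 ?_
    rw [AddSubgroup.mem_addSubgroupOf] at haa' hbb' ⊢
    obtain ⟨Ua, α, hα, hα'⟩ := haa'
    obtain ⟨Ub, β, hβ, hβ'⟩ := hbb'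
    obtain ⟨Uc, hc, hc'⟩ := a.2
    obtain ⟨Ud, hd, hd'⟩ := b'.2
    refine ⟨fun x => (Ua x ⊓ Ub x) ⊓ (Uc x ⊓ Ud x), fun x y p =>
      μ.toFun p (α x p) (b'.1 x y p) - μ.toFun p (a.1 x y p) (β y p), fun x y p hp =>
      (S₃.germs p).sub_mem (μ.map_germs (hα x p hp.1.1.1) (hd x y p ⟨hp.1.2.2, hp.2.2.2⟩))
      (μ.map_germs (hc x y p ⟨hp.1.2.1, hp.2.2.1⟩) (hβ y p hp.2.1.2)), fun x y z p hp => ?_⟩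
    have h1 := hα' x y p ⟨hp.1.1.1.1, hp.1.2.1.1⟩
    have h2 := hβ' y z p ⟨hp.1.2.1.2, hp.2.1.2⟩
    have h3 := hc' x y z p ⟨⟨hp.1.1.2.1, hp.1.2.2.1⟩, hp.2.2.1⟩
    have h4 := hd' x y z p ⟨⟨hp.1.1.2.2, hp.1.2.2.2⟩, hp.2.2.2⟩
    have e1 : a'.1 x y p = a.1 x y p + (α y p - α x p) := by rw [← h1]; simp
    have e2 : b'.1 y z p = b.1 y z p + (β z p - β y p) := by rw [← h2]; simp
    have e3 : a.1 x z p = a.1 y z p + a.1 x y p := by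
      rw [← sub_eq_zero, ← neg_eq_zero, ← h3]; abel
    have e4 : b'.1 x z p = b'.1 y z p + b'.1 x y p := by
      rw [← sub_eq_zero, ← neg_eq_zero, ← h4]; abel
    have e5 : b.1 y z p = b'.1 y z p - (β z p - β y p) := by rw [e2]; abel
    change - μ.toFun p (a.1 x y p) (b.1 y z p) + μ.toFun p (a'.1 x y p) (b'.1 y z p) = _
    simp only [e3, e4, e1, e5, map_add, map_sub, AddMonoidHom.add_apply, AddMonoidHom.sub_apply]
    abel)

end Pairing
end Cup
end SectionSheaf

section Bundles

variable {EX : Type*} [NormedAddCommGroup EX] [NormedSpace ℂ EX]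
  {X : Type*} [TopologicalSpace X] [ChartedSpace EX X]

section
variable (F : Type*) [NormedAddCommGroup F] [NormedSpace ℂ F]
  (V : X → Type*) [TopologicalSpace (TotalSpace F V)] [∀ x, AddCommGroup (V x)]
  [∀ x, Module ℂ (V x)] [∀ x, TopologicalSpace (V x)] [FiberBundle F V] [VectorBundle ℂ F V]

/-- The sheaf of holomorphic sections of a holomorphic vector bundle `V` on `X`. -/
def holomorphicSections : SectionSheaf V where
  germs p :=
    { carrier := {s | ContMDiffAt 𝓘(ℂ, EX) (𝓘(ℂ, EX).prod 𝓘(ℂ, F)) ω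
        (fun x => TotalSpace.mk' F x (s x)) p}
      zero_mem' := contMDiffAt_zeroSection ℂ V
      add_mem' := fun hs ht => ContMDiffAt.add_section hs ht
      neg_mem' := fun hs => ContMDiffAt.neg_section hs }
  congr {p s t} h hs := by
    refine ContMDiffAt.congr_of_eventuallyEq hs ?_
    filter_upwards [h] with x hx
    rw [hx]
end

variable {F₁ F₂ F₃ : Type*} [NormedAddCommGroup F₁] [NormedSpace ℂ F₁]
  [NormedAddCommGroup F₂] [NormedSpace ℂ F₂] [NormedAddCommGroup F₃] [NormedSpace ℂ F₃]
  {V₁ V₂ V₃ : X → Type*}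
  [TopologicalSpace (TotalSpace F₁ V₁)] [∀ x, AddCommGroup (V₁ x)]
  [∀ x, Module ℂ (V₁ x)] [∀ x, TopologicalSpace (V₁ x)] [FiberBundle F₁ V₁] [VectorBundle ℂ F₁ V₁]
  [TopologicalSpace (TotalSpace F₂ V₂)] [∀ x, AddCommGroup (V₂ x)]
  [∀ x, Module ℂ (V₂ x)] [∀ x, TopologicalSpace (V₂ x)] [FiberBundle F₂ V₂] [VectorBundle ℂ F₂ V₂]
  [∀ x, IsTopologicalAddGroup (V₂ x)] [∀ x, ContinuousSMul ℂ (V₂ x)]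
  [TopologicalSpace (TotalSpace F₃ V₃)] [∀ x, AddCommGroup (V₃ x)]
  [∀ x, Module ℂ (V₃ x)] [∀ x, TopologicalSpace (V₃ x)] [FiberBundle F₃ V₃] [VectorBundle ℂ F₃ V₃]
  [∀ x, IsTopologicalAddGroup (V₃ x)] [∀ x, ContinuousSMul ℂ (V₃ x)]

lemma holomorphicSections_comp {p : X} {A : ∀ x, V₂ x →L[ℂ] V₃ x} {B : ∀ x, V₁ x →L[ℂ] V₂ x}
    (hA : A ∈ (holomorphicSections (EX := EX) (F₂ →L[ℂ] F₃) (fun x => V₂ x →L[ℂ] V₃ x)).germs p)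
    (hB : B ∈ (holomorphicSections (EX := EX) (F₁ →L[ℂ] F₂) (fun x => V₁ x →L[ℂ] V₂ x)).germs p) :
    (fun x => (A x).comp (B x)) ∈
      (holomorphicSections (EX := EX) (F₁ →L[ℂ] F₃) (fun x => V₁ x →L[ℂ] V₃ x)).germs p := by
  have hA' := ((contMDiffAt_hom_bundle _).1 hA).2
  have hB' := ((contMDiffAt_hom_bundle _).1 hB).2
  refine (contMDiffAt_hom_bundle _).2 ⟨contMDiffAt_id, ?_⟩
  refine (hA'.clm_comp hB').congr_of_eventuallyEq ?_
  have h2 := (trivializationAt F₂ V₂ p).open_baseSet.mem_nhds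
    (FiberBundle.mem_baseSet_trivializationAt F₂ V₂ p)
  filter_upwards [h2] with x hx2
  ext v
  simp only [ContinuousLinearMap.inCoordinates, ContinuousLinearMap.comp_apply]
  erw [(trivializationAt F₂ V₂ p).symmL_continuousLinearMapAt hx2]

lemma holomorphicSections_id (p : X) : (fun x => ContinuousLinearMap.id ℂ (V₂ x)) ∈
    (holomorphicSections (EX := EX) (F₂ →L[ℂ] F₂) (fun x => V₂ x →L[ℂ] V₂ x)).germs p := by
  refine (contMDiffAt_hom_bundle _).2 ⟨contMDiffAt_id, ?_⟩
  refine (contMDiffAt_const (c := ContinuousLinearMap.id ℂ F₂)).congr_of_eventuallyEq ?_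
  have h2 := (trivializationAt F₂ V₂ p).open_baseSet.mem_nhds
    (FiberBundle.mem_baseSet_trivializationAt F₂ V₂ p)
  filter_upwards [h2] with x hx2
  ext v
  exact (trivializationAt F₂ V₂ p).continuousLinearMapAt_symmL hx2 v

end Bundles

section Pullback

instance pullbackFiberAddCommGroup {B B' : Type*} (f : B' → B) (V : B → Type*)
    [∀ x, AddCommGroup (V x)] (p : B') : AddCommGroup ((f *ᵖ V) p) :=
  inferInstanceAs (AddCommGroup (V (f p)))

instance pullbackFiberIsTopologicalAddGroup {B B' : Type*} (f : B' → B) (V : B → Type*)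
    [∀ x, AddCommGroup (V x)] [∀ x, TopologicalSpace (V x)] [∀ x, IsTopologicalAddGroup (V x)]
    (p : B') : IsTopologicalAddGroup ((f *ᵖ V) p) :=
  inferInstanceAs (IsTopologicalAddGroup (V (f p)))

instance pullbackFiberContinuousSMul {B B' : Type*} (f : B' → B) (V : B → Type*)
    [∀ x, AddCommGroup (V x)] [∀ x, Module ℂ (V x)] [∀ x, TopologicalSpace (V x)]
    [∀ x, ContinuousSMul ℂ (V x)] (p : B') : ContinuousSMul ℂ ((f *ᵖ V) p) :=
  inferInstanceAs (ContinuousSMul ℂ (V (f p)))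

variable {B B' K F : Type*} {V : B → Type*} [TopologicalSpace B] [TopologicalSpace B']
  [FunLike K B' B] [ContinuousMapClass K B' B] [NormedAddCommGroup F] [NormedSpace ℂ F]
  [TopologicalSpace (TotalSpace F V)] [∀ x, AddCommGroup (V x)]
  [∀ x, Module ℂ (V x)] [∀ x, TopologicalSpace (V x)] [FiberBundle F V] [VectorBundle ℂ F V]

lemma pullback_continuousLinearMapAt (f : K) {p x : B'}
    (h : f x ∈ (trivializationAt F V (f p)).baseSet) (v : V (f x)) :
    (trivializationAt F (f *ᵖ V) p).continuousLinearMapAt ℂ x v =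
      (trivializationAt F V (f p)).continuousLinearMapAt ℂ (f x) v := by
  rw [Trivialization.continuousLinearMapAt_apply, Trivialization.continuousLinearMapAt_apply,
    Trivialization.coe_linearMapAt_of_mem _ h]
  erw [Trivialization.coe_linearMapAt_of_mem (R := ℂ) ((trivializationAt F V (f p)).pullback f) h]
  rfl

lemma pullback_symmL (f : K) {p x : B'}
    (h : f x ∈ (trivializationAt F V (f p)).baseSet) (v : F) :
    (trivializationAt F (f *ᵖ V) p).symmL ℂ x v =
      (trivializationAt F V (f p)).symmL ℂ (f x) v := by
  rw [Trivialization.symmL_apply _ h]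
  erw [Trivialization.symmL_apply ((trivializationAt F V (f p)).pullback f) h]
  apply ((trivializationAt F V (f p)).continuousLinearEquivAt ℂ (f x) h).injective
  have h1 := (trivializationAt F V (f p)).apply_mk_symm h v
  have h2 := ((trivializationAt F V (f p)).pullback f).apply_mk_symm (b := x) h v
  exact (congrArg Prod.snd h2).trans (congrArg Prod.snd h1).symm

end Pullback

section Submanifold

variable {EX : Type*} [NormedAddCommGroup EX] [NormedSpace ℂ EX]
  {EY : Type*} [NormedAddCommGroup EY] [NormedSpace ℂ EY]
  {X : Type*} [TopologicalSpace X] [ChartedSpace EX X]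
  {Y : Type*} [TopologicalSpace Y] [ChartedSpace EY Y]

/-- The restriction `T_{Y|X} = ι^* T_Y` of the tangent bundle of `Y` to `X`. -/
abbrev AmbientTangent (ι : C^ω⟮𝓘(ℂ, EX), X; 𝓘(ℂ, EY), Y⟯) : X → Type _ :=
  ι *ᵖ (TangentSpace 𝓘(ℂ, EY) : Y → Type _)

/-- The differential `T_X → T_{Y|X}` of the embedding. -/
def tangentInclusion (ι : C^ω⟮𝓘(ℂ, EX), X; 𝓘(ℂ, EY), Y⟯) (p : X) :
    TangentSpace 𝓘(ℂ, EX) p →L[ℂ] AmbientTangent ι p :=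
  mfderiv 𝓘(ℂ, EX) 𝓘(ℂ, EY) ι p

/-- The fibre at `p` of the normal bundle `N_{X/Y} = T_{Y|X} / T_X`. -/
abbrev NormalFiber (ι : C^ω⟮𝓘(ℂ, EX), X; 𝓘(ℂ, EY), Y⟯) (p : X) : Type _ :=
  AmbientTangent ι p ⧸ (tangentInclusion ι p).range

/-- The projection `T_{Y|X} → N_{X/Y}`. -/
def normalProj (ι : C^ω⟮𝓘(ℂ, EX), X; 𝓘(ℂ, EY), Y⟯) (p : X) :
    AmbientTangent ι p →L[ℂ] NormalFiber ι p :=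
  (tangentInclusion ι p).range.mkQL

lemma exists_descend (ι : C^ω⟮𝓘(ℂ, EX), X; 𝓘(ℂ, EY), Y⟯) {W : X → Type*} [∀ x, AddCommGroup (W x)]
    [∀ x, Module ℂ (W x)] [∀ x, TopologicalSpace (W x)]
    (A : ∀ x, AmbientTangent ι x →L[ℂ] W x) :
    ∃ a : ∀ x, NormalFiber ι x →L[ℂ] W x, ∀ x,
      (∀ v, A x (tangentInclusion ι x v) = 0) → (a x).comp (normalProj ι x) = A x := by
  classical
  refine ⟨fun x => if h : (tangentInclusion ι x).range ≤ (A x).ker then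
    (tangentInclusion ι x).range.liftQL (A x) h else 0, fun x hx => ?_⟩
  have h : (tangentInclusion ι x).range ≤ (A x).ker := by
    rintro _ ⟨v, rfl⟩
    exact hx v
  beta_reduce
  rw [dif_pos h]
  ext v
  rfl

variable [IsManifold 𝓘(ℂ, EX) ω X] [IsManifold 𝓘(ℂ, EY) ω Y]
  (ι : C^ω⟮𝓘(ℂ, EX), X; 𝓘(ℂ, EY), Y⟯)

lemma tangentInclusion_mem (p : X) : tangentInclusion ι ∈
    (holomorphicSections (EX := EX) (EX →L[ℂ] EY)
      (fun x => TangentSpace 𝓘(ℂ, EX) x →L[ℂ] AmbientTangent ι x)).germs p := by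
  have key := ContMDiffAt.mfderiv_const (ι.contMDiff p) (m := ω) (n := ω) (by rfl)
  have h1 : ι ⁻¹' (trivializationAt EY (TangentSpace 𝓘(ℂ, EY)) (ι p)).baseSet ∈ 𝓝 p :=
    ι.contMDiff.continuous.continuousAt.preimage_mem_nhds
      ((trivializationAt EY (TangentSpace 𝓘(ℂ, EY)) (ι p)).open_baseSet.mem_nhds
        (FiberBundle.mem_baseSet_trivializationAt _ _ _))
  refine (contMDiffAt_hom_bundle _).2 ⟨contMDiffAt_id, key.congr_of_eventuallyEq ?_⟩
  filter_upwards [h1] with x hx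
  ext v
  exact pullback_continuousLinearMapAt ι hx _

section

variable (F : Type*) [NormedAddCommGroup F] [NormedSpace ℂ F]
  (W : X → Type*) [TopologicalSpace (TotalSpace F W)] [∀ x, AddCommGroup (W x)]
  [∀ x, Module ℂ (W x)] [∀ x, TopologicalSpace (W x)] [FiberBundle F W] [VectorBundle ℂ F W]
  [∀ x, IsTopologicalAddGroup (W x)] [∀ x, ContinuousSMul ℂ (W x)]

/-- The sheaf of holomorphic sections of `Hom(N_{X/Y}, W)`, for a holomorphic vector bundle `W`.
As `T_{Y|X} → N_{X/Y}` is a holomorphic surjection of bundles, a section of `Hom(N_{X/Y}, W)` is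
holomorphic exactly if the induced section of `Hom(T_{Y|X}, W)` is.  For `W = End E` this is the
sheaf `N_{X/Y}^* ⊗ End E`. -/
def normalHomSections : SectionSheaf (fun p => NormalFiber ι p →L[ℂ] W p) where
  germs p := ((holomorphicSections (EX := EX) (EY →L[ℂ] F)
      (fun x => AmbientTangent ι x →L[ℂ] W x)).germs p).comap
    { toFun := fun s x => (s x).comp (normalProj ι x)
      map_zero' := rfl
      map_add' := fun _ _ => rfl }
  congr {p s t} h hs := by
    refine (holomorphicSections (EX := EX) (EY →L[ℂ] F)
      (fun x => AmbientTangent ι x →L[ℂ] W x)).congr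
      (s := fun x => (s x).comp (normalProj ι x)) ?_ hs
    filter_upwards [h] with x hx
    exact congrArg (fun a => ContinuousLinearMap.comp a (normalProj ι x)) hx

end

lemma exists_retraction (hι : Manifold.IsSmoothEmbedding 𝓘(ℂ, EX) 𝓘(ℂ, EY) ω ι) (p : X) :
    ∃ (U : OpenNhdsOf p) (ρ : ∀ x, AmbientTangent ι x →L[ℂ] TangentSpace 𝓘(ℂ, EX) x),
      (holomorphicSections (EX := EX) (EY →L[ℂ] EX)
        (fun x => AmbientTangent ι x →L[ℂ] TangentSpace 𝓘(ℂ, EX) x)).IsSection U ρ ∧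
      ∀ x ∈ U, ∀ v, ρ x (tangentInclusion ι x v) = v := by
  obtain ⟨G, _, _, h⟩ := hι.isImmersion
  have h := h p
  set r : Y → X := fun y => (h.domChart.extend 𝓘(ℂ, EX)).symm
    (h.equiv.symm (h.codChart.extend 𝓘(ℂ, EY) y)).1 with hr
  have hw : ∀ x ∈ h.domChart.source, h.equiv.symm (h.codChart.extend 𝓘(ℂ, EY) (ι x)) =
      (h.domChart.extend 𝓘(ℂ, EX) x, 0) := by
    intro x hx
    have h1 := h.writtenInCharts ((h.domChart.extend 𝓘(ℂ, EX)).map_source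
      (by rwa [h.domChart.extend_source]))
    simp only [Function.comp_apply] at h1
    rw [h.domChart.extend_left_inv hx] at h1
    rw [h1, ContinuousLinearEquiv.symm_apply_apply]
  have hrι : ∀ x ∈ h.domChart.source, r (ι x) = x := by
    intro x hx
    simp only [hr, hw x hx]
    exact h.domChart.extend_left_inv hx
  have hrd : ∀ x ∈ h.domChart.source, ContMDiffAt 𝓘(ℂ, EY) 𝓘(ℂ, EX) ω r (ι x) := by
    intro x hx
    have h1 : ContMDiffAt 𝓘(ℂ, EY) 𝓘(ℂ, EY) ω (h.codChart.extend 𝓘(ℂ, EY)) (ι x) :=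
      contMDiffAt_of_mem_maximalAtlas h.codChart_mem_maximalAtlas
        (h.source_subset_preimage_source hx)
    have h2 : ContMDiffAt 𝓘(ℂ, EY) 𝓘(ℂ, EX) ω
        (fun y => (h.equiv.symm (h.codChart.extend 𝓘(ℂ, EY) y)).1) (ι x) :=
      ContMDiffAt.comp (I' := 𝓘(ℂ, EY)) (g := (ContinuousLinearMap.fst ℂ EX G).comp
        (h.equiv.symm : EY →L[ℂ] EX × G)) (ι x) (ContinuousLinearMap.contMDiff _).contMDiffAt h1
    refine ContMDiffAt.comp (I' := 𝓘(ℂ, EX)) (ι x) ?_ h2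
    rw [hw x hx]
    exact contMDiffAt_symm_of_mem_maximalAtlas h.domChart_mem_maximalAtlas
      (h.domChart.map_source hx)
  let U : OpenNhdsOf p := ⟨⟨h.domChart.source, h.domChart.open_source⟩, h.mem_domChart_source⟩
  refine ⟨U, fun x => (mfderiv 𝓘(ℂ, EY) 𝓘(ℂ, EX) r (ι x) : EY →L[ℂ] EX), ?_, ?_⟩
  · intro x hx
    have key := ContMDiffAt.mfderiv (m := ω) (n := ω) (fun _ : X => r) ι
      (ContMDiffAt.comp (I' := 𝓘(ℂ, EY)) (x, ι x) (hrd x hx) contMDiffAt_snd)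
      (ι.contMDiff x) (by rfl)
    refine (contMDiffAt_hom_bundle _).2 ⟨contMDiffAt_id, key.congr_of_eventuallyEq ?_⟩
    have h1 : ι ⁻¹' (trivializationAt EY (TangentSpace 𝓘(ℂ, EY)) (ι x)).baseSet ∈ 𝓝 x :=
      ι.contMDiff.continuous.continuousAt.preimage_mem_nhds
        ((trivializationAt EY (TangentSpace 𝓘(ℂ, EY)) (ι x)).open_baseSet.mem_nhds
          (FiberBundle.mem_baseSet_trivializationAt _ _ _))
    filter_upwards [h1, h.domChart.open_source.mem_nhds hx] with x' hx' hx''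
    ext v
    have e1 : ∀ q₀ q : X, q₀ = x → q = x' → ∀ w : EX,
        (trivializationAt EX (TangentSpace 𝓘(ℂ, EX)) x).continuousLinearMapAt ℂ x' w =
          (trivializationAt EX (TangentSpace 𝓘(ℂ, EX)) q₀).continuousLinearMapAt ℂ q w := by
      rintro _ _ rfl rfl _
      rfl
    have e2 := pullback_symmL (F := EY) (V := (TangentSpace 𝓘(ℂ, EY) : Y → Type _)) ι hx' v
    refine Eq.trans ?_ (e1 _ _ (hrι x hx) (hrι x' hx'') _)
    exact congrArg (fun w : EY => (trivializationAt EX (TangentSpace 𝓘(ℂ, EX)) x).continuousLinearMapAt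
      ℂ x' ((mfderiv 𝓘(ℂ, EY) 𝓘(ℂ, EX) r (ι x') : EY →L[ℂ] EX) w)) e2
  · intro x hx v
    have h1 := (((hrd x hx).mdifferentiableAt (by simp)).hasMFDerivAt.comp x
      ((ι.contMDiff x).mdifferentiableAt (by simp)).hasMFDerivAt)
    have h2 : HasMFDerivAt 𝓘(ℂ, EX) 𝓘(ℂ, EX) (r ∘ ι) x
        (ContinuousLinearMap.id ℂ (TangentSpace 𝓘(ℂ, EX) x)) :=
      (hasMFDerivAt_id x).congr_of_eventuallyEq (by
        filter_upwards [h.domChart.open_source.mem_nhds hx] with x' hx'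
        exact hrι x' hx')
    exact congrArg (fun L : EX →L[ℂ] EX => L v) (hasMFDerivAt_unique h1 h2)

/-- `κ` is represented by a cocycle `c x y = Ψ x - Ψ y`, where the `Ψ x` are holomorphic
sections over `U x` of `Hom(N_{X/Y}, T_{Y|X})` that split the projection `T_{Y|X} → N_{X/Y}`; the
difference `Ψ x - Ψ y` takes its values in `T_X ⊆ T_{Y|X}`. -/
def IsKodairaSpencerClass
    (κ : (normalHomSections ι EX (TangentSpace 𝓘(ℂ, EX) : X → Type _)).H1) : Prop :=
  ∃ (U : ∀ x : X, OpenNhdsOf x) (Ψ : X → ∀ p, NormalFiber ι p →L[ℂ] AmbientTangent ι p)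
    (c : (normalHomSections ι EX (TangentSpace 𝓘(ℂ, EX) : X → Type _)).cocycles₁),
    (∀ x, (normalHomSections ι EY (AmbientTangent ι)).IsSection (U x) (Ψ x)) ∧
    (∀ x, ∀ p ∈ (U x : Set X), ∀ n, normalProj ι p (Ψ x p n) = n) ∧
    (∀ x y, ∀ p ∈ (U x : Set X) ∩ U y, ∀ n,
      tangentInclusion ι p (c.1 x y p n) = Ψ x p n - Ψ y p n) ∧
    κ = SectionSheaf.H1.mk _ c

lemma exists_isKodairaSpencerClass
    (hι : Manifold.IsSmoothEmbedding 𝓘(ℂ, EX) 𝓘(ℂ, EY) ω ι) :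
    ∃ κ, IsKodairaSpencerClass ι κ := by
  choose U ρ hρ hρι using exists_retraction ι hι
  choose Ψ hΨ using fun x => exists_descend ι
    (fun p => ContinuousLinearMap.id ℂ (AmbientTangent ι p) - (tangentInclusion ι p).comp (ρ x p))
  choose c hc using fun x y => exists_descend ι (fun p => ρ y p - ρ x p)
  have hΨ' : ∀ x, ∀ p ∈ (U x : Set X), (Ψ x p).comp (normalProj ι p) =
      ContinuousLinearMap.id ℂ (AmbientTangent ι p) - (tangentInclusion ι p).comp (ρ x p) := by
    intro x p hp
    refine hΨ x p fun v => ?_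
    simp [hρι x p hp]
  have hc' : ∀ x y, ∀ p ∈ (U x : Set X) ∩ U y, (c x y p).comp (normalProj ι p) =
      ρ y p - ρ x p := by
    intro x y p hp
    refine hc x y p fun v => ?_
    simp [hρι x p hp.1, hρι y p hp.2]
  have hcc : c ∈ (normalHomSections ι EX (TangentSpace 𝓘(ℂ, EX) : X → Type _)).cocycles₁ := by
    refine ⟨U, fun x y p hp => ?_, fun x y z p hp => ?_⟩
    · refine (holomorphicSections (EX := EX) (EY →L[ℂ] EX)
        (fun x => AmbientTangent ι x →L[ℂ] TangentSpace 𝓘(ℂ, EX) x)).congr ?_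
        (AddSubgroup.sub_mem _ (hρ y p hp.2) (hρ x p hp.1))
      filter_upwards [((U x).is_open'.inter (U y).is_open').mem_nhds hp] with q hq
      exact (hc' x y q hq).symm
    · ext n
      obtain ⟨v, rfl⟩ := (tangentInclusion ι p).range.mkQ_surjective n
      have h1 := congrArg (fun L => L v) (hc' x y p ⟨hp.1.1, hp.1.2⟩)
      have h2 := congrArg (fun L => L v) (hc' x z p ⟨hp.1.1, hp.2⟩)
      have h3 := congrArg (fun L => L v) (hc' y z p ⟨hp.1.2, hp.2⟩)
      change c y z p (normalProj ι p v) - c x z p (normalProj ι p v) +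
        c x y p (normalProj ι p v) = 0
      simp only [ContinuousLinearMap.comp_apply, sub_apply] at h1 h2 h3
      rw [h1, h2, h3]
      abel
  refine ⟨_, U, Ψ, ⟨c, hcc⟩, fun x p hp => ?_, fun x p hp n => ?_, fun x y p hp n => ?_, rfl⟩
  · have hid : (fun x => ContinuousLinearMap.id ℂ (AmbientTangent ι x)) ∈
        (holomorphicSections (EX := EX) (EY →L[ℂ] EY)
          (fun x => AmbientTangent ι x →L[ℂ] AmbientTangent ι x)).germs p :=
      holomorphicSections_id p
    refine (holomorphicSections (EX := EX) (EY →L[ℂ] EY)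
      (fun x => AmbientTangent ι x →L[ℂ] AmbientTangent ι x)).congr ?_
      (AddSubgroup.sub_mem _ hid (holomorphicSections_comp (tangentInclusion_mem ι p) (hρ x p hp)))
    filter_upwards [(U x).is_open'.mem_nhds hp] with q hq
    exact (hΨ' x q hq).symm
  · obtain ⟨v, rfl⟩ := (tangentInclusion ι p).range.mkQ_surjective n
    have h1 := congrArg (fun L => normalProj ι p (L v)) (hΨ' x p hp)
    refine h1.trans ?_
    simp only [sub_apply, map_sub]
    have : normalProj ι p (((tangentInclusion ι p).comp (ρ x p)) v) = 0 :=
      (Submodule.Quotient.mk_eq_zero _).2 ⟨ρ x p v, rfl⟩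
    rw [this, sub_zero]
    rfl
  · obtain ⟨v, rfl⟩ := (tangentInclusion ι p).range.mkQ_surjective n
    have h1 := congrArg (fun L => L v) (hΨ' x p hp.1)
    have h2 := congrArg (fun L => L v) (hΨ' y p hp.2)
    have h3 := congrArg (fun L => tangentInclusion ι p (L v)) (hc' x y p hp)
    refine h3.trans ((?_ : _ = _).trans (congrArg₂ (· - ·) h1 h2).symm)
    simp

/-- The Kodaira–Spencer invariant `κ_{X/Y} ∈ H¹(X, Hom(N_{X/Y}, T_X))`.  The class does not depend
on the choice of the cover and of the local splittings. -/
def kodairaSpencerClass (hι : Manifold.IsSmoothEmbedding 𝓘(ℂ, EX) 𝓘(ℂ, EY) ω ι) :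
    (normalHomSections ι EX (TangentSpace 𝓘(ℂ, EX) : X → Type _)).H1 :=
  (exists_isKodairaSpencerClass ι hι).choose

end Submanifold

section Atiyah

variable {EX : Type*} [NormedAddCommGroup EX] [NormedSpace ℂ EX]
  {X : Type*} [TopologicalSpace X] [ChartedSpace EX X] [IsManifold 𝓘(ℂ, EX) ω X]
  (F : Type*) [NormedAddCommGroup F] [NormedSpace ℂ F]
  (E : X → Type*) [TopologicalSpace (TotalSpace F E)] [∀ x, AddCommGroup (E x)]
  [∀ x, Module ℂ (E x)] [∀ x, TopologicalSpace (E x)] [FiberBundle F E] [VectorBundle ℂ F E]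
  [∀ x, IsTopologicalAddGroup (E x)] [∀ x, ContinuousSMul ℂ (E x)]

/-- The bundle `End E`. -/
abbrev EndBundle : X → Type _ := fun x => E x →L[ℂ] E x

/-- The sheaf `Ω¹_X ⊗ End E` of holomorphic sections of `Hom(T_X, End E)`. -/
def atiyahSheaf : SectionSheaf (fun x : X => TangentSpace 𝓘(ℂ, EX) x →L[ℂ] EndBundle E x) :=
  holomorphicSections (EX := EX) (EX →L[ℂ] (F →L[ℂ] F))
    (fun x => TangentSpace 𝓘(ℂ, EX) x →L[ℂ] EndBundle E x)

/-- The transition function `g_{xy} = e_x e_y⁻¹` of `E`, where `e_x : E_p → F` is the preferred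
local trivialization of `E` around `x`; it is meaningful at `p` in both base sets. -/
def bundleTransition (x y p : X) : F →L[ℂ] F :=
  (trivializationAt F E y).coordChangeL ℂ (trivializationAt F E x) p

/-- The differential `dg_{xy}` at `p`. -/
def transitionDeriv (x y p : X) : TangentSpace 𝓘(ℂ, EX) p →L[ℂ] (F →L[ℂ] F) :=
  mfderiv 𝓘(ℂ, EX) 𝓘(ℂ, F →L[ℂ] F) (bundleTransition F E x y) p

/-- The Atiyah cocycle `A_{xy} = e_x⁻¹ ∘ dg_{xy} ∘ e_y`.  In the trivialization `e_z` it is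
`g_{zx} dg_{xz} - g_{zy} dg_{yz}`; it is the difference `∇_x - ∇_y` of the flat holomorphic
connections given by the trivializations `e_x` and `e_y`. -/
def atiyahCochain (x y p : X) : TangentSpace 𝓘(ℂ, EX) p →L[ℂ] EndBundle E p :=
  (((trivializationAt F E y).continuousLinearMapAt ℂ p).precomp (E p)).comp
    ((((trivializationAt F E x).symmL ℂ p).postcomp F).comp
      (transitionDeriv F E x y p))

variable [ContMDiffVectorBundle ω F E 𝓘(ℂ, EX)]

lemma contMDiffAt_bundleTransition {x y p : X} (hx : p ∈ (trivializationAt F E x).baseSet)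
    (hy : p ∈ (trivializationAt F E y).baseSet) :
    ContMDiffAt 𝓘(ℂ, EX) 𝓘(ℂ, F →L[ℂ] F) ω (bundleTransition F E x y) p :=
  contMDiffAt_coordChangeL hy hx

lemma atiyahCochain_apply (x y p : X) (v : TangentSpace 𝓘(ℂ, EX) p) (w : E p) :
    atiyahCochain (EX := EX) F E x y p v w = (trivializationAt F E x).symmL ℂ p
      (transitionDeriv F E x y p v ((trivializationAt F E y).continuousLinearMapAt ℂ p w)) := rfl

lemma bundleTransition_apply {x y p : X} (hx : p ∈ (trivializationAt F E x).baseSet)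
    (hy : p ∈ (trivializationAt F E y).baseSet) (u : F) :
    bundleTransition F E x y p u = (trivializationAt F E x).continuousLinearMapAt ℂ p
      ((trivializationAt F E y).symmL ℂ p u) := by
  simp only [bundleTransition, ContinuousLinearEquiv.coe_coe]
  rw [Trivialization.coordChangeL_apply _ _ ⟨hy, hx⟩, Trivialization.continuousLinearMapAt_apply,
    Trivialization.coe_linearMapAt_of_mem _ hx, Trivialization.symmL_apply _ hy]

lemma bundleTransition_comp {x y z p : X} (hx : p ∈ (trivializationAt F E x).baseSet)
    (hy : p ∈ (trivializationAt F E y).baseSet) (hz : p ∈ (trivializationAt F E z).baseSet) :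
    bundleTransition F E x z p = (bundleTransition F E x y p).comp (bundleTransition F E y z p) := by
  ext v
  rw [ContinuousLinearMap.comp_apply, bundleTransition_apply F E hx hz, bundleTransition_apply F E hx hy,
    bundleTransition_apply F E hy hz, Trivialization.symmL_continuousLinearMapAt _ hy]

lemma atiyahCochain_mem_germs {x y p : X} (hx : p ∈ (trivializationAt F E x).baseSet)
    (hy : p ∈ (trivializationAt F E y).baseSet) :
    atiyahCochain F E x y ∈ (atiyahSheaf (EX := EX) F E).germs p := by
  refine (contMDiffAt_hom_bundle _).2 ⟨contMDiffAt_id, ?_⟩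
  have key : ContMDiffAt 𝓘(ℂ, EX) 𝓘(ℂ, EX →L[ℂ] (F →L[ℂ] F)) ω _ p :=
    ContMDiffAt.mfderiv_const (contMDiffAt_bundleTransition (EX := EX) F E hx hy) (m := ω) (n := ω) (by rfl)
  have hp := FiberBundle.mem_baseSet_trivializationAt F E p
  have k1 := (contMDiffAt_bundleTransition (EX := EX) F E hp hx).clm_postcomp (F₁ := F)
  have k2 := (contMDiffAt_bundleTransition (EX := EX) F E hy hp).clm_precomp (F₃ := F)
  refine (k2.clm_comp (k1.clm_comp key)).congr_of_eventuallyEq ?_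
  filter_upwards [(trivializationAt F E p).open_baseSet.mem_nhds hp,
    (trivializationAt F E x).open_baseSet.mem_nhds hx,
    (trivializationAt F E y).open_baseSet.mem_nhds hy] with q hq hqx hqy
  have e1 : ∀ φ : EndBundle E q, (trivializationAt (F →L[ℂ] F) (EndBundle E) p).continuousLinearMapAt
      ℂ q φ = ((trivializationAt F E p).continuousLinearMapAt ℂ q).comp
        (φ.comp ((trivializationAt F E p).symmL ℂ q)) := by
    intro φ
    rw [Trivialization.continuousLinearMapAt_apply, Trivialization.coe_linearMapAt_of_mem]
    · rfl
    · exact ⟨hq, hq⟩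
  ext v w
  refine (congrArg (fun L : F →L[ℂ] F => L w) (e1 _)).trans ?_
  refine Eq.trans ?_ (bundleTransition_apply F E hq hqx _).symm
  refine congrArg (fun u => (trivializationAt F E p).continuousLinearMapAt ℂ q
    ((trivializationAt F E x).symmL ℂ q u)) ?_
  have e2 : inTangentCoordinates 𝓘(ℂ, EX) 𝓘(ℂ, F →L[ℂ] F) id (bundleTransition F E x y)
      (fun q => mfderiv 𝓘(ℂ, EX) 𝓘(ℂ, F →L[ℂ] F) (bundleTransition F E x y) q) p q v =
      transitionDeriv (EX := EX) F E x y q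
        ((trivializationAt EX (TangentSpace 𝓘(ℂ, EX)) p).symmL ℂ q v) := by
    simp only [inTangentCoordinates, ContinuousLinearMap.inCoordinates]
    erw [TangentBundle.continuousLinearMapAt_model_space]
    rfl
  exact (congrArg (transitionDeriv (EX := EX) F E x y q _)
    (bundleTransition_apply F E hqy hq w).symm).trans
    (congrArg (fun L : F →L[ℂ] F => L (bundleTransition F E y p q w)) e2.symm)

lemma atiyahCochain_mem : atiyahCochain F E ∈ (atiyahSheaf (EX := EX) F E).cocycles₁ := by
  refine ⟨fun x => ⟨⟨(trivializationAt F E x).baseSet, (trivializationAt F E x).open_baseSet⟩,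
    FiberBundle.mem_baseSet_trivializationAt F E x⟩,
    fun x y p hp => atiyahCochain_mem_germs F E hp.1 hp.2, fun x y z p hp => ?_⟩
  obtain ⟨⟨hx, hy⟩, hz⟩ := hp
  have h1 : transitionDeriv (EX := EX) F E x z p =
      ((ContinuousLinearMap.compL ℂ F F F) (bundleTransition F E x y p)).comp (transitionDeriv F E y z p) +
      ((ContinuousLinearMap.compL ℂ F F F).flip (bundleTransition F E y z p)).comp
        (transitionDeriv F E x y p) := by
    have hb := (ContinuousLinearMap.compL ℂ F F F).isBoundedBilinearMap.hasFDerivAt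
      (bundleTransition F E x y p, bundleTransition F E y z p)
    have h1 := ((contMDiffAt_bundleTransition (EX := EX) F E hx hy).mdifferentiableAt
      (by simp)).hasMFDerivAt
    have h2 := ((contMDiffAt_bundleTransition (EX := EX) F E hy hz).mdifferentiableAt
      (by simp)).hasMFDerivAt
    have hg : HasMFDerivAt 𝓘(ℂ, EX) 𝓘(ℂ, (F →L[ℂ] F) × (F →L[ℂ] F))
        (fun q => (bundleTransition F E x y q, bundleTransition F E y z q)) p
        ((transitionDeriv F E x y p).prod (transitionDeriv F E y z p)) :=
      ⟨h1.1.prodMk h2.1, h1.2.prodMk h2.2⟩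
    have hm : HasMFDerivAt 𝓘(ℂ, EX) 𝓘(ℂ, F →L[ℂ] F) (bundleTransition F E x z) p _ :=
      (HasMFDerivAt.comp (I' := 𝓘(ℂ, (F →L[ℂ] F) × (F →L[ℂ] F))) p hb.hasMFDerivAt
        hg).congr_of_eventuallyEq (by
        filter_upwards [(trivializationAt F E x).open_baseSet.mem_nhds hx,
          (trivializationAt F E y).open_baseSet.mem_nhds hy,
          (trivializationAt F E z).open_baseSet.mem_nhds hz] with q hqx hqy hqz
        exact bundleTransition_comp F E hqx hqy hqz)
    refine hm.mfderiv.trans ?_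
    ext v w
    rfl
  ext v w
  change atiyahCochain F E y z p v w - atiyahCochain F E x z p v w +
    atiyahCochain F E x y p v w = 0
  have h2 : transitionDeriv (EX := EX) F E x z p v ((trivializationAt F E z).continuousLinearMapAt
      ℂ p w) = bundleTransition F E x y p (transitionDeriv F E y z p v
        ((trivializationAt F E z).continuousLinearMapAt ℂ p w)) +
      transitionDeriv F E x y p v (bundleTransition F E y z p
        ((trivializationAt F E z).continuousLinearMapAt ℂ p w)) := by
    rw [h1]
    rfl
  simp only [atiyahCochain_apply, h2, map_add]
  rw [bundleTransition_apply F E hx hy, bundleTransition_apply F E hy hz,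
    Trivialization.symmL_continuousLinearMapAt _ hx,
    Trivialization.symmL_continuousLinearMapAt _ hz]
  abel

/-- The Atiyah class `At(E) ∈ H¹(X, Ω¹_X ⊗ End E)`. -/
def atiyahClass : (atiyahSheaf (EX := EX) F E).H1 :=
  SectionSheaf.H1.mk _ ⟨atiyahCochain F E, atiyahCochain_mem F E⟩

variable {EY : Type*} [NormedAddCommGroup EY] [NormedSpace ℂ EY]
  {Y : Type*} [TopologicalSpace Y] [ChartedSpace EY Y] [IsManifold 𝓘(ℂ, EY) ω Y]
  (ι : C^ω⟮𝓘(ℂ, EX), X; 𝓘(ℂ, EY), Y⟯)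

/-- The trace over `T_X`, `(Ω¹_X ⊗ End E) ⊗ Hom(N_{X/Y}, T_X) → N_{X/Y}^* ⊗ End E`.  With
`Ω¹_X ⊗ End E = Hom(T_X, End E)` this contraction is the composition of homomorphisms. -/
def tracePairing : SectionSheaf.Pairing (atiyahSheaf (EX := EX) F E)
    (normalHomSections ι EX (TangentSpace 𝓘(ℂ, EX) : X → Type _))
    (normalHomSections ι (F →L[ℂ] F) (EndBundle E)) where
  toFun x :=
    { toFun := fun a =>
        { toFun := fun k => a.comp k
          map_zero' := ContinuousLinearMap.comp_zero a
          map_add' := fun k l => ContinuousLinearMap.comp_add a k l }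
      map_zero' := by ext; rfl
      map_add' := fun a b => by ext; rfl }
  map_germs {p s t} hs ht := by
    change (fun x => (s x).comp ((t x).comp (normalProj ι x))) ∈
      (holomorphicSections (EX := EX) (EY →L[ℂ] (F →L[ℂ] F))
        (fun x => AmbientTangent ι x →L[ℂ] EndBundle E x)).germs p
    exact holomorphicSections_comp hs ht

end Atiyah

section Thickening

variable {EX : Type*} [NormedAddCommGroup EX] [NormedSpace ℂ EX]
  {EY : Type*} [NormedAddCommGroup EY] [NormedSpace ℂ EY]
  {X Y : Type u} [TopologicalSpace X] [ChartedSpace EX X]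
  [TopologicalSpace Y] [ChartedSpace EY Y]

/-- The ring `𝒪_{Y,y}` of germs at `y` of holomorphic functions on `Y`. -/
def holomorphicGerms (EY : Type*) [NormedAddCommGroup EY] [NormedSpace ℂ EY]
    {Y : Type u} [TopologicalSpace Y] [ChartedSpace EY Y] (y : Y) : Subring ((𝓝 y).Germ ℂ) where
  carrier := {g | ∃ f : Y → ℂ, ContMDiffAt 𝓘(ℂ, EY) 𝓘(ℂ) ω f y ∧ (f : (𝓝 y).Germ ℂ) = g}
  zero_mem' := ⟨fun _ => 0, contMDiffAt_const, rfl⟩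
  one_mem' := ⟨fun _ => 1, contMDiffAt_const, rfl⟩
  add_mem' := by
    rintro _ _ ⟨f, hf, rfl⟩ ⟨g, hg, rfl⟩
    exact ⟨f + g, hf.add hg, rfl⟩
  mul_mem' := by
    rintro _ _ ⟨f, hf, rfl⟩ ⟨g, hg, rfl⟩
    exact ⟨f * g, hf.mul hg, rfl⟩
  neg_mem' := by
    rintro _ ⟨f, hf, rfl⟩
    exact ⟨-f, hf.neg, rfl⟩

variable (ι : C^ω⟮𝓘(ℂ, EX), X; 𝓘(ℂ, EY), Y⟯)

/-- The stalk at `x` of the ideal sheaf `ℐ` of `X`: the germs in `𝒪_{Y,x}` that vanish on `X`. -/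
def idealGerms (x : X) : Ideal (holomorphicGerms EY (ι x)) where
  carrier := {g | ∃ f : Y → ℂ, (f : (𝓝 (ι x)).Germ ℂ) = g.1 ∧
    ∀ᶠ y in 𝓝 (ι x), y ∈ Set.range ι → f y = 0}
  zero_mem' := ⟨fun _ => 0, rfl, by simp⟩
  add_mem' := by
    rintro a b ⟨f, hf, hf'⟩ ⟨g, hg, hg'⟩
    refine ⟨f + g, ?_, ?_⟩
    · rw [Subring.coe_add, ← hf, ← hg]
      rfl
    · filter_upwards [hf', hg'] with y h1 h2 hy
      simp [h1 hy, h2 hy]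
  smul_mem' := by
    rintro ⟨_, k, hk, rfl⟩ b ⟨g, hg, hg'⟩
    refine ⟨k * g, ?_, ?_⟩
    · rw [smul_eq_mul, Subring.coe_mul, ← hg]
      rfl
    · filter_upwards [hg'] with y h2 hy
      simp [h2 hy]

/-- The stalk `𝒪_{Y,x} / ℐ_x²` of the structure sheaf of `X₁`. -/
abbrev ThickStalk (x : X) : Type u := holomorphicGerms EY (ι x) ⧸ idealGerms ι x ^ 2

/-- The image in `𝒪_{Y,x} / ℐ_x²` of a function on `Y` that is holomorphic at `x`. -/
def thickGerm (x : X) (f : Y → ℂ) (hf : ContMDiffAt 𝓘(ℂ, EY) 𝓘(ℂ) ω f (ι x)) : ThickStalk ι x :=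
  Ideal.Quotient.mk _ ⟨(f : (𝓝 (ι x)).Germ ℂ), f, hf, rfl⟩

/-- The value at `x` of an element of `𝒪_{Y,x} / ℐ_x²`. -/
def thickValue (x : X) : ThickStalk ι x →+* ℂ :=
  Ideal.Quotient.lift (idealGerms ι x ^ 2)
    ((Filter.Germ.valueRingHom (E := ℂ)).comp (holomorphicGerms EY (ι x)).subtype) (by
    intro a ha
    have h0 : idealGerms ι x ≤ RingHom.ker
        ((Filter.Germ.valueRingHom (E := ℂ)).comp (holomorphicGerms EY (ι x)).subtype) := by
      rintro g ⟨f, hf, hf'⟩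
      rw [RingHom.mem_ker, RingHom.comp_apply, Subring.subtype_apply, ← hf]
      exact hf'.self_of_nhds ⟨x, rfl⟩
    exact h0 (Ideal.pow_le_self two_ne_zero ha))

/-- The ring `𝒪_{X₁}(U)` of sections of the sheaf `𝒪_Y / ℐ²` over the open set `U ⊆ X`: families
of elements of the stalks that are locally induced by holomorphic functions on `Y`. -/
def thickSections (U : Opens X) : Subring (∀ x : U, ThickStalk ι (x : X)) where
  carrier := {s | ∀ x : U, ∃ f : Y → ℂ, ∀ᶠ x' : U in 𝓝 x,
    ∃ hf : ContMDiffAt 𝓘(ℂ, EY) 𝓘(ℂ) ω f (ι x'), s x' = thickGerm ι x' f hf}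
  zero_mem' := fun x => ⟨fun _ => 0, .of_forall fun x' => ⟨contMDiffAt_const, rfl⟩⟩
  one_mem' := fun x => ⟨fun _ => 1, .of_forall fun x' => ⟨contMDiffAt_const, rfl⟩⟩
  add_mem' := by
    intro s t hs ht x
    obtain ⟨f, hf⟩ := hs x
    obtain ⟨g, hg⟩ := ht x
    refine ⟨f + g, ?_⟩
    filter_upwards [hf, hg] with x' ⟨h1, h1'⟩ ⟨h2, h2'⟩
    exact ⟨h1.add h2, by rw [Pi.add_apply, h1', h2']; rfl⟩
  mul_mem' := by
    intro s t hs ht x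
    obtain ⟨f, hf⟩ := hs x
    obtain ⟨g, hg⟩ := ht x
    refine ⟨f * g, ?_⟩
    filter_upwards [hf, hg] with x' ⟨h1, h1'⟩ ⟨h2, h2'⟩
    exact ⟨h1.mul h2, by rw [Pi.mul_apply, h1', h2']; rfl⟩
  neg_mem' := by
    intro s hs x
    obtain ⟨f, hf⟩ := hs x
    refine ⟨-f, ?_⟩
    filter_upwards [hf] with x' ⟨h1, h1'⟩
    exact ⟨h1.neg, by rw [Pi.neg_apply, h1']; rfl⟩

lemma thickSections_res {U W : Opens X} (h : W ≤ U) {s : ∀ x : U, ThickStalk ι (x : X)}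
    (hs : s ∈ thickSections ι U) :
    (fun x : W => s (Opens.inclusion h x)) ∈ thickSections ι W := by
  intro x
  obtain ⟨f, hf⟩ := hs (Opens.inclusion h x)
  exact ⟨f, (continuous_inclusion h).continuousAt.eventually hf⟩

/-- The restriction `𝒪_{X₁}(U) → 𝒪_{X₁}(W)`. -/
def thickRes {U W : Opens X} (h : W ≤ U) : thickSections ι U →+* thickSections ι W where
  toFun s := ⟨fun x => s.1 (Opens.inclusion h x), thickSections_res ι h s.2⟩
  map_one' := rfl
  map_mul' _ _ := rfl
  map_zero' := rfl
  map_add' _ _ := rfl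

/-- Membership in `𝒪_{X₁}(U)` is a local condition. -/
def thickLocalPredicate : TopCat.LocalPredicate (fun x : TopCat.of X => ThickStalk ι x) where
  pred {U} s := s ∈ thickSections ι U
  res i s hs := thickSections_res ι (leOfHom i) hs
  locality := by
    intro U s hs x
    obtain ⟨W, hxW, i, hW⟩ := hs x
    obtain ⟨f, hf⟩ := hW ⟨x.1, hxW⟩
    refine ⟨f, ?_⟩
    have hn := (Opens.isOpenEmbedding_of_le (leOfHom i)).map_nhds_eq ⟨x.1, hxW⟩
    change ∀ᶠ x' in 𝓝 (Set.inclusion (leOfHom i) ⟨x.1, hxW⟩), _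
    rw [← hn]
    exact hf

/-- The presheaf of rings `U ↦ 𝒪_{X₁}(U)`. -/
def thickPresheaf : TopCat.Presheaf RingCat.{u} (TopCat.of X) where
  obj U := RingCat.of (thickSections ι U.unop)
  map i := RingCat.ofHom (thickRes ι (leOfHom i.unop))
  map_id _ := rfl
  map_comp _ _ := rfl

/-- The structure sheaf `𝒪_{X₁} = 𝒪_Y / ℐ²` of the first-order thickening `X₁`, a sheaf of rings
on the topological space `X`. -/
def thickSheaf : Sheaf (Opens.grothendieckTopology (TopCat.of X)) RingCat.{u} where
  obj := thickPresheaf ι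
  property := by
    rw [CategoryTheory.Presheaf.isSheaf_iff_isSheaf_forget _ _ (CategoryTheory.forget RingCat)]
    exact (TopCat.subsheafToTypes (thickLocalPredicate ι)).property

/-- A sheaf of `𝒪_{X₁}`-modules is a vector bundle over `X₁` if it is locally free of finite rank:
locally it has sections `e 0, ..., e (n - 1)` whose restrictions to every smaller open set `W` form
a basis of the sections over `W`. -/
def IsLocallyFreeOfFiniteRank (M : SheafOfModules.{u} (thickSheaf ι)) : Prop :=
  ∀ x : X, ∃ U : Opens (TopCat.of X), x ∈ U ∧ ∃ (n : ℕ) (e : Fin n → M.val.obj (op U)),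
    ∀ (W : Opens (TopCat.of X)) (h : W ≤ U) (s : M.val.obj (op W)),
      ∃! a : Fin n → (thickSheaf ι).obj.obj (op W),
        s = ∑ i, a i • (M.val.map (homOfLE h).op (e i) : M.val.obj (op W))

/-- The ideal of sections of `𝒥 = ℐ / ℐ² = ker (𝒪_{X₁} → 𝒪_X)` over `U`. -/
def thickIdeal (U : Opens X) : Ideal (thickSections ι U) where
  carrier := {a | ∀ x : U, thickValue ι x (a.1 x) = 0}
  zero_mem' := fun _ => map_zero _
  add_mem' := fun {a b} ha hb x => by
    simp [ha x, hb x]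
  smul_mem' := fun c a ha x => by
    simp [ha x]

/-- An isomorphism `ι^* M ≅ E`, where `ι^* M = M ⊗ 𝒪_X = M / 𝒥 M` and `E` stands for its sheaf of
holomorphic sections: a homomorphism of sheaves from `M` to the sheaf of holomorphic sections of
`E` that is linear over `𝒪_{X₁} → 𝒪_X`, surjective as a map of sheaves, and whose kernel is the
subsheaf `𝒥 M` (that `𝒥 M` lies in the kernel follows from linearity). -/
structure PullbackIso (F : Type*) [NormedAddCommGroup F] [NormedSpace ℂ F]
    (E : X → Type*) [TopologicalSpace (TotalSpace F E)] [∀ x, AddCommGroup (E x)]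
    [∀ x, Module ℂ (E x)] [∀ x, TopologicalSpace (E x)] [FiberBundle F E] [VectorBundle ℂ F E]
    (M : SheafOfModules.{u} (thickSheaf ι)) where
  toFun : ∀ U : Opens (TopCat.of X), M.val.obj (op U) →+ ∀ x : U, E (x : X)
  holomorphic : ∀ (U : Opens (TopCat.of X)) (s : M.val.obj (op U)),
    ContMDiff 𝓘(ℂ, EX) (𝓘(ℂ, EX).prod 𝓘(ℂ, F)) ω
      (fun x : U => TotalSpace.mk' F (x : X) (toFun U s x))
  map_smul : ∀ (U : Opens (TopCat.of X)) (a : thickSections ι U) (s : M.val.obj (op U)) (x : U),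
    toFun U ((show (thickSheaf ι).obj.obj (op U) from a) • s) x =
      thickValue ι (x : X) (a.1 x) • toFun U s x
  map_res : ∀ (U W : Opens (TopCat.of X)) (h : W ≤ U) (s : M.val.obj (op U)) (x : W),
    toFun W (M.val.map (homOfLE h).op s : M.val.obj (op W)) x = toFun U s (Opens.inclusion h x)
  locally_surjective : ∀ (U : Opens (TopCat.of X)) (t : ∀ x : U, E (x : X)),
    ContMDiff 𝓘(ℂ, EX) (𝓘(ℂ, EX).prod 𝓘(ℂ, F)) ω
      (fun x : U => TotalSpace.mk' F (x : X) (t x)) →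
    ∀ x ∈ U, ∃ (W : Opens (TopCat.of X)) (h : W ≤ U) (s : M.val.obj (op W)), x ∈ W ∧
      ∀ y : W, toFun W s y = t (Opens.inclusion h y)
  ker_le : ∀ (U : Opens (TopCat.of X)) (s : M.val.obj (op U)), toFun U s = 0 →
    ∀ x ∈ U, ∃ (W : Opens (TopCat.of X)) (h : W ≤ U), x ∈ W ∧
      (M.val.map (homOfLE h).op s : M.val.obj (op W)) ∈
        Submodule.span ((thickSheaf ι).obj.obj (op W))
          {m : M.val.obj (op W) | ∃ a ∈ thickIdeal ι W, ∃ m' : M.val.obj (op W),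
            m = (show (thickSheaf ι).obj.obj (op W) from a) • m'}

/-- There is a vector bundle `E₁` over `X₁` with `ι^* E₁ = E`. -/
def ExtendsToFirstThickening (F : Type*) [NormedAddCommGroup F] [NormedSpace ℂ F]
    (E : X → Type*) [TopologicalSpace (TotalSpace F E)] [∀ x, AddCommGroup (E x)]
    [∀ x, Module ℂ (E x)] [∀ x, TopologicalSpace (E x)] [FiberBundle F E] [VectorBundle ℂ F E] :
    Prop :=
  ∃ E₁ : SheafOfModules.{u} (thickSheaf ι),
    IsLocallyFreeOfFiniteRank ι E₁ ∧ Nonempty (PullbackIso ι F E E₁)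

end Thickening

end

/-! ### The product `At(E)·κ` as the obstruction to lifting the Atiyah cocycle to `Ω¹_Y|_X ⊗ End E`.
-/

section Obstruction

variable {EX : Type*} [NormedAddCommGroup EX] [NormedSpace ℂ EX]
  {EY : Type*} [NormedAddCommGroup EY] [NormedSpace ℂ EY]
  {X : Type*} [TopologicalSpace X] [ChartedSpace EX X] [IsManifold 𝓘(ℂ, EX) ω X]
  {Y : Type*} [TopologicalSpace Y] [ChartedSpace EY Y] [IsManifold 𝓘(ℂ, EY) ω Y]
  (ι : C^ω⟮𝓘(ℂ, EX), X; 𝓘(ℂ, EY), Y⟯)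

/-! Both sides of the equivalence say that the Atiyah cocycle lifts, on some cover, to a cocycle
with values in `Ω¹_Y|_X ⊗ End E`.

Cohomological side. Write `A_xy` for the Atiyah cocycle. The normal sequence dualizes to `0 → N^* ⊗
End E → Ω¹_Y|_X ⊗ End E → Ω¹_X ⊗ End E → 0`. The local splittings that define `κ` amount to local
retractions `ρ_x : T_{Y|X} → T_X`, and `A_xy ∘ ρ_y` is a local lift of `A_xy`. Its coboundary is
minus the cup product of `A` with the Kodaira–Spencer cocycle. So the lifts can be corrected by
sections of `N^* ⊗ End E` to a cocycle exactly when `At(E)·κ = 0`; this is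
`cup_eq_zero_iff_exists_atiyahLift`.

Jets. A section of `𝒪_Y/ℐ²` is the same as a pair `(f, l)`: a holomorphic function `f` on `X` and a
holomorphic section `l` of `Ω¹_Y|_X` whose restriction to `T_X` is `df`. Injectivity is
`ThickAt.eq_zero`, local surjectivity is `exists_thickAt_of_jet`, and products follow the Leibniz
rule. Hence a matrix over `𝒪_{X₁}` lifting the transition function `g_xy` of `E` is a matrix of
forms `Λ_xy` extending `dg_xy`, and the multiplicative cocycle condition becomes `Λ_xz = g_xy Λ_yz +
Λ_xy g_yz`. For `B_xy = e_x⁻¹ Λ_xy e_y` this reads `B_xz = B_xy + B_yz`, and `B` restricts to the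
Atiyah cocycle. So the transition functions lift to a cocycle over `𝒪_{X₁}` exactly when the Atiyah
cocycle lifts (`IsThickCocycle.exists_atiyahLift`, `IsAtiyahLift.exists_thickCocycle`).

Bundles. A cocycle of lifted matrices glues free modules to a bundle `E₁`. No quotient is needed: a
section records at `p` its coordinates in the frame indexed by `p`, and the matrices carry these to
a common frame (`IsThickCocycle.extendsToFirstThickening`). Conversely, the local frames of `E` lift
to sections of a given `E₁`. Since the ideal `𝒥 = ℐ/ℐ²` has square zero, a Nakayama argument shows
that they are bases (`exists_liftsFrame_existsUnique`), and the base changes between them form the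
required cocycle (`ExtendsToFirstThickening.exists_thickCocycle`). -/

omit [IsManifold 𝓘(ℂ, EX) ω X] [IsManifold 𝓘(ℂ, EY) ω Y] in
lemma normalProj_tangentInclusion (p : X) (v : TangentSpace 𝓘(ℂ, EX) p) :
    normalProj ι p (tangentInclusion ι p v) = 0 :=
  (Submodule.Quotient.mk_eq_zero _).2 ⟨v, rfl⟩

omit [IsManifold 𝓘(ℂ, EX) ω X] [IsManifold 𝓘(ℂ, EY) ω Y] in
lemma exists_tangentInclusion_of_normalProj_eq_zero {p : X} {w : AmbientTangent ι p}
    (h : normalProj ι p w = 0) : ∃ v, tangentInclusion ι p v = w :=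
  (Submodule.Quotient.mk_eq_zero _).1 h

omit [IsManifold 𝓘(ℂ, EX) ω X] [IsManifold 𝓘(ℂ, EY) ω Y] in
lemma normalProj_surjective (p : X) : Function.Surjective (normalProj ι p) :=
  (tangentInclusion ι p).range.mkQ_surjective

lemma tangentInclusion_injective (hι : Manifold.IsSmoothEmbedding 𝓘(ℂ, EX) 𝓘(ℂ, EY) ω ι) (p : X) :
    Function.Injective (tangentInclusion ι p) := by
  obtain ⟨U, ρ, -, hρ⟩ := exists_retraction ι hι p
  exact Function.LeftInverse.injective (hρ p U.mem)

/-- Splittings of `T_{Y|X} → N_{X/Y}` correspond to holomorphic retractions of `T_X → T_{Y|X}`. -/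
lemma exists_retraction_of_splitting (hι : Manifold.IsSmoothEmbedding 𝓘(ℂ, EX) 𝓘(ℂ, EY) ω ι)
    (U : X → Set X) (hU : ∀ x, IsOpen (U x))
    (Ψ : X → ∀ p, NormalFiber ι p →L[ℂ] AmbientTangent ι p)
    (hΨ : ∀ x, (normalHomSections ι EY (AmbientTangent ι)).IsSection (U x) (Ψ x))
    (hΨs : ∀ x, ∀ p ∈ U x, ∀ n, normalProj ι p (Ψ x p n) = n) :
    ∃ ρ : X → ∀ p, AmbientTangent ι p →L[ℂ] TangentSpace 𝓘(ℂ, EX) p,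
      (∀ x, (holomorphicSections (EX := EX) (EY →L[ℂ] EX)
        (fun x => AmbientTangent ι x →L[ℂ] TangentSpace 𝓘(ℂ, EX) x)).IsSection (U x) (ρ x)) ∧
      ∀ x, ∀ p ∈ U x, ∀ v, tangentInclusion ι p (ρ x p v) = v - Ψ x p (normalProj ι p v) := by
  choose V σ hσ hσι using exists_retraction ι hι
  have hrange : ∀ x, ∀ p ∈ U x, ∀ v, ∃ w, tangentInclusion ι p w =
      v - Ψ x p (normalProj ι p v) := fun x p hp v =>
    exists_tangentInclusion_of_normalProj_eq_zero ι (by rw [map_sub, hΨs x p hp, sub_self])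
  -- `id - Ψ_x ∘ π` takes values in `T_X`, where all the local left inverses `σ` agree. The
  -- pointwise choice `σ q q` may therefore be replaced near `p` by the holomorphic `σ p`.
  refine ⟨fun x q => (σ q q).comp
    (ContinuousLinearMap.id ℂ (AmbientTangent ι q) - (Ψ x q).comp (normalProj ι q)), ?_, ?_⟩
  · intro x p hp
    have hid : (fun x => ContinuousLinearMap.id ℂ (AmbientTangent ι x)) ∈
        (holomorphicSections (EX := EX) (EY →L[ℂ] EY)
          (fun x => AmbientTangent ι x →L[ℂ] AmbientTangent ι x)).germs p :=
      holomorphicSections_id p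
    refine (holomorphicSections (EX := EX) (EY →L[ℂ] EX)
      (fun x => AmbientTangent ι x →L[ℂ] TangentSpace 𝓘(ℂ, EX) x)).congr ?_
      (holomorphicSections_comp (hσ p p (V p).mem) (AddSubgroup.sub_mem _ hid (hΨ x p hp)))
    filter_upwards [(hU x).mem_nhds hp, (V p).is_open'.mem_nhds (V p).mem] with q hq hq'
    ext v
    obtain ⟨w, hw⟩ := hrange x q hq v
    change σ p q (v - Ψ x q (normalProj ι q v)) = σ q q (v - Ψ x q (normalProj ι q v))
    rw [← hw, hσι p q hq', hσι q q (V q).mem]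
  · intro x p hp v
    obtain ⟨w, hw⟩ := hrange x p hp v
    change tangentInclusion ι p (σ p p (v - Ψ x p (normalProj ι p v))) = _
    rw [← hw, hσι p p (V p).mem]

variable (F : Type*) [NormedAddCommGroup F] [NormedSpace ℂ F]
  (E : X → Type*) [TopologicalSpace (TotalSpace F E)] [∀ x, AddCommGroup (E x)]
  [∀ x, Module ℂ (E x)] [∀ x, TopologicalSpace (E x)] [FiberBundle F E] [VectorBundle ℂ F E]
  [∀ x, IsTopologicalAddGroup (E x)] [∀ x, ContinuousSMul ℂ (E x)]

/-- A lift of the Atiyah cocycle along `Ω¹_Y|_X ⊗ End E → Ω¹_X ⊗ End E` to a Čech cocycle on the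
cover `U`. -/
structure IsAtiyahLift (U : ∀ x : X, OpenNhdsOf x)
    (B : X → X → ∀ p, AmbientTangent ι p →L[ℂ] EndBundle E p) : Prop where
  subset : ∀ x, (U x : Set X) ⊆ (trivializationAt F E x).baseSet
  isSection : ∀ x y, (holomorphicSections (EX := EX) (EY →L[ℂ] (F →L[ℂ] F))
    (fun p => AmbientTangent ι p →L[ℂ] EndBundle E p)).IsSection ((U x : Set X) ∩ U y) (B x y)
  cocycle : ∀ x y z, ∀ p ∈ (U x : Set X) ∩ U y ∩ U z, B x z p = B x y p + B y z p
  lift : ∀ x y, ∀ p ∈ (U x : Set X) ∩ U y, ∀ v,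
    B x y p (tangentInclusion ι p v) = atiyahCochain F E x y p v

variable [ContMDiffVectorBundle ω F E 𝓘(ℂ, EX)]

/-- The preferred trivialization domains as a cover. -/
def baseNhds (x : X) : OpenNhdsOf x :=
  ⟨⟨(trivializationAt F E x).baseSet, (trivializationAt F E x).open_baseSet⟩,
    FiberBundle.mem_baseSet_trivializationAt F E x⟩

/-- The Leibniz rule for `g_xz = g_xy g_yz`, conjugated by the frames. -/
lemma atiyahCochain_add {x y z p : X} (hx : p ∈ (trivializationAt F E x).baseSet)
    (hy : p ∈ (trivializationAt F E y).baseSet) (hz : p ∈ (trivializationAt F E z).baseSet) :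
    atiyahCochain (EX := EX) F E x z p = atiyahCochain F E x y p + atiyahCochain F E y z p := by
  have h1 : transitionDeriv (EX := EX) F E x z p =
      ((ContinuousLinearMap.compL ℂ F F F) (bundleTransition F E x y p)).comp (transitionDeriv F E y z p) +
      ((ContinuousLinearMap.compL ℂ F F F).flip (bundleTransition F E y z p)).comp
        (transitionDeriv F E x y p) := by
    have hb := (ContinuousLinearMap.compL ℂ F F F).isBoundedBilinearMap.hasFDerivAt
      (bundleTransition F E x y p, bundleTransition F E y z p)
    have h1 := ((contMDiffAt_bundleTransition (EX := EX) F E hx hy).mdifferentiableAt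
      (by simp)).hasMFDerivAt
    have h2 := ((contMDiffAt_bundleTransition (EX := EX) F E hy hz).mdifferentiableAt
      (by simp)).hasMFDerivAt
    have hg : HasMFDerivAt 𝓘(ℂ, EX) 𝓘(ℂ, (F →L[ℂ] F) × (F →L[ℂ] F))
        (fun q => (bundleTransition F E x y q, bundleTransition F E y z q)) p
        ((transitionDeriv F E x y p).prod (transitionDeriv F E y z p)) :=
      ⟨h1.1.prodMk h2.1, h1.2.prodMk h2.2⟩
    have hm : HasMFDerivAt 𝓘(ℂ, EX) 𝓘(ℂ, F →L[ℂ] F) (bundleTransition F E x z) p _ :=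
      (HasMFDerivAt.comp (I' := 𝓘(ℂ, (F →L[ℂ] F) × (F →L[ℂ] F))) p hb.hasMFDerivAt
        hg).congr_of_eventuallyEq (by
        filter_upwards [(trivializationAt F E x).open_baseSet.mem_nhds hx,
          (trivializationAt F E y).open_baseSet.mem_nhds hy,
          (trivializationAt F E z).open_baseSet.mem_nhds hz] with q hqx hqy hqz
        exact bundleTransition_comp F E hqx hqy hqz)
    refine hm.mfderiv.trans ?_
    ext v
    rfl
  ext v w
  change atiyahCochain F E x z p v w = atiyahCochain F E x y p v w + atiyahCochain F E y z p v w
  have h2 : transitionDeriv (EX := EX) F E x z p v ((trivializationAt F E z).continuousLinearMapAt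
      ℂ p w) = bundleTransition F E x y p (transitionDeriv F E y z p v
        ((trivializationAt F E z).continuousLinearMapAt ℂ p w)) +
      transitionDeriv F E x y p v (bundleTransition F E y z p
        ((trivializationAt F E z).continuousLinearMapAt ℂ p w)) := by
    rw [h1]
    rfl
  simp only [atiyahCochain_apply, h2, map_add]
  rw [bundleTransition_apply F E hx hy, bundleTransition_apply F E hy hz,
    Trivialization.symmL_continuousLinearMapAt _ hx,
    Trivialization.symmL_continuousLinearMapAt _ hz]
  abel

/-- The connecting homomorphism of the dualized normal sequence, computed on cochains. The Atiyah
cocycle itself is lifted, so no coboundary with values in `Ω¹_X ⊗ End E` has to be absorbed. -/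
theorem cup_eq_zero_iff_exists_atiyahLift
    (hι : Manifold.IsSmoothEmbedding 𝓘(ℂ, EX) 𝓘(ℂ, EY) ω ι) :
    (tracePairing F E ι).cup (atiyahClass F E) (kodairaSpencerClass ι hι) = 0 ↔
      ∃ U B, IsAtiyahLift ι F E U B := by
  obtain ⟨U, Ψ, c, hΨ, hΨs, hc, hκ⟩ := (exists_isKodairaSpencerClass ι hι).choose_spec
  obtain ⟨ρ, hρ, hρι⟩ := exists_retraction_of_splitting ι hι (fun x => U x)
    (fun x => (U x).is_open') Ψ hΨ hΨs
  set A := atiyahCochain (EX := EX) F E with hA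
  have hρt : ∀ x, ∀ p ∈ U x, ∀ v, ρ x p (tangentInclusion ι p v) = v := fun x p hp v =>
    tangentInclusion_injective ι hι p (by
      rw [hρι x p hp, normalProj_tangentInclusion, map_zero, sub_zero])
  -- Since `dι ∘ ρ_x = id - Ψ_x ∘ π`, the difference `Ψ_x - Ψ_y` becomes a difference of retractions
  -- with the sign reversed.
  have hcρ : ∀ x y, ∀ p ∈ (U x : Set X) ∩ U y, ∀ v,
      c.1 x y p (normalProj ι p v) = ρ y p v - ρ x p v := fun x y p hp v =>
    tangentInclusion_injective ι hι p (by
      rw [hc x y p hp, map_sub, hρι x p hp.1, hρι y p hp.2]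
      abel)
  have hcup : (tracePairing F E ι).cup (atiyahClass F E) (kodairaSpencerClass ι hι) = 0 ↔
      (tracePairing F E ι).cochain A c.1 ∈
        (normalHomSections ι (F →L[ℂ] F) (EndBundle E)).coboundaries₂ := by
    have hκ' : kodairaSpencerClass ι hι = SectionSheaf.H1.mk _ c := hκ
    rw [hκ']
    refine (QuotientAddGroup.eq_zero_iff (N := ((normalHomSections ι (F →L[ℂ] F)
      (EndBundle E)).coboundaries₂.addSubgroupOf _))
      (⟨(tracePairing F E ι).cochain A c.1, (tracePairing F E ι).cochain_mem
        ⟨A, atiyahCochain_mem F E⟩ c⟩ :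
        (normalHomSections ι (F →L[ℂ] F) (EndBundle E)).cocycles₂)).trans ?_
    rw [AddSubgroup.mem_addSubgroupOf]
  have happ : ∀ x y z p n, (tracePairing F E ι).cochain A c.1 x y z p n =
      A x y p (c.1 y z p n) := fun _ _ _ _ _ => rfl
  rw [hcup]
  constructor
  · rintro ⟨W, b, hb, hb'⟩
    -- The coboundary of `A_xy ∘ ρ_y` is `-(A_xy ∘ c_yz ∘ π)`; adding `b_xy ∘ π` cancels it and
    -- leaves the values on `T_X` unchanged.
    refine ⟨fun x => U x ⊓ W x ⊓ baseNhds F E x, fun x y p =>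
      (A x y p).comp (ρ y p) + (b x y p).comp (normalProj ι p), fun x p hp => hp.2, ?_, ?_, ?_⟩
    · intro x y p hp
      exact AddSubgroup.add_mem _ (holomorphicSections_comp
        (atiyahCochain_mem_germs F E hp.1.2 hp.2.2) (hρ y p hp.2.1.1))
        (hb x y p ⟨hp.1.1.2, hp.2.1.2⟩)
    · rintro x y z p ⟨⟨⟨⟨h1, h2⟩, h3⟩, ⟨h4, h5⟩, h6⟩, ⟨h7, h8⟩, h9⟩
      have e1 := hb' x y z p ⟨⟨h2, h5⟩, h8⟩
      have e2 := atiyahCochain_add (EX := EX) F E h3 h6 h9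
      ext1 v
      have e3 := congrArg (fun L => L (normalProj ι p v)) e1
      simp only [happ, hcρ y z p ⟨h4, h7⟩ v, map_sub, add_apply, sub_apply] at e3
      have e4 := congrArg (fun L => L (ρ z p v)) e2
      simp only [add_apply] at e4
      simp only [ContinuousLinearMap.comp_apply, add_apply]
      rw [← hA] at e4
      have e5 : b x z p (normalProj ι p v) = b y z p (normalProj ι p v) +
          b x y p (normalProj ι p v) - (A x y p (ρ z p v) - A x y p (ρ y p v)) := by
        rw [e3]; abel
      rw [e4, e5]
      abel
    · intro x y p hp v
      simp only [ContinuousLinearMap.comp_apply, add_apply]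
      rw [hρt y p hp.2.1.1, normalProj_tangentInclusion, ContinuousLinearMap.map_zero, add_zero]
  · rintro ⟨W, B, hB⟩
    -- Two lifts of `A_xy` differ by a form that kills `T_X`, hence by a form on `N`.
    choose b hb using fun x y => exists_descend ι (fun p => B x y p - (A x y p).comp (ρ y p))
    have hb' : ∀ x y, ∀ p ∈ ((U x ⊓ W x : OpenNhdsOf x) : Set X) ∩ (U y ⊓ W y : OpenNhdsOf y),
        (b x y p).comp (normalProj ι p) = B x y p - (A x y p).comp (ρ y p) := by
      intro x y p hp
      refine hb x y p fun v => ?_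
      simp only [ContinuousLinearMap.comp_apply, sub_apply]
      rw [hB.lift x y p ⟨hp.1.2, hp.2.2⟩, hρt y p hp.2.1, sub_self]
    refine ⟨fun x => U x ⊓ W x, b, fun x y p hp => ?_, fun x y z p hp => ?_⟩
    · refine (holomorphicSections (EX := EX) (EY →L[ℂ] (F →L[ℂ] F))
        (fun x => AmbientTangent ι x →L[ℂ] EndBundle E x)).congr ?_
        (AddSubgroup.sub_mem _ (hB.isSection x y p ⟨hp.1.2, hp.2.2⟩) (holomorphicSections_comp
          (atiyahCochain_mem_germs F E (hB.subset x hp.1.2) (hB.subset y hp.2.2))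
          (hρ y p hp.2.1)))
      filter_upwards [((U x ⊓ W x).is_open'.inter (U y ⊓ W y).is_open').mem_nhds hp] with q hq
      exact (hb' x y q hq).symm
    · obtain ⟨⟨⟨h1, h2⟩, h3, h4⟩, h5, h6⟩ := hp
      ext1 n
      obtain ⟨v, rfl⟩ := normalProj_surjective ι p n
      have e1 := congrArg (fun L => L v) (hb' x y p ⟨⟨h1, h2⟩, h3, h4⟩)
      have e2 := congrArg (fun L => L v) (hb' x z p ⟨⟨h1, h2⟩, h5, h6⟩)
      have e3 := congrArg (fun L => L v) (hb' y z p ⟨⟨h3, h4⟩, h5, h6⟩)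
      have e4 := congrArg (fun L => L v) (hB.cocycle x y z p ⟨⟨h2, h4⟩, h6⟩)
      have e5 := congrArg (fun L => L (ρ z p v)) (atiyahCochain_add (EX := EX) F E
        (hB.subset x h2) (hB.subset y h4) (hB.subset z h6))
      change b x y p (normalProj ι p v) = B x y p v - A x y p (ρ y p v) at e1
      change b x z p (normalProj ι p v) = B x z p v - A x z p (ρ z p v) at e2
      change b y z p (normalProj ι p v) = B y z p v - A y z p (ρ z p v) at e3
      change B x z p v = B x y p v + B y z p v at e4
      change A x z p (ρ z p v) = A x y p (ρ z p v) + A y z p (ρ z p v) at e5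
      change A x y p (c.1 y z p (normalProj ι p v)) = b y z p (normalProj ι p v) -
        b x z p (normalProj ι p v) + b x y p (normalProj ι p v)
      rw [hcρ y z p ⟨h3, h5⟩, e1, e2, e3, e4, ContinuousLinearMap.map_sub, e5]
      abel

end Obstruction

/-! ### Hadamard's lemma for analytic maps between normed spaces. -/

section Hadamard

open MeasureTheory intervalIntegral
open scoped NNReal ENNReal

variable {E V : Type*} [NormedAddCommGroup E] [NormedSpace ℂ E]
  [NormedAddCommGroup V] [NormedSpace ℂ V] [CompleteSpace V]

omit [CompleteSpace V] in
lemma continuous_compContinuousLinearMap_const {n : ℕ} (q : E [×n]→L[ℂ] V) {L : ℝ → E →L[ℂ] E}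
    (hL : Continuous L) :
    Continuous fun t => q.compContinuousLinearMap (fun _ => L t) :=
  (q.compContinuousLinearMapLRight (E := fun _ => E)).cont.comp (continuous_pi fun _ => hL)

/-- An integral `∫ φ (L t w) dt` of analytic functions depends analytically on `w`. -/
theorem AnalyticAt.integral_comp_clm {φ : E → V} (hφ : AnalyticAt ℂ φ 0) {L : ℝ → E →L[ℂ] E}
    (hL : Continuous L) : AnalyticAt ℂ (fun w => ∫ t in (0 : ℝ)..1, φ (L t w)) 0 := by
  obtain ⟨p, r, hp⟩ := hφ
  obtain ⟨C, hC⟩ := isCompact_Icc.exists_bound_of_continuousOn (s := Set.Icc (0 : ℝ) 1)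
    hL.continuousOn
  -- A positive bound for `‖L t‖` on `[0, 1]`: if `‖w‖ < s / C'`, then every `L t w` has norm at
  -- most `s`, strictly inside the disc of convergence.
  set C' : ℝ≥0 := C.toNNReal + 1 with hC'
  have hLC : ∀ t ∈ Set.Icc (0 : ℝ) 1, ‖L t‖ ≤ C' := fun t ht =>
    (hC t ht).trans (by rw [hC']; push_cast; linarith [Real.le_coe_toNNReal C])
  obtain ⟨s, hs0, hsr⟩ := ENNReal.lt_iff_exists_nnreal_btwn.1 hp.r_pos
  have hs0' : 0 < s := by exact_mod_cast hs0
  have hC0 : 0 < C' := by rw [hC']; positivity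
  set r' : ℝ≥0 := s / C' with hr'
  have hr0 : 0 < r' := div_pos hs0' hC0
  have hCr : (C' : ℝ) * r' = s := by
    rw [hr']; push_cast; field_simp
  have hsrad : (s : ℝ≥0∞) < p.radius := hsr.trans_le hp.r_le
  obtain ⟨K, hK, hKb⟩ := p.norm_mul_pow_le_of_lt_radius hsrad
  -- The power series of the integral, obtained termwise; dominated convergence with the bound `‖p
  -- n‖ * s ^ n` justifies the exchange.
  let q : FormalMultilinearSeries ℂ E V := fun n =>
    ∫ t in (0 : ℝ)..1, (p n).compContinuousLinearMap (fun _ => L t)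
  have hcomp : ∀ n, ∀ t ∈ Set.Icc (0 : ℝ) 1,
      ‖(p n).compContinuousLinearMap (fun _ => L t)‖ ≤ ‖p n‖ * (C' : ℝ) ^ n := by
    intro n t ht
    refine (ContinuousMultilinearMap.norm_compContinuousLinearMap_le _ _).trans ?_
    rw [Finset.prod_const, Finset.card_univ, Fintype.card_fin]
    gcongr
    exact hLC t ht
  have huIoc : ∀ t ∈ Set.uIoc (0 : ℝ) 1, t ∈ Set.Icc (0 : ℝ) 1 := fun t ht => by
    rw [Set.uIoc_of_le zero_le_one] at ht
    exact ⟨ht.1.le, ht.2⟩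
  refine ⟨q, r', ?_, by exact_mod_cast hr0, ?_⟩
  · refine q.le_radius_of_bound K fun n => ?_
    have h1 : ‖q n‖ ≤ ‖p n‖ * (C' : ℝ) ^ n := by
      have := norm_integral_le_of_norm_le_const (a := (0 : ℝ)) (b := 1)
        (f := fun t => (p n).compContinuousLinearMap (fun _ => L t))
        (C := ‖p n‖ * (C' : ℝ) ^ n) fun t ht => hcomp n t (huIoc t ht)
      simpa using this
    calc ‖q n‖ * (r' : ℝ) ^ n ≤ ‖p n‖ * (C' : ℝ) ^ n * (r' : ℝ) ^ n := by gcongr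
      _ = ‖p n‖ * (s : ℝ) ^ n := by rw [mul_assoc, ← mul_pow, hCr]
      _ ≤ K := hKb n
  · intro w hw
    have hw' : ‖w‖ < r' := by simpa using hw
    have hLw : ∀ t ∈ Set.Icc (0 : ℝ) 1, ‖L t w‖ ≤ s := fun t ht => by
      calc ‖L t w‖ ≤ ‖L t‖ * ‖w‖ := (L t).le_opNorm w
        _ ≤ C' * r' := by gcongr; exact hLC t ht
        _ = s := hCr
    have hq : ∀ n, q n (fun _ => w) = ∫ t in (0 : ℝ)..1, p n (fun _ => L t w) := by
      intro n
      exact ((ContinuousMultilinearMap.apply ℂ (fun _ : Fin n => E) V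
        (fun _ => w)).intervalIntegral_comp_comm
        ((continuous_compContinuousLinearMap_const (p n) hL).intervalIntegrable 0 1)).symm
    simp only [hq, zero_add]
    refine hasSum_integral_of_dominated_convergence (fun n _ => ‖p n‖ * (s : ℝ) ^ n) ?_ ?_ ?_ ?_ ?_
    · intro n
      exact (Continuous.aestronglyMeasurable (by
        exact (p n).cont.comp (continuous_pi fun _ => hL.clm_apply continuous_const)))
    · intro n
      refine .of_forall fun t ht => ?_
      refine ((p n).le_opNorm _).trans ?_
      rw [Finset.prod_const, Finset.card_univ, Fintype.card_fin]
      gcongr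
      exact hLw t (huIoc t ht)
    · exact .of_forall fun t _ => p.summable_norm_mul_pow hsrad
    · exact intervalIntegrable_const
    · refine .of_forall fun t ht => ?_
      have := hp.hasSum (y := L t w) (by
        simp only [Metric.mem_eball, edist_zero_right]
        refine lt_of_le_of_lt ?_ hsr
        rw [← ENNReal.ofReal_coe_nnreal, ← ofReal_norm]
        exact ENNReal.ofReal_le_ofReal (hLw t (huIoc t ht)))
      simpa using this

/-- Hadamard's lemma relative to a linear projection `P`. -/
theorem AnalyticAt.exists_hadamard {φ : E → V} {w₀ : E} (hφ : AnalyticAt ℂ φ w₀) (P : E →L[ℂ] E)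
    (hP : ∀ w, P (P w) = P w) (hw₀ : P w₀ = w₀) :
    ∃ H : E → E →L[ℂ] V, AnalyticAt ℂ H w₀ ∧ (∀ᶠ w in 𝓝 w₀, φ w - φ (P w) = H w (w - P w)) ∧
      ∀ w, H (P w) = fderiv ℂ φ (P w) := by
  -- As `P` fixes `w₀`, the points `w₀ + L t (w - w₀)` run through the segment from `P w` to `w`.
  let L : ℝ → E →L[ℂ] E := fun t => P + (t : ℂ) • (ContinuousLinearMap.id ℂ E - P)
  have hL : Continuous L := by fun_prop
  have hLt : ∀ t w, w₀ + L t (w - w₀) = P w + (t : ℂ) • (w - P w) := by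
    intro t w
    simp only [L, add_apply, smul_apply, sub_apply, map_sub, hw₀,
      ContinuousLinearMap.id_apply, smul_sub]
    abel
  -- The mean of `dφ` over that segment. On the image of `P` the segment is constant, so `H` is `dφ`
  -- there.
  let H : E → E →L[ℂ] V := fun w => ∫ t in (0 : ℝ)..1, fderiv ℂ φ (w₀ + L t (w - w₀))
  refine ⟨H, ?_, ?_, ?_⟩
  · have h1 : AnalyticAt ℂ (fun v => fderiv ℂ φ (w₀ + v)) 0 := by
      refine AnalyticAt.fun_comp (g := fderiv ℂ φ) (f := fun v => w₀ + v) ?_ (by fun_prop)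
      rw [add_zero]
      exact hφ.fderiv
    have h2 := h1.integral_comp_clm hL
    refine AnalyticAt.fun_comp (g := fun v => ∫ t in (0 : ℝ)..1, fderiv ℂ φ (w₀ + L t v))
      (f := fun w => w - w₀) ?_ (by fun_prop)
    rw [sub_self]
    exact h2
  · obtain ⟨ε, hε, hball⟩ := Metric.eventually_nhds_iff_ball.1 hφ.eventually_analyticAt
    obtain ⟨C, hC⟩ := isCompact_Icc.exists_bound_of_continuousOn (s := Set.Icc (0 : ℝ) 1)
      hL.continuousOn
    have hC0 : 0 ≤ C := (norm_nonneg _).trans (hC 0 (by simp))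
    -- With this radius the whole segment stays in the ball where `φ` is analytic, because `‖L t‖ ≤
    -- C`.
    filter_upwards [Metric.ball_mem_nhds w₀ (show 0 < ε / (C + 1) by positivity)] with w hw
    have hmem : ∀ t ∈ Set.Icc (0 : ℝ) 1, AnalyticAt ℂ φ (P w + (t : ℂ) • (w - P w)) := by
      intro t ht
      rw [← hLt]
      refine hball _ ?_
      rw [Metric.mem_ball, dist_eq_norm, add_sub_cancel_left]
      have hw' : ‖w - w₀‖ < ε / (C + 1) := by rwa [Metric.mem_ball, dist_eq_norm] at hw
      calc ‖L t (w - w₀)‖ ≤ ‖L t‖ * ‖w - w₀‖ := (L t).le_opNorm _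
        _ ≤ (C + 1) * ‖w - w₀‖ := by gcongr; linarith [hC t ht]
        _ < (C + 1) * (ε / (C + 1)) := by gcongr
        _ = ε := by field_simp
    have hcont : ContinuousOn (fun t : ℝ => fderiv ℂ φ (P w + (t : ℂ) • (w - P w)))
        (Set.uIcc 0 1) := by
      intro t ht
      rw [Set.uIcc_of_le zero_le_one] at ht
      have h1 : ContinuousAt (fderiv ℂ φ) (P w + (t : ℂ) • (w - P w)) :=
        (hmem t ht).fderiv.continuousAt
      exact (ContinuousAt.comp (f := fun t : ℝ => P w + (t : ℂ) • (w - P w)) h1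
        (by fun_prop)).continuousWithinAt
    have hder : ∀ t ∈ Set.uIcc (0 : ℝ) 1, HasDerivAt (fun t : ℝ => φ (P w + (t : ℂ) • (w - P w)))
        (fderiv ℂ φ (P w + (t : ℂ) • (w - P w)) (w - P w)) t := by
      intro t ht
      rw [Set.uIcc_of_le zero_le_one] at ht
      have h1 : HasDerivAt (fun t : ℝ => P w + (t : ℂ) • (w - P w)) (w - P w) t := by
        have := ((Complex.ofRealCLM.hasDerivAt (x := t)).smul_const (w - P w)).const_add (P w)
        simpa using this
      exact ((hmem t ht).differentiableAt.hasFDerivAt.restrictScalars ℝ).comp_hasDerivAt t h1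
    have hev := (ContinuousLinearMap.apply ℂ V (w - P w)).intervalIntegral_comp_comm
      (f := fun t : ℝ => fderiv ℂ φ (P w + (t : ℂ) • (w - P w))) (μ := volume)
      hcont.intervalIntegrable
    have hftc := integral_eq_sub_of_hasDerivAt hder
      ((hcont.clm_apply continuousOn_const).intervalIntegrable)
    simp only [ContinuousLinearMap.apply_apply] at hev
    rw [hev] at hftc
    simp only [Complex.ofReal_one, one_smul, Complex.ofReal_zero, zero_smul, add_zero,
      add_sub_cancel] at hftc
    simp only [H, hLt]
    exact hftc.symm
  · intro w
    simp only [H, hLt, hP, sub_self, smul_zero, add_zero, intervalIntegral.integral_const, sub_zero, one_smul]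

end Hadamard

/-! ### Values and differentials along `X` of sections of `𝒪_Y/ℐ²`. -/

section Jets

variable {EX : Type*} [NormedAddCommGroup EX] [NormedSpace ℂ EX]
  {EY : Type*} [NormedAddCommGroup EY] [NormedSpace ℂ EY]
  {X Y : Type u} [TopologicalSpace X] [ChartedSpace EX X]
  [TopologicalSpace Y] [ChartedSpace EY Y]
  (ι : C^ω⟮𝓘(ℂ, EX), X; 𝓘(ℂ, EY), Y⟯)

lemma thickValue_thickGerm (x : X) (f : Y → ℂ) (hf : ContMDiffAt 𝓘(ℂ, EY) 𝓘(ℂ) ω f (ι x)) :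
    thickValue ι x (thickGerm ι x f hf) = f (ι x) := rfl

lemma thickGerm_congr {x : X} {f g : Y → ℂ} (h : f =ᶠ[𝓝 (ι x)] g)
    (hf : ContMDiffAt 𝓘(ℂ, EY) 𝓘(ℂ) ω f (ι x)) (hg : ContMDiffAt 𝓘(ℂ, EY) 𝓘(ℂ) ω g (ι x)) :
    thickGerm ι x f hf = thickGerm ι x g hg := by
  have : (f : (𝓝 (ι x)).Germ ℂ) = g := Filter.Germ.coe_eq.2 h
  simp only [thickGerm, this]

lemma exists_thickGerm {x : X} (a : ThickStalk ι x) :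
    ∃ (f : Y → ℂ) (hf : ContMDiffAt 𝓘(ℂ, EY) 𝓘(ℂ) ω f (ι x)), a = thickGerm ι x f hf := by
  obtain ⟨⟨_, f, hf, rfl⟩, rfl⟩ := Ideal.Quotient.mk_surjective a
  exact ⟨f, hf, rfl⟩

lemma exists_rep_of_mem_idealGerms {x : X} {g : holomorphicGerms EY (ι x)}
    (hg : g ∈ idealGerms ι x) : ∃ f : Y → ℂ, ContMDiffAt 𝓘(ℂ, EY) 𝓘(ℂ) ω f (ι x) ∧
      (f : (𝓝 (ι x)).Germ ℂ) = g.1 ∧ f (ι x) = 0 := by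
  obtain ⟨f, hf, hf0⟩ := hg
  obtain ⟨k, hk, hkg⟩ := g.2
  exact ⟨f, hk.congr_of_eventuallyEq (Filter.Germ.coe_eq.1 (hf.trans hkg.symm)), hf,
    hf0.self_of_nhds ⟨x, rfl⟩⟩

/-- A product of two functions vanishing at a point has zero differential there. This makes the
differential well defined modulo `ℐ²`. -/
lemma exists_rep_of_mem_idealGerms_sq {x : X} {g : holomorphicGerms EY (ι x)}
    (hg : g ∈ idealGerms ι x ^ 2) : ∃ f : Y → ℂ, (f : (𝓝 (ι x)).Germ ℂ) = g.1 ∧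
      HasMFDerivAt 𝓘(ℂ, EY) 𝓘(ℂ) f (ι x) (0 : EY →L[ℂ] ℂ) := by
  rw [pow_two] at hg
  refine Submodule.mul_induction_on hg ?_ ?_
  · intro a ha b hb
    obtain ⟨f, hf, hfa, hf0⟩ := exists_rep_of_mem_idealGerms ι ha
    obtain ⟨k, hk, hkb, hk0⟩ := exists_rep_of_mem_idealGerms ι hb
    refine ⟨f * k, ?_, ?_⟩
    · rw [Subring.coe_mul, ← hfa, ← hkb]
      rfl
    · have := (hf.mdifferentiableAt (by simp)).hasMFDerivAt.mul
        (hk.mdifferentiableAt (by simp)).hasMFDerivAt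
      have h0 : ∀ a b : EY →L[ℂ] ℂ, f (ι x) • b + k (ι x) • a = 0 := fun a b => by
        ext w
        simp [hf0, hk0]
      exact Eq.mp (congrArg (fun L : EY →L[ℂ] ℂ =>
        HasMFDerivAt 𝓘(ℂ, EY) 𝓘(ℂ) (f * k) (ι x) L) (h0 _ _)) this
  · rintro a b ⟨f, hfa, hf⟩ ⟨k, hkb, hk⟩
    refine ⟨f + k, ?_, ?_⟩
    · rw [Subring.coe_add, ← hfa, ← hkb]
      rfl
    · exact Eq.mp (congrArg (fun L : EY →L[ℂ] ℂ =>
        HasMFDerivAt 𝓘(ℂ, EY) 𝓘(ℂ) (f + k) (ι x) L) (add_zero 0)) (hf.add hk)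

lemma mfderiv_eq_of_thickGerm_eq {x : X} {f g : Y → ℂ}
    {hf : ContMDiffAt 𝓘(ℂ, EY) 𝓘(ℂ) ω f (ι x)} {hg : ContMDiffAt 𝓘(ℂ, EY) 𝓘(ℂ) ω g (ι x)}
    (h : thickGerm ι x f hf = thickGerm ι x g hg) :
    (mfderiv 𝓘(ℂ, EY) 𝓘(ℂ) f (ι x) : EY →L[ℂ] ℂ) = mfderiv 𝓘(ℂ, EY) 𝓘(ℂ) g (ι x) := by
  obtain ⟨k, hk, hk0⟩ := exists_rep_of_mem_idealGerms_sq ι (Ideal.Quotient.eq.1 h)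
  have h1 : k =ᶠ[𝓝 (ι x)] f - g := Filter.Germ.coe_eq.1 hk
  have h2 := (hf.mdifferentiableAt (by simp)).hasMFDerivAt.sub
    (hg.mdifferentiableAt (by simp)).hasMFDerivAt
  have h3 : HasMFDerivAt 𝓘(ℂ, EY) 𝓘(ℂ) (f - g) (ι x) (0 : EY →L[ℂ] ℂ) :=
    hk0.congr_of_eventuallyEq h1.symm
  have h4 := hasMFDerivAt_unique h2 h3
  exact sub_eq_zero.1 h4

/-- The differential along `X` of an element of `𝒪_{Y,x} / ℐ_x²`. -/
noncomputable def thickDeriv (x : X) (a : ThickStalk ι x) : EY →L[ℂ] ℂ :=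
  mfderiv 𝓘(ℂ, EY) 𝓘(ℂ) (exists_thickGerm ι a).choose (ι x)

lemma thickDeriv_thickGerm (x : X) (f : Y → ℂ) (hf : ContMDiffAt 𝓘(ℂ, EY) 𝓘(ℂ) ω f (ι x)) :
    thickDeriv ι x (thickGerm ι x f hf) = mfderiv 𝓘(ℂ, EY) 𝓘(ℂ) f (ι x) :=
  (mfderiv_eq_of_thickGerm_eq ι (exists_thickGerm ι (thickGerm ι x f hf)).choose_spec.choose_spec).symm

lemma thickDeriv_add {x : X} (a b : ThickStalk ι x) :
    thickDeriv ι x (a + b) = thickDeriv ι x a + thickDeriv ι x b := by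
  obtain ⟨f, hf, rfl⟩ := exists_thickGerm ι a
  obtain ⟨g, hg, rfl⟩ := exists_thickGerm ι b
  have h : thickGerm ι x f hf + thickGerm ι x g hg = thickGerm ι x (f + g) (hf.add hg) := rfl
  rw [h, thickDeriv_thickGerm, thickDeriv_thickGerm, thickDeriv_thickGerm]
  exact ((hf.mdifferentiableAt (by simp)).hasMFDerivAt.add
    (hg.mdifferentiableAt (by simp)).hasMFDerivAt).mfderiv

lemma thickDeriv_mul {x : X} (a b : ThickStalk ι x) :
    thickDeriv ι x (a * b) =
      thickValue ι x a • thickDeriv ι x b + thickValue ι x b • thickDeriv ι x a := by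
  obtain ⟨f, hf, rfl⟩ := exists_thickGerm ι a
  obtain ⟨g, hg, rfl⟩ := exists_thickGerm ι b
  have h : thickGerm ι x f hf * thickGerm ι x g hg = thickGerm ι x (f * g) (hf.mul hg) := rfl
  rw [h, thickDeriv_thickGerm, thickDeriv_thickGerm, thickDeriv_thickGerm]
  exact ((hf.mdifferentiableAt (by simp)).hasMFDerivAt.mul
    (hg.mdifferentiableAt (by simp)).hasMFDerivAt).mfderiv

/-- `thickDeriv` as an additive homomorphism. -/
noncomputable def thickDerivHom (x : X) : ThickStalk ι x →+ (EY →L[ℂ] ℂ) :=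
  AddMonoidHom.mk' (thickDeriv ι x) (thickDeriv_add ι)

lemma thickDeriv_zero (x : X) : thickDeriv ι x 0 = 0 := (thickDerivHom ι x).map_zero

lemma thickDeriv_sub {x : X} (a b : ThickStalk ι x) :
    thickDeriv ι x (a - b) = thickDeriv ι x a - thickDeriv ι x b := (thickDerivHom ι x).map_sub a b

lemma thickDeriv_sum {x : X} {α : Type*} (s : Finset α) (a : α → ThickStalk ι x) :
    thickDeriv ι x (∑ i ∈ s, a i) = ∑ i ∈ s, thickDeriv ι x (a i) := map_sum (thickDerivHom ι x) a s

lemma thickDeriv_one (x : X) : thickDeriv ι x 1 = 0 := by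
  have h := thickDeriv_mul ι (1 : ThickStalk ι x) 1
  rw [mul_one, map_one, one_smul] at h
  exact left_eq_add.1 h

/-- A family of stalk elements is a section of `𝒪_{X₁}` near `x`. -/
noncomputable def ThickAt (s : ∀ p : X, ThickStalk ι p) (x : X) : Prop :=
  ∃ f : Y → ℂ, ∀ᶠ p in 𝓝 x, ∃ hf : ContMDiffAt 𝓘(ℂ, EY) 𝓘(ℂ) ω f (ι p), s p = thickGerm ι p f hf

variable {ι} in
lemma ThickAt.congr {s t : ∀ p : X, ThickStalk ι p} {x : X} (hs : ThickAt ι s x)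
    (h : ∀ᶠ p in 𝓝 x, s p = t p) : ThickAt ι t x := by
  obtain ⟨f, hf⟩ := hs
  refine ⟨f, ?_⟩
  filter_upwards [hf, h] with p ⟨h1, h2⟩ h3
  exact ⟨h1, h3 ▸ h2⟩

variable {ι} in
lemma ThickAt.eventually {s : ∀ p : X, ThickStalk ι p} {x : X} (hs : ThickAt ι s x) :
    ∀ᶠ p in 𝓝 x, ThickAt ι s p := by
  obtain ⟨f, hf⟩ := hs
  filter_upwards [hf.eventually_nhds] with p hp
  exact ⟨f, hp⟩

variable {ι} in
lemma ThickAt.add {s t : ∀ p : X, ThickStalk ι p} {x : X} (hs : ThickAt ι s x)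
    (ht : ThickAt ι t x) : ThickAt ι (fun p => s p + t p) x := by
  obtain ⟨f, hf⟩ := hs
  obtain ⟨g, hg⟩ := ht
  refine ⟨f + g, ?_⟩
  filter_upwards [hf, hg] with p ⟨h1, h1'⟩ ⟨h2, h2'⟩
  exact ⟨h1.add h2, by rw [h1', h2']; rfl⟩

variable {ι} in
lemma ThickAt.mul {s t : ∀ p : X, ThickStalk ι p} {x : X} (hs : ThickAt ι s x)
    (ht : ThickAt ι t x) : ThickAt ι (fun p => s p * t p) x := by
  obtain ⟨f, hf⟩ := hs
  obtain ⟨g, hg⟩ := ht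
  refine ⟨f * g, ?_⟩
  filter_upwards [hf, hg] with p ⟨h1, h1'⟩ ⟨h2, h2'⟩
  exact ⟨h1.mul h2, by rw [h1', h2']; rfl⟩

variable {ι} in
lemma ThickAt.neg {s : ∀ p : X, ThickStalk ι p} {x : X} (hs : ThickAt ι s x) :
    ThickAt ι (fun p => - s p) x := by
  obtain ⟨f, hf⟩ := hs
  refine ⟨-f, ?_⟩
  filter_upwards [hf] with p ⟨h1, h1'⟩
  exact ⟨h1.neg, by rw [h1']; rfl⟩

lemma thickAt_zero (x : X) : ThickAt ι (fun _ => 0) x :=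
  ⟨fun _ => 0, .of_forall fun _ => ⟨contMDiffAt_const, rfl⟩⟩

lemma thickAt_one (x : X) : ThickAt ι (fun _ => 1) x :=
  ⟨fun _ => 1, .of_forall fun _ => ⟨contMDiffAt_const, rfl⟩⟩

variable {ι} in
lemma ThickAt.sub {s t : ∀ p : X, ThickStalk ι p} {x : X} (hs : ThickAt ι s x)
    (ht : ThickAt ι t x) : ThickAt ι (fun p => s p - t p) x :=
  (hs.add ht.neg).congr (.of_forall fun _ => (sub_eq_add_neg _ _).symm)

variable {ι} in
lemma ThickAt.sum {α : Type*} {t : Finset α} {s : α → ∀ p : X, ThickStalk ι p} {x : X}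
    (hs : ∀ i ∈ t, ThickAt ι (s i) x) : ThickAt ι (fun p => ∑ i ∈ t, s i p) x := by
  classical
  induction t using Finset.induction_on with
  | empty => simpa using thickAt_zero ι x
  | insert i t hi ih =>
    simp only [Finset.sum_insert hi]
    exact (hs i (t.mem_insert_self i)).add (ih fun j hj => hs j (Finset.mem_insert_of_mem hj))

variable {ι} in
lemma ThickAt.value {s : ∀ p : X, ThickStalk ι p} {x : X} (hs : ThickAt ι s x) :
    ContMDiffAt 𝓘(ℂ, EX) 𝓘(ℂ) ω (fun p => thickValue ι p (s p)) x := by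
  obtain ⟨f, hf⟩ := hs
  obtain ⟨h1, -⟩ := hf.self_of_nhds
  refine (h1.comp x (ι.contMDiff x)).congr_of_eventuallyEq ?_
  filter_upwards [hf] with p ⟨h2, h3⟩
  rw [h3]
  rfl

variable {ι} in
-- The chain rule for the restriction of an ambient representative to `X`. This is the only
-- constraint that links the two components of a jet.
lemma ThickAt.deriv_tangentInclusion {s : ∀ p : X, ThickStalk ι p} {x : X} (hs : ThickAt ι s x)
    (v : TangentSpace 𝓘(ℂ, EX) x) : thickDeriv ι x (s x) (tangentInclusion ι x v) =
      (mfderiv 𝓘(ℂ, EX) 𝓘(ℂ) (fun p => thickValue ι p (s p)) x : EX →L[ℂ] ℂ) v := by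
  obtain ⟨f, hf⟩ := hs
  obtain ⟨h1, h2⟩ := hf.self_of_nhds
  have h3 : (fun p => thickValue ι p (s p)) =ᶠ[𝓝 x] f ∘ ι := by
    filter_upwards [hf] with p ⟨h2, h3⟩
    rw [h3]
    rfl
  rw [h2, thickDeriv_thickGerm]
  have h4 := (((h1.mdifferentiableAt (by simp)).hasMFDerivAt.comp x
    ((ι.contMDiff x).mdifferentiableAt (by simp)).hasMFDerivAt).congr_of_eventuallyEq h3).mfderiv
  exact (congrArg (fun L : EX →L[ℂ] ℂ => L v) h4).symm

variable {ι} in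
/-- `𝒥² = 0`. -/
lemma ThickAt.mul_eq_zero (hι : Manifold.IsSmoothEmbedding 𝓘(ℂ, EX) 𝓘(ℂ, EY) ω ι)
    {s t : ∀ p : X, ThickStalk ι p} {x : X} (hs : ThickAt ι s x) (ht : ThickAt ι t x)
    (hs0 : ∀ᶠ p in 𝓝 x, thickValue ι p (s p) = 0) (ht0 : ∀ᶠ p in 𝓝 x, thickValue ι p (t p) = 0) :
    s x * t x = 0 := by
  have key : ∀ s : ∀ p : X, ThickStalk ι p, ThickAt ι s x →
      (∀ᶠ p in 𝓝 x, thickValue ι p (s p) = 0) →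
      ∃ g ∈ idealGerms ι x, s x = Ideal.Quotient.mk _ g := by
    rintro s ⟨f, hf⟩ hs0
    obtain ⟨h1, h2⟩ := hf.self_of_nhds
    refine ⟨_, ⟨f, rfl, ?_⟩, h2⟩
    have h3 : ∀ᶠ p in 𝓝 x, f (ι p) = 0 := by
      filter_upwards [hf, hs0] with p ⟨h4, h5⟩ h6
      rwa [h5] at h6
    -- Because `ι` is a topological embedding, vanishing of `f ∘ ι` near `x` is vanishing of `f` on
    -- the part of `X` in a neighbourhood of `ι x` in `Y`, which is what membership in `ℐ_x` asks
    -- for.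
    rw [hι.isEmbedding.nhds_eq_comap, Filter.eventually_comap] at h3
    filter_upwards [h3] with y hy
    rintro ⟨p, rfl⟩
    exact hy p rfl
  obtain ⟨a, ha, ha'⟩ := key s hs hs0
  obtain ⟨b, hb, hb'⟩ := key t ht ht0
  rw [ha', hb', ← map_mul, Ideal.Quotient.eq_zero_iff_mem, pow_two]
  exact Ideal.mul_mem_mul ha hb

section Manifold

variable [IsManifold 𝓘(ℂ, EY) ω Y]

/-- A `W`-valued `1`-form along `X`, i.e. a section of `Hom(T_{Y|X}, W)`, is holomorphic at `x`. -/
noncomputable def HolFormAt {W : Type*} [NormedAddCommGroup W] [NormedSpace ℂ W] (l : X → EY →L[ℂ] W) (x : X) :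
    Prop :=
  ContMDiffAt 𝓘(ℂ, EX) 𝓘(ℂ, EY →L[ℂ] W) ω (fun p => (l p).comp
    ((trivializationAt EY (TangentSpace 𝓘(ℂ, EY)) (ι x)).symmL ℂ (ι p) : EY →L[ℂ] EY)) x

lemma contMDiffAt_eventually_along {f : Y → ℂ} {x : X}
    (hf : ContMDiffAt 𝓘(ℂ, EY) 𝓘(ℂ) ω f (ι x)) :
    ∀ᶠ p in 𝓝 x, ContMDiffAt 𝓘(ℂ, EY) 𝓘(ℂ) ω f (ι p) :=
  (ι.contMDiff x).continuousAt.eventually ((contMDiffAt_iff_contMDiffAt_nhds (by simp)).1 hf)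

lemma exists_thickAt_of_contMDiffAt {f : Y → ℂ} {x : X}
    (hf : ContMDiffAt 𝓘(ℂ, EY) 𝓘(ℂ) ω f (ι x)) :
    ∃ s, ThickAt ι s x ∧ ∀ᶠ p in 𝓝 x, thickValue ι p (s p) = f (ι p) ∧
      thickDeriv ι p (s p) = mfderiv 𝓘(ℂ, EY) 𝓘(ℂ) f (ι p) := by
  classical
  have h := contMDiffAt_eventually_along ι hf
  refine ⟨fun p => if h : ContMDiffAt 𝓘(ℂ, EY) 𝓘(ℂ) ω f (ι p) then thickGerm ι p f h else 0,
    ⟨f, ?_⟩, ?_⟩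
  · filter_upwards [h] with p hp
    exact ⟨hp, dif_pos hp⟩
  · filter_upwards [h] with p hp
    rw [dif_pos hp]
    exact ⟨thickValue_thickGerm .., thickDeriv_thickGerm ..⟩

variable {ι} in
lemma ThickAt.holFormAt {s : ∀ p : X, ThickStalk ι p} {x : X} (hs : ThickAt ι s x) :
    HolFormAt ι (fun p => thickDeriv ι p (s p)) x := by
  obtain ⟨f, hf⟩ := hs
  obtain ⟨h1, -⟩ := hf.self_of_nhds
  have key : ContMDiffAt 𝓘(ℂ, EY) 𝓘(ℂ, EY →L[ℂ] ℂ) ω _ (ι x) :=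
    ContMDiffAt.mfderiv_const h1 (m := ω) (n := ω) (by rfl)
  refine (key.comp x (ι.contMDiff x)).congr_of_eventuallyEq ?_
  filter_upwards [hf] with p ⟨h2, h3⟩
  rw [h3, thickDeriv_thickGerm]
  simp only [Function.comp_apply, inTangentCoordinates, ContinuousLinearMap.inCoordinates]
  erw [TangentBundle.continuousLinearMapAt_model_space]
  rfl

end Manifold

end Jets

/-! ### Slice charts and the identification of `𝒪_Y/ℐ²` with jets along `X`. -/

section LocalStructure

variable {EX : Type*} [NormedAddCommGroup EX] [NormedSpace ℂ EX]
  {EY : Type*} [NormedAddCommGroup EY] [NormedSpace ℂ EY]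
  {X Y : Type u} [TopologicalSpace X] [ChartedSpace EX X]
  [TopologicalSpace Y] [ChartedSpace EY Y]
  (ι : C^ω⟮𝓘(ℂ, EX), X; 𝓘(ℂ, EY), Y⟯)

/-- A slice chart `ψ` (with inverse `ψ'`) of `Y` around a point of `X`: the submanifold is the fixed
locus of the linear projection `P`, and `r'` is the corresponding parametrization of `X`. -/
lemma exists_slice_chart [IsManifold 𝓘(ℂ, EX) ω X] [IsManifold 𝓘(ℂ, EY) ω Y]
    (hι : Manifold.IsSmoothEmbedding 𝓘(ℂ, EX) 𝓘(ℂ, EY) ω ι) (x : X) :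
    ∃ (ψ : Y → EY) (ψ' : EY → Y) (P : EY →L[ℂ] EY) (r : EY → X), (∀ w, P (P w) = P w) ∧
      ContMDiffAt 𝓘(ℂ, EY) 𝓘(ℂ, EY) ω ψ (ι x) ∧
      ContMDiffAt 𝓘(ℂ, EY) 𝓘(ℂ, EY) ω ψ' (ψ (ι x)) ∧
      (∀ᶠ y in 𝓝 (ι x), ψ' (ψ y) = y) ∧ (∀ᶠ p in 𝓝 x, P (ψ (ι p)) = ψ (ι p)) ∧
      (∀ᶠ w in 𝓝 (ψ (ι x)), ψ' (P w) = ι (r w)) ∧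
      ContMDiffAt 𝓘(ℂ, EY) 𝓘(ℂ, EX) ω r (ψ (ι x)) ∧ ∀ᶠ p in 𝓝 x, r (ψ (ι p)) = p := by
  obtain ⟨G, _, _, h⟩ := hι.isImmersion
  have h := h x
  have hw : ∀ p ∈ h.domChart.source, h.equiv.symm (h.codChart.extend 𝓘(ℂ, EY) (ι p)) =
      (h.domChart.extend 𝓘(ℂ, EX) p, 0) := by
    intro p hp
    have h1 := h.writtenInCharts ((h.domChart.extend 𝓘(ℂ, EX)).map_source
      (by rwa [h.domChart.extend_source]))
    simp only [Function.comp_apply] at h1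
    rw [h.domChart.extend_left_inv hp] at h1
    rw [h1, ContinuousLinearEquiv.symm_apply_apply]
  have hx := h.mem_domChart_source
  have hsrc : ∀ᶠ p in 𝓝 x, p ∈ h.domChart.source := h.domChart.open_source.mem_nhds hx
  -- In the immersion charts `EY` is `EX × G` and `ι` reads `u ↦ (u, 0)`. The map `P` forgets the
  -- `G` component, and `r` returns the point of `X` with coordinate `u`.
  let r : EY → X := fun w => (h.domChart.extend 𝓘(ℂ, EX)).symm (h.equiv.symm w).1
  let P : EY →L[ℂ] EY := (h.equiv : EX × G →L[ℂ] EY).comp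
    (((ContinuousLinearMap.inl ℂ EX G).comp (ContinuousLinearMap.fst ℂ EX G)).comp
      (h.equiv.symm : EY →L[ℂ] EX × G))
  have hP : ∀ w, P w = h.equiv ((h.equiv.symm w).1, 0) := fun w => rfl
  have hψ : ContMDiffAt 𝓘(ℂ, EY) 𝓘(ℂ, EY) ω (h.codChart.extend 𝓘(ℂ, EY)) (ι x) :=
    contMDiffAt_of_mem_maximalAtlas h.codChart_mem_maximalAtlas h.mem_codChart_source
  refine ⟨h.codChart.extend 𝓘(ℂ, EY), (h.codChart.extend 𝓘(ℂ, EY)).symm, P, r, ?_, hψ, ?_, ?_, ?_,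
    ?_, ?_, ?_⟩
  · intro w
    rw [hP, hP, ContinuousLinearEquiv.symm_apply_apply]
  · exact contMDiffAt_symm_of_mem_maximalAtlas h.codChart_mem_maximalAtlas
      (h.codChart.map_source h.mem_codChart_source)
  · filter_upwards [h.codChart.open_source.mem_nhds h.mem_codChart_source] with y hy
    exact h.codChart.extend_left_inv hy
  · filter_upwards [hsrc] with p hp
    rw [hP, hw p hp, ← hw p hp, ContinuousLinearEquiv.apply_symm_apply]
  · have h1 : ContinuousAt (fun w => (h.equiv.symm w).1) (h.codChart.extend 𝓘(ℂ, EY) (ι x)) := by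
      fun_prop
    have h2 : (h.domChart.extend 𝓘(ℂ, EX)).target ∈
        𝓝 ((h.equiv.symm (h.codChart.extend 𝓘(ℂ, EY) (ι x))).1) := by
      rw [hw x hx]
      exact h.domChart.isOpen_extend_target.mem_nhds ((h.domChart.extend 𝓘(ℂ, EX)).map_source
        (by rwa [h.domChart.extend_source]))
    filter_upwards [h1 h2] with w hw'
    have h3 := h.writtenInCharts hw'
    simp only [Function.comp_apply] at h3
    have h4 : r w ∈ h.domChart.source := by
      rw [← h.domChart.extend_source (I := 𝓘(ℂ, EX))]
      exact (h.domChart.extend 𝓘(ℂ, EX)).map_target hw'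
    rw [hP, ← h3]
    exact h.codChart.extend_left_inv (h.source_subset_preimage_source h4)
  · have h2 : ContMDiffAt 𝓘(ℂ, EY) 𝓘(ℂ, EX) ω (fun w => (h.equiv.symm w).1)
        (h.codChart.extend 𝓘(ℂ, EY) (ι x)) :=
      ((ContinuousLinearMap.fst ℂ EX G).comp
        (h.equiv.symm : EY →L[ℂ] EX × G)).contMDiff.contMDiffAt
    refine ContMDiffAt.comp (I' := 𝓘(ℂ, EX)) _ ?_ h2
    rw [hw x hx]
    exact contMDiffAt_symm_of_mem_maximalAtlas h.domChart_mem_maximalAtlas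
      (h.domChart.map_source hx)
  · filter_upwards [hsrc] with p hp
    simp only [r, hw p hp]
    exact h.domChart.extend_left_inv hp

lemma thickGerm_sum_eq_zero {α : Type*} {x : X} (t : Finset α) {f : α → Y → ℂ}
    (hf : ∀ i ∈ t, ∃ h : ContMDiffAt 𝓘(ℂ, EY) 𝓘(ℂ) ω (f i) (ι x), thickGerm ι x (f i) h = 0) :
    ∃ h : ContMDiffAt 𝓘(ℂ, EY) 𝓘(ℂ) ω (fun y => ∑ i ∈ t, f i y) (ι x),
      thickGerm ι x (fun y => ∑ i ∈ t, f i y) h = 0 := by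
  classical
  induction t using Finset.induction_on with
  | empty => exact ⟨contMDiffAt_const, rfl⟩
  | insert i t hi ih =>
    obtain ⟨h1, h1'⟩ := hf i (t.mem_insert_self i)
    obtain ⟨h2, h2'⟩ := ih fun j hj => hf j (Finset.mem_insert_of_mem hj)
    simp only [Finset.sum_insert hi]
    refine ⟨h1.add h2, ?_⟩
    have : thickGerm ι x _ (h1.add h2) = thickGerm ι x (f i) h1 +
      thickGerm ι x (fun y => ∑ i ∈ t, f i y) h2 := rfl
    exact this.trans (by rw [h1', h2', add_zero])

lemma thickGerm_mul_mul_eq_zero {x : X} {f g k : Y → ℂ}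
    (hf : ContMDiffAt 𝓘(ℂ, EY) 𝓘(ℂ) ω f (ι x)) (hg : ContMDiffAt 𝓘(ℂ, EY) 𝓘(ℂ) ω g (ι x))
    (hk : ContMDiffAt 𝓘(ℂ, EY) 𝓘(ℂ) ω k (ι x))
    (hf0 : ∀ᶠ y in 𝓝 (ι x), y ∈ Set.range ι → f y = 0)
    (hg0 : ∀ᶠ y in 𝓝 (ι x), y ∈ Set.range ι → g y = 0) :
    ∃ h : ContMDiffAt 𝓘(ℂ, EY) 𝓘(ℂ) ω (fun y => f y * g y * k y) (ι x),
      thickGerm ι x (fun y => f y * g y * k y) h = 0 := by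
  refine ⟨(hf.mul hg).mul hk, ?_⟩
  refine Ideal.Quotient.eq_zero_iff_mem.2 ?_
  let f' : holomorphicGerms EY (ι x) := ⟨f, f, hf, rfl⟩
  let g' : holomorphicGerms EY (ι x) := ⟨g, g, hg, rfl⟩
  let k' : holomorphicGerms EY (ι x) := ⟨k, k, hk, rfl⟩
  have hf' : f' ∈ idealGerms ι x := ⟨f, rfl, hf0⟩
  have hg' : g' ∈ idealGerms ι x := ⟨g, rfl, hg0⟩
  have h : f' * g' * k' ∈ idealGerms ι x ^ 2 := by
    rw [pow_two]
    exact Ideal.mul_mem_right _ _ (Ideal.mul_mem_mul hf' hg')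
  exact h

lemma HasMFDerivAt.cast_point {M M' H H' : Type*} [NormedAddCommGroup H] [NormedSpace ℂ H]
    [NormedAddCommGroup H'] [NormedSpace ℂ H'] [TopologicalSpace M] [ChartedSpace H M]
    [TopologicalSpace M'] [ChartedSpace H' M'] {f : M → M'} {p q : M} (hpq : p = q)
    {L : H →L[ℂ] H'} (h : HasMFDerivAt 𝓘(ℂ, H) 𝓘(ℂ, H') f p L) :
    HasMFDerivAt 𝓘(ℂ, H) 𝓘(ℂ, H') f q L := by
  subst hpq
  exact h

variable {ι} in
/-- A section of `𝒪_Y / ℐ²` whose `1`-jet along `X` vanishes is zero. -/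
theorem ThickAt.eq_zero [FiniteDimensional ℂ EY] [IsManifold 𝓘(ℂ, EX) ω X]
    [IsManifold 𝓘(ℂ, EY) ω Y]
    (hι : Manifold.IsSmoothEmbedding 𝓘(ℂ, EX) 𝓘(ℂ, EY) ω ι) {s : ∀ p : X, ThickStalk ι p} {x : X}
    (hs : ThickAt ι s x) (hv : ∀ᶠ p in 𝓝 x, thickValue ι p (s p) = 0)
    (hd : ∀ᶠ p in 𝓝 x, thickDeriv ι p (s p) = 0) : s x = 0 := by
  obtain ⟨f, hf⟩ := hs
  obtain ⟨hfx, hsx⟩ := hf.self_of_nhds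
  obtain ⟨ψ, ψ', P, r, hPP, hψ, hψ', hinv, hPψ, hr, hrd, hrι⟩ := exists_slice_chart ι hι x
  have hψx : ψ' (ψ (ι x)) = ι x := hinv.self_of_nhds
  have hPx : P (ψ (ι x)) = ψ (ι x) := hPψ.self_of_nhds
  have hrx : r (ψ (ι x)) = x := hrι.self_of_nhds
  have hφ : AnalyticAt ℂ (f ∘ ψ') (ψ (ι x)) := by
    have h1 : ContMDiffAt 𝓘(ℂ, EY) 𝓘(ℂ) ω (f ∘ ψ') (ψ (ι x)) :=
      ContMDiffAt.comp (I' := 𝓘(ℂ, EY)) _ (by rw [hψx]; exact hfx) hψ'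
    exact (contMDiffAt_iff_contDiffAt.1 h1).analyticAt
  have hrt : Filter.Tendsto r (𝓝 (ψ (ι x))) (𝓝 x) := by
    have := hrd.continuousAt.tendsto
    rwa [hrx] at this
  have hPt : Filter.Tendsto P (𝓝 (ψ (ι x))) (𝓝 (ψ (ι x))) := by
    have h1 : Continuous P := P.cont
    have := h1.tendsto (ψ (ι x))
    rwa [hPx] at this
  have hval : ∀ᶠ w in 𝓝 (ψ (ι x)), (f ∘ ψ') (P w) = 0 := by
    filter_upwards [hr, hrt.eventually (hf.and hv)] with w h1 ⟨⟨h2, h3⟩, h4⟩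
    rw [Function.comp_apply, h1]
    rwa [h3] at h4
  -- Points `P w` correspond to `ι (r w)`, where `df` is the differential of the given section and
  -- so vanishes; the chain rule with `ψ'` gives the claim in coordinates.
  have hder : ∀ᶠ w in 𝓝 (ψ (ι x)), fderiv ℂ (f ∘ ψ') (P w) = 0 := by
    filter_upwards [hr, hrt.eventually (hf.and hd),
      hPt.eventually ((contMDiffAt_iff_contMDiffAt_nhds (by simp)).1 hψ')] with w h1 ⟨⟨h2, h3⟩, h4⟩ h5
    rw [h3, thickDeriv_thickGerm] at h4
    have h6 : HasMFDerivAt 𝓘(ℂ, EY) 𝓘(ℂ) f (ι (r w)) (0 : EY →L[ℂ] ℂ) := by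
      rw [← h4]
      exact (h2.mdifferentiableAt (by simp)).hasMFDerivAt
    obtain ⟨A, hA⟩ : ∃ A : EY →L[ℂ] EY, HasMFDerivAt 𝓘(ℂ, EY) 𝓘(ℂ, EY) ψ' (P w) A :=
      ⟨_, (h5.mdifferentiableAt (by simp)).hasMFDerivAt⟩
    have h7 : HasMFDerivAt 𝓘(ℂ, EY) 𝓘(ℂ) (f ∘ ψ') (P w) ((0 : EY →L[ℂ] ℂ).comp A) :=
      HasMFDerivAt.comp (P w) (h6.cast_point h1.symm) hA
    have h8 : HasFDerivAt (f ∘ ψ') ((0 : EY →L[ℂ] ℂ).comp A) (P w) :=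
      hasMFDerivAt_iff_hasFDerivAt.1 h7
    rw [h8.fderiv, ContinuousLinearMap.zero_comp]
  -- Hadamard is applied twice. As `φ` vanishes on the slice, `φ w = H w (w - P w)`; as `dφ`
  -- vanishes there, so does `H`, and `H w = K w (w - P w)`. Thus `f` is quadratic in the transverse
  -- displacement `w - P w`.
  obtain ⟨H, hH, hH1, hH2⟩ := hφ.exists_hadamard P hPP hPx
  obtain ⟨K, hK, hK1, -⟩ := hH.exists_hadamard P hPP hPx
  -- A finite basis writes this quadratic expression as a finite sum of `z i * z j * k i j`; each `z
  -- i` vanishes on `X`, so every term lies in `ℐ²`.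
  let b := Module.finBasis ℂ EY
  let z : Fin (Module.finrank ℂ EY) → Y → ℂ := fun i y => b.coord i (ψ y - P (ψ y))
  let k : Fin (Module.finrank ℂ EY) → Fin (Module.finrank ℂ EY) → Y → ℂ := fun i j y =>
    K (ψ y) (b i) (b j)
  have hz : ∀ i, ContMDiffAt 𝓘(ℂ, EY) 𝓘(ℂ) ω (z i) (ι x) := by
    intro i
    let L : EY →L[ℂ] ℂ := (LinearMap.toContinuousLinearMap (b.coord i) : EY →L[ℂ] ℂ).comp
      (ContinuousLinearMap.id ℂ EY - P)
    exact ContMDiffAt.comp (I' := 𝓘(ℂ, EY)) (g := L) (ι x) L.contMDiff.contMDiffAt hψ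
  have hk : ∀ i j, ContMDiffAt 𝓘(ℂ, EY) 𝓘(ℂ) ω (k i j) (ι x) := by
    intro i j
    have h1 : ContMDiffAt 𝓘(ℂ, EY) 𝓘(ℂ, EY →L[ℂ] EY →L[ℂ] ℂ) ω K (ψ (ι x)) :=
      contMDiffAt_iff_contDiffAt.2 hK.contDiffAt
    exact ((h1.comp (ι x) hψ).clm_apply contMDiffAt_const).clm_apply contMDiffAt_const
  have hz0 : ∀ i, ∀ᶠ y in 𝓝 (ι x), y ∈ Set.range ι → z i y = 0 := by
    intro i
    have h1 := hPψ
    rw [hι.isEmbedding.nhds_eq_comap, Filter.eventually_comap] at h1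
    filter_upwards [h1] with y hy
    rintro ⟨p, rfl⟩
    simp only [z]
    rw [hy p rfl, sub_self, map_zero]
  have hsum : f =ᶠ[𝓝 (ι x)] fun y => ∑ i, ∑ j, z i y * z j y * k i j y := by
    have hψt := hψ.continuousAt.tendsto
    filter_upwards [hinv, hψt.eventually (hval.and (hder.and (hH1.and hK1)))] with
      y h1 ⟨h2, h3, h4, h5⟩
    rw [Function.comp_apply, h1, h2, sub_zero] at h4
    rw [hH2, h3, sub_zero] at h5
    rw [h4, h5]
    have h6 : ψ y - P (ψ y) = ∑ i, z i y • b i := (b.sum_repr _).symm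
    rw [h6]
    simp only [map_sum, map_smul, sum_apply, smul_apply, smul_eq_mul, k, Finset.mul_sum]
    rw [Finset.sum_comm]
    refine Finset.sum_congr rfl fun i _ => Finset.sum_congr rfl fun j _ => ?_
    ring
  obtain ⟨h1, h2⟩ := thickGerm_sum_eq_zero ι (x := x) Finset.univ
    (f := fun i y => ∑ j, z i y * z j y * k i j y) fun i _ =>
      thickGerm_sum_eq_zero ι Finset.univ fun j _ =>
        thickGerm_mul_mul_eq_zero ι (hz i) (hz j) (hk i j) (hz0 i) (hz0 j)
  rw [hsx, thickGerm_congr ι hsum hfx h1, h2]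

/-- A holomorphic function on `X` together with a compatible holomorphic `1`-form along `X` is the
`1`-jet of a section of `𝒪_Y / ℐ²`. -/
theorem exists_thickAt_of_jet [IsManifold 𝓘(ℂ, EX) ω X] [IsManifold 𝓘(ℂ, EY) ω Y]
    (hι : Manifold.IsSmoothEmbedding 𝓘(ℂ, EX) 𝓘(ℂ, EY) ω ι) {f : X → ℂ} {l : X → EY →L[ℂ] ℂ} {x : X}
    (hf : ContMDiffAt 𝓘(ℂ, EX) 𝓘(ℂ) ω f x) (hl : HolFormAt ι l x)
    (hfl : ∀ᶠ p in 𝓝 x, ∀ v, l p (tangentInclusion ι p v) =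
      (mfderiv 𝓘(ℂ, EX) 𝓘(ℂ) f p : EX →L[ℂ] ℂ) v) :
    ∃ s, ThickAt ι s x ∧ ∀ᶠ p in 𝓝 x, thickValue ι p (s p) = f p ∧ thickDeriv ι p (s p) = l p := by
  obtain ⟨ψ, -, -, r', -, hψ, -, -, -, -, hrd, hrι⟩ := exists_slice_chart ι hι x
  set r : Y → X := fun y => r' (ψ y) with hr
  have hrx : r (ι x) = x := hrι.self_of_nhds
  have hrc : ContMDiffAt 𝓘(ℂ, EY) 𝓘(ℂ, EX) ω r (ι x) := hrd.comp (ι x) hψ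
  let τ := trivializationAt EY (TangentSpace 𝓘(ℂ, EY)) (ι x)
  let l' : X → EY →L[ℂ] ℂ := fun p => (l p).comp (τ.symmL ℂ (ι p) : EY →L[ℂ] EY)
  have hl' : ContMDiffAt 𝓘(ℂ, EX) 𝓘(ℂ, EY →L[ℂ] ℂ) ω l' x := hl
  let χ : Y → EY := extChartAt 𝓘(ℂ, EY) (ι x)
  have hχ : ContMDiffAt 𝓘(ℂ, EY) 𝓘(ℂ, EY) ω χ (ι x) := contMDiffAt_extChartAt
  -- The first-order Taylor polynomial transverse to `X`, where `r` is a local retraction of `Y`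
  -- onto `X` and `χ` a chart of `Y`. Along `X` its differential is `df ∘ dr + l ∘ (id - dι ∘ dr)`,
  -- which is `l` by the compatibility `l ∘ dι = df`.
  let g : Y → ℂ := fun y => f (r y) + l' (r y) (χ y - χ (ι (r y)))
  have hg : ContMDiffAt 𝓘(ℂ, EY) 𝓘(ℂ) ω g (ι x) := by
    have h1 : ContMDiffAt 𝓘(ℂ, EY) 𝓘(ℂ) ω (fun y => f (r y)) (ι x) :=
      ContMDiffAt.comp (I' := 𝓘(ℂ, EX)) (ι x) (by rwa [hrx]) hrc
    have h2 : ContMDiffAt 𝓘(ℂ, EY) 𝓘(ℂ, EY →L[ℂ] ℂ) ω (fun y => l' (r y)) (ι x) :=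
      ContMDiffAt.comp (I' := 𝓘(ℂ, EX)) (ι x) (by rwa [hrx]) hrc
    have h3 : ContMDiffAt 𝓘(ℂ, EY) 𝓘(ℂ, EY) ω (fun y => ι (r y)) (ι x) :=
      ContMDiffAt.comp (I' := 𝓘(ℂ, EX)) (ι x) (ι.contMDiff _) hrc
    have h4 : ContMDiffAt 𝓘(ℂ, EY) 𝓘(ℂ, EY) ω (fun y => χ (ι (r y))) (ι x) :=
      ContMDiffAt.comp (I' := 𝓘(ℂ, EY)) (ι x) (by rwa [hrx]) h3
    exact h1.add (h2.clm_apply (hχ.sub h4))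
  obtain ⟨s, hs, hs'⟩ := exists_thickAt_of_contMDiffAt ι hg
  refine ⟨s, hs, ?_⟩
  have hιt := (ι.contMDiff x).continuousAt.tendsto
  have hchart : ∀ᶠ y in 𝓝 (ι x), y ∈ (chartAt EY (ι x)).source :=
    (chartAt EY (ι x)).open_source.mem_nhds (mem_chart_source EY (ι x))
  filter_upwards [hs', hrι, hfl, hιt.eventually hchart,
    hιt.eventually ((contMDiffAt_iff_contMDiffAt_nhds (by simp)).1 hrc),
    hιt.eventually ((contMDiffAt_iff_contMDiffAt_nhds (by simp)).1 hχ),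
    (contMDiffAt_iff_contMDiffAt_nhds (by simp)).1 hf,
    (contMDiffAt_iff_contMDiffAt_nhds (by simp)).1 hl'] with p ⟨h1, h2⟩ hrp h4 h5 h6 h7 h8 h9
  have h3 : r (ι p) = p := hrp
  refine ⟨?_, ?_⟩
  · rw [h1]
    simp only [g, h3, sub_self, map_zero, add_zero]
  · rw [h2]
    obtain ⟨R, hR⟩ : ∃ R : EY →L[ℂ] EX, HasMFDerivAt 𝓘(ℂ, EY) 𝓘(ℂ, EX) r (ι p) R :=
      ⟨_, (h6.mdifferentiableAt (by simp)).hasMFDerivAt⟩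
    obtain ⟨D, hD, hD'⟩ : ∃ D : EX →L[ℂ] ℂ, HasMFDerivAt 𝓘(ℂ, EX) 𝓘(ℂ) f p D ∧
        ∀ v, l p (tangentInclusion ι p v) = D v :=
      ⟨_, (h8.mdifferentiableAt (by simp)).hasMFDerivAt, h4⟩
    obtain ⟨Q, hQ⟩ : ∃ Q : EX →L[ℂ] (EY →L[ℂ] ℂ), HasMFDerivAt 𝓘(ℂ, EX) 𝓘(ℂ, EY →L[ℂ] ℂ) l' p Q :=
      ⟨_, (h9.mdifferentiableAt (by simp)).hasMFDerivAt⟩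
    obtain ⟨T, hT, hT'⟩ : ∃ T : EX →L[ℂ] EY, HasMFDerivAt 𝓘(ℂ, EX) 𝓘(ℂ, EY) ι p T ∧
        ∀ v : EX, tangentInclusion ι p v = T v :=
      ⟨_, ((ι.contMDiff p).mdifferentiableAt (by simp)).hasMFDerivAt, fun _ => rfl⟩
    -- The trivialization of the tangent bundle at `ι x` is the differential of `χ`, so expressing
    -- `l` in that trivialization is undone by `dχ`.
    obtain ⟨C, hC, hC'⟩ : ∃ C : EY →L[ℂ] EY, HasMFDerivAt 𝓘(ℂ, EY) 𝓘(ℂ, EY) χ (ι p) C ∧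
        ∀ v, l' p (C v) = l p v := by
      refine ⟨_, (h7.mdifferentiableAt (by simp)).hasMFDerivAt, fun v => ?_⟩
      have e1 := TangentBundle.continuousLinearMapAt_trivializationAt (I := 𝓘(ℂ, EY)) h5
      have e2 := τ.symmL_continuousLinearMapAt (R := ℂ) (b := ι p)
        (by simpa [τ] using h5) v
      refine Eq.trans ?_ (congrArg (l p) e2)
      exact congrArg (fun L : EY →L[ℂ] EY => l p ((τ.symmL ℂ (ι p) : EY →L[ℂ] EY) (L v))) e1.symm
    have k1 : HasMFDerivAt 𝓘(ℂ, EY) 𝓘(ℂ) (fun y => f (r y)) (ι p) (D.comp R) :=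
      HasMFDerivAt.comp (ι p) (hD.cast_point h3.symm) hR
    have k2 : HasMFDerivAt 𝓘(ℂ, EY) 𝓘(ℂ, EY →L[ℂ] ℂ) (fun y => l' (r y)) (ι p) (Q.comp R) :=
      HasMFDerivAt.comp (ι p) (hQ.cast_point h3.symm) hR
    have k3 : HasMFDerivAt 𝓘(ℂ, EY) 𝓘(ℂ, EY) (fun y => ι (r y)) (ι p) (T.comp R) :=
      HasMFDerivAt.comp (ι p) (hT.cast_point h3.symm) hR
    have k4 : HasMFDerivAt 𝓘(ℂ, EY) 𝓘(ℂ, EY) (fun y => χ (ι (r y))) (ι p) (C.comp (T.comp R)) :=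
      HasMFDerivAt.comp (ι p) (hC.cast_point (congrArg ι h3.symm)) k3
    have k5 : HasMFDerivAt 𝓘(ℂ, EY) 𝓘(ℂ, EY) (fun y => χ y - χ (ι (r y))) (ι p)
        (C - C.comp (T.comp R)) := hC.sub k4
    have k6 : HasMFDerivAt 𝓘(ℂ, EY) 𝓘(ℂ, (EY →L[ℂ] ℂ) × EY)
        (fun y => (l' (r y), χ y - χ (ι (r y)))) (ι p) ((Q.comp R).prod (C - C.comp (T.comp R))) :=
      ⟨k2.1.prodMk k5.1, k2.2.prodMk k5.2⟩
    have hb := (isBoundedBilinearMap_apply (𝕜 := ℂ) (E := EY) (F := ℂ)).hasFDerivAt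
      (l' (r (ι p)), χ (ι p) - χ (ι (r (ι p))))
    have k7 : HasMFDerivAt 𝓘(ℂ, EY) 𝓘(ℂ) g (ι p) _ :=
      k1.add (HasMFDerivAt.comp (I' := 𝓘(ℂ, (EY →L[ℂ] ℂ) × EY)) (ι p) hb.hasMFDerivAt k6)
    refine k7.mfderiv.trans ?_
    refine ContinuousLinearMap.ext fun v : EY => ?_
    change D (R v) + (l' (r (ι p)) (C v - C (T (R v))) +
      Q (R v) (χ (ι p) - χ (ι (r (ι p))))) = l p v
    have e : l p (T (R v)) = D (R v) :=
      (congrArg (l p) (hT' (R v))).symm.trans (hD' (R v))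
    rw [h3, sub_self, map_zero, add_zero, map_sub, hC', hC', e]
    abel

end LocalStructure

/-! ### Endomorphisms of `F` as matrices. -/

section MatrixEntries

variable (F : Type*) [NormedAddCommGroup F] [NormedSpace ℂ F] [FiniteDimensional ℂ F]

/-- The coordinates on `F` with respect to the standard basis. -/
noncomputable def coordCLM (i : Fin (Module.finrank ℂ F)) : F →L[ℂ] ℂ :=
  LinearMap.toContinuousLinearMap ((Module.finBasis ℂ F).coord i)

/-- The matrix entries of an endomorphism of `F`. -/
noncomputable def entryCLM (i j : Fin (Module.finrank ℂ F)) : (F →L[ℂ] F) →L[ℂ] ℂ :=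
  (coordCLM F i).comp (ContinuousLinearMap.apply ℂ F (Module.finBasis ℂ F j))

/-- The elementary matrices. -/
noncomputable def elemCLM (i j : Fin (Module.finrank ℂ F)) : F →L[ℂ] F :=
  (coordCLM F j).smulRight (Module.finBasis ℂ F i)

lemma coordCLM_basis (i j : Fin (Module.finrank ℂ F)) :
    coordCLM F i (Module.finBasis ℂ F j) = if j = i then 1 else 0 := by
  simp [coordCLM, Finsupp.single_apply]

variable {F}

lemma sum_coordCLM_smul (v : F) : ∑ i, coordCLM F i v • Module.finBasis ℂ F i = v :=
  (Module.finBasis ℂ F).sum_repr v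

lemma entryCLM_apply (i j : Fin (Module.finrank ℂ F)) (T : F →L[ℂ] F) :
    entryCLM F i j T = coordCLM F i (T (Module.finBasis ℂ F j)) := rfl

lemma ext_entryCLM {T S : F →L[ℂ] F} (h : ∀ i j, entryCLM F i j T = entryCLM F i j S) : T = S := by
  have h1 : (T : F →ₗ[ℂ] F) = S := (Module.finBasis ℂ F).ext fun j => by
    change T (Module.finBasis ℂ F j) = S (Module.finBasis ℂ F j)
    rw [← sum_coordCLM_smul (T (Module.finBasis ℂ F j))]
    exact (Finset.sum_congr rfl fun i _ => by
      rw [← entryCLM_apply, h, entryCLM_apply]).trans (sum_coordCLM_smul _)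
  exact ContinuousLinearMap.coe_injective h1

lemma coordCLM_apply_eq_sum (i : Fin (Module.finrank ℂ F)) (T : F →L[ℂ] F) (v : F) :
    coordCLM F i (T v) = ∑ k, entryCLM F i k T * coordCLM F k v := by
  conv_lhs => rw [← sum_coordCLM_smul v]
  simp only [map_sum, map_smul, smul_eq_mul, entryCLM_apply]
  exact Finset.sum_congr rfl fun k _ => mul_comm _ _

lemma entryCLM_comp (i j : Fin (Module.finrank ℂ F)) (T S : F →L[ℂ] F) :
    entryCLM F i j (T.comp S) = ∑ k, entryCLM F i k T * entryCLM F k j S :=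
  coordCLM_apply_eq_sum i T _

lemma entryCLM_id (i j : Fin (Module.finrank ℂ F)) :
    entryCLM F i j (ContinuousLinearMap.id ℂ F) = (1 : Matrix _ _ ℂ) i j := by
  rw [entryCLM_apply, ContinuousLinearMap.id_apply, coordCLM_basis, Matrix.one_apply]
  simp only [eq_comm]

lemma entryCLM_elemCLM (i j k l : Fin (Module.finrank ℂ F)) :
    entryCLM F i j (elemCLM F k l) = if k = i ∧ l = j then 1 else 0 := by
  simp only [entryCLM_apply, elemCLM, ContinuousLinearMap.smulRight_apply, map_smul,
    coordCLM_basis, smul_eq_mul]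
  grind

/-- The endomorphism valued form with given entries. -/
noncomputable def endFormOfEntries {EY : Type*} [NormedAddCommGroup EY] [NormedSpace ℂ EY]
    (m : Fin (Module.finrank ℂ F) → Fin (Module.finrank ℂ F) → EY →L[ℂ] ℂ) :
    EY →L[ℂ] (F →L[ℂ] F) :=
  ∑ k, ∑ l, ((ContinuousLinearMap.toSpanSingleton ℂ (elemCLM F k l))).comp (m k l)

lemma entryCLM_endFormOfEntries {EY : Type*} [NormedAddCommGroup EY] [NormedSpace ℂ EY]
    (m : Fin (Module.finrank ℂ F) → Fin (Module.finrank ℂ F) → EY →L[ℂ] ℂ) (v : EY)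
    (i j : Fin (Module.finrank ℂ F)) : entryCLM F i j (endFormOfEntries m v) = m i j v := by
  simp only [endFormOfEntries, sum_apply, map_sum, ContinuousLinearMap.comp_apply,
    ContinuousLinearMap.toSpanSingleton_apply, map_smul, entryCLM_elemCLM, smul_eq_mul]
  rw [Finset.sum_eq_single i, Finset.sum_eq_single j]
  · simp
  · intro l _ hl
    simp [hl]
  · simp
  · intro k _ hk
    simp [hk]
  · simp

end MatrixEntries

/-! ### Global jets on open sets, and conjugation of forms by local frames. -/

section ThickCocycle

variable {EX : Type*} [NormedAddCommGroup EX] [NormedSpace ℂ EX]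
  {EY : Type*} [NormedAddCommGroup EY] [NormedSpace ℂ EY]
  {X Y : Type u} [TopologicalSpace X] [ChartedSpace EX X] [IsManifold 𝓘(ℂ, EX) ω X]
  [TopologicalSpace Y] [ChartedSpace EY Y] [IsManifold 𝓘(ℂ, EY) ω Y]
  (ι : C^ω⟮𝓘(ℂ, EX), X; 𝓘(ℂ, EY), Y⟯)

/-- Local solutions with the prescribed jet are unique by `ThickAt.eq_zero`, so they agree on
overlaps and glue. -/
lemma exists_thick_of_jet_on [FiniteDimensional ℂ EY]
    (hι : Manifold.IsSmoothEmbedding 𝓘(ℂ, EX) 𝓘(ℂ, EY) ω ι)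
    {f : X → ℂ} {l : X → EY →L[ℂ] ℂ} {O : Set X} (hO : IsOpen O)
    (hf : ∀ x ∈ O, ContMDiffAt 𝓘(ℂ, EX) 𝓘(ℂ) ω f x) (hl : ∀ x ∈ O, HolFormAt ι l x)
    (hfl : ∀ x ∈ O, ∀ v, l x (tangentInclusion ι x v) =
      (mfderiv 𝓘(ℂ, EX) 𝓘(ℂ) f x : EX →L[ℂ] ℂ) v) :
    ∃ s : ∀ p : X, ThickStalk ι p, ∀ x ∈ O, ThickAt ι s x ∧ thickValue ι x (s x) = f x ∧
      thickDeriv ι x (s x) = l x := by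
  classical
  have h : ∀ x, ∃ s : ∀ p : X, ThickStalk ι p, x ∈ O → ThickAt ι s x ∧
      ∀ᶠ p in 𝓝 x, thickValue ι p (s p) = f p ∧ thickDeriv ι p (s p) = l p := by
    intro x
    by_cases hx : x ∈ O
    · obtain ⟨s, hs⟩ := exists_thickAt_of_jet ι hι (hf x hx) (hl x hx) (by
        filter_upwards [hO.mem_nhds hx] with p hp
        exact hfl p hp)
      exact ⟨s, fun _ => hs⟩
    · exact ⟨0, fun h => absurd h hx⟩
  choose s hs using h
  -- At `p` the solution constructed around `p` itself is used; by uniqueness it coincides with the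
  -- one around any nearby `x`.
  refine ⟨fun p => s p p, fun x hx => ⟨?_, (hs x hx).2.self_of_nhds⟩⟩
  refine (hs x hx).1.congr ?_
  filter_upwards [hO.mem_nhds hx, (hs x hx).1.eventually, (hs x hx).2.eventually_nhds] with
    p hp h1 h2
  refine sub_eq_zero.1 (ThickAt.eq_zero (s := fun q => s x q - s p q) hι (h1.sub (hs p hp).1) ?_ ?_)
  · filter_upwards [h2, (hs p hp).2] with q h3 h4
    rw [map_sub, h3.1, h4.1, sub_self]
  · filter_upwards [h2, (hs p hp).2] with q h3 h4
    rw [thickDeriv_sub, h3.2, h4.2, sub_self]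

omit [IsManifold 𝓘(ℂ, EX) ω X] in
variable {ι} in
lemma HolFormAt.clm_comp {W W' : Type*} [NormedAddCommGroup W] [NormedSpace ℂ W]
    [NormedAddCommGroup W'] [NormedSpace ℂ W'] {l : X → EY →L[ℂ] W} {x : X}
    {A : X → W →L[ℂ] W'} (hA : ContMDiffAt 𝓘(ℂ, EX) 𝓘(ℂ, W →L[ℂ] W') ω A x)
    (hl : HolFormAt ι l x) : HolFormAt ι (fun p => (A p).comp (l p)) x := by
  have h := ContMDiffAt.clm_comp hA (show ContMDiffAt 𝓘(ℂ, EX) 𝓘(ℂ, EY →L[ℂ] W) ω _ x from hl)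
  exact h

omit [IsManifold 𝓘(ℂ, EX) ω X] in
variable {ι} in
lemma HolFormAt.sum {W α : Type*} [NormedAddCommGroup W] [NormedSpace ℂ W] {t : Finset α}
    {l : α → X → EY →L[ℂ] W} {x : X} (hl : ∀ i ∈ t, HolFormAt ι (l i) x) :
    HolFormAt ι (fun p => ∑ i ∈ t, l i p) x := by
  classical
  induction t using Finset.induction_on with
  | empty =>
    simp only [Finset.sum_empty]
    exact (contMDiffAt_const (c := (0 : EY →L[ℂ] W))).congr_of_eventuallyEq
      (.of_forall fun p => ContinuousLinearMap.zero_comp _)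
  | insert i t hi ih =>
    simp only [Finset.sum_insert hi]
    refine (ContMDiffAt.add (hl i (t.mem_insert_self i))
      (ih fun j hj => hl j (Finset.mem_insert_of_mem hj))).congr_of_eventuallyEq
      (.of_forall fun p => ContinuousLinearMap.add_comp _ _ _)

variable (F : Type*) [NormedAddCommGroup F] [NormedSpace ℂ F]
  (E : X → Type*) [TopologicalSpace (TotalSpace F E)] [∀ x, AddCommGroup (E x)]
  [∀ x, Module ℂ (E x)] [∀ x, TopologicalSpace (E x)] [FiberBundle F E] [VectorBundle ℂ F E]
  [∀ x, IsTopologicalAddGroup (E x)] [∀ x, ContinuousSMul ℂ (E x)]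
  [ContMDiffVectorBundle ω F E 𝓘(ℂ, EX)]

lemma endBundle_continuousLinearMapAt {p q : X} (hq : q ∈ (trivializationAt F E p).baseSet)
    (φ : EndBundle E q) : (trivializationAt (F →L[ℂ] F) (EndBundle E) p).continuousLinearMapAt
      ℂ q φ = ((trivializationAt F E p).continuousLinearMapAt ℂ q).comp
        (φ.comp ((trivializationAt F E p).symmL ℂ q)) := by
  rw [Trivialization.continuousLinearMapAt_apply, Trivialization.coe_linearMapAt_of_mem]
  · rfl
  · exact ⟨hq, hq⟩

/-- The `End E`-valued form `e_x⁻¹ ∘ Λ ∘ e_y` along `X`. -/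
noncomputable def conjForm (x y : X) (Λ : X → EY →L[ℂ] (F →L[ℂ] F)) (p : X) :
    AmbientTangent ι p →L[ℂ] EndBundle E p :=
  (((trivializationAt F E y).continuousLinearMapAt ℂ p).precomp (E p)).comp
    ((((trivializationAt F E x).symmL ℂ p).postcomp F).comp (Λ p))

/-- The form `e_x ∘ B ∘ e_y⁻¹`. -/
noncomputable def unconjForm (x y : X) (B : ∀ p, AmbientTangent ι p →L[ℂ] EndBundle E p) (p : X) :
    EY →L[ℂ] (F →L[ℂ] F) :=
  (((trivializationAt F E y).symmL ℂ p).precomp F).comp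
    ((((trivializationAt F E x).continuousLinearMapAt ℂ p).postcomp (E p)).comp (B p))

omit [IsManifold 𝓘(ℂ, EX) ω X] in
lemma eventually_mem_tangent_baseSet (p : X) : ∀ᶠ q in 𝓝 p,
    ι q ∈ (trivializationAt EY (TangentSpace 𝓘(ℂ, EY)) (ι p)).baseSet :=
  ι.contMDiff.continuous.continuousAt.preimage_mem_nhds
    ((trivializationAt EY (TangentSpace 𝓘(ℂ, EY)) (ι p)).open_baseSet.mem_nhds
      (FiberBundle.mem_baseSet_trivializationAt _ _ _))

/-- Read in the trivialization at `p`, conjugation multiplies `Λ` by the holomorphic functions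
`g_px` on the left and `g_yp` on the right. -/
lemma conjForm_mem_germs {x y p : X} (hx : p ∈ (trivializationAt F E x).baseSet)
    (hy : p ∈ (trivializationAt F E y).baseSet) {Λ : X → EY →L[ℂ] (F →L[ℂ] F)}
    (hΛ : HolFormAt ι Λ p) :
    conjForm ι F E x y Λ ∈ (holomorphicSections (EX := EX) (EY →L[ℂ] (F →L[ℂ] F))
      (fun p => AmbientTangent ι p →L[ℂ] EndBundle E p)).germs p := by
  refine (contMDiffAt_hom_bundle _).2 ⟨contMDiffAt_id, ?_⟩
  have hp := FiberBundle.mem_baseSet_trivializationAt F E p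
  have k1 := (contMDiffAt_bundleTransition (EX := EX) F E hp hx).clm_postcomp (F₁ := F)
  have k2 := (contMDiffAt_bundleTransition (EX := EX) F E hy hp).clm_precomp (F₃ := F)
  refine (k2.clm_comp (k1.clm_comp hΛ)).congr_of_eventuallyEq ?_
  filter_upwards [(trivializationAt F E p).open_baseSet.mem_nhds hp,
    (trivializationAt F E x).open_baseSet.mem_nhds hx,
    (trivializationAt F E y).open_baseSet.mem_nhds hy,
    eventually_mem_tangent_baseSet ι p] with q hq hqx hqy hqT
  ext v w
  refine (congrArg (fun L : F →L[ℂ] F => L w) (endBundle_continuousLinearMapAt F E hq _)).trans ?_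
  refine Eq.trans ?_ (bundleTransition_apply F E hq hqx _).symm
  refine congrArg (fun u => (trivializationAt F E p).continuousLinearMapAt ℂ q
    ((trivializationAt F E x).symmL ℂ q u)) ?_
  have e2 := pullback_symmL (F := EY) (V := (TangentSpace 𝓘(ℂ, EY) : Y → Type _)) ι hqT v
  exact (congrArg (fun u : EY => Λ q u _) e2).trans
    (congrArg (Λ q _) (bundleTransition_apply F E hqy hq w).symm)

lemma holFormAt_unconjForm {x y p : X} (hx : p ∈ (trivializationAt F E x).baseSet)
    (hy : p ∈ (trivializationAt F E y).baseSet)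
    {B : ∀ p, AmbientTangent ι p →L[ℂ] EndBundle E p}
    (hB : B ∈ (holomorphicSections (EX := EX) (EY →L[ℂ] (F →L[ℂ] F))
      (fun p => AmbientTangent ι p →L[ℂ] EndBundle E p)).germs p) :
    HolFormAt ι (unconjForm ι F E x y B) p := by
  have hB' := ((contMDiffAt_hom_bundle _).1 hB).2
  have hp := FiberBundle.mem_baseSet_trivializationAt F E p
  have k1 := (contMDiffAt_bundleTransition (EX := EX) F E hx hp).clm_postcomp (F₁ := F)
  have k2 := (contMDiffAt_bundleTransition (EX := EX) F E hp hy).clm_precomp (F₃ := F)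
  refine (k2.clm_comp (k1.clm_comp hB')).congr_of_eventuallyEq ?_
  filter_upwards [(trivializationAt F E p).open_baseSet.mem_nhds hp,
    (trivializationAt F E x).open_baseSet.mem_nhds hx,
    (trivializationAt F E y).open_baseSet.mem_nhds hy,
    eventually_mem_tangent_baseSet ι p] with q hq hqx hqy hqT
  refine ContinuousLinearMap.ext fun v : EY => ContinuousLinearMap.ext fun w : F => ?_
  have e2 := pullback_symmL (F := EY) (V := (TangentSpace 𝓘(ℂ, EY) : Y → Type _)) ι hqT v
  symm
  refine (bundleTransition_apply F E hqx hq _).trans ?_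
  have e3 := congrArg (fun L : F →L[ℂ] F => L (bundleTransition F E p y q w))
    (endBundle_continuousLinearMapAt F E hq
      (B q ((trivializationAt EY (ι *ᵖ (TangentSpace 𝓘(ℂ, EY) : Y → Type _)) p).symmL ℂ q v)))
  refine (congrArg (fun u => (trivializationAt F E x).continuousLinearMapAt ℂ q
    ((trivializationAt F E p).symmL ℂ q u)) e3).trans ?_
  refine congrArg ((trivializationAt F E x).continuousLinearMapAt ℂ q)
    (((trivializationAt F E p).symmL_continuousLinearMapAt hq _).trans ?_)
  refine (congrArg (fun u => B q u _) e2).trans (congrArg (B q _) ?_)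
  rw [bundleTransition_apply F E hq hqy]
  exact (trivializationAt F E p).symmL_continuousLinearMapAt hq _

end ThickCocycle

/-! ### Lifted transition matrices correspond to lifts of the Atiyah cocycle. -/

section CocycleJets

variable {EX : Type*} [NormedAddCommGroup EX] [NormedSpace ℂ EX]
  {EY : Type*} [NormedAddCommGroup EY] [NormedSpace ℂ EY]
  {X Y : Type u} [TopologicalSpace X] [ChartedSpace EX X] [IsManifold 𝓘(ℂ, EX) ω X]
  [TopologicalSpace Y] [ChartedSpace EY Y] [IsManifold 𝓘(ℂ, EY) ω Y]
  (ι : C^ω⟮𝓘(ℂ, EX), X; 𝓘(ℂ, EY), Y⟯)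
  (F : Type*) [NormedAddCommGroup F] [NormedSpace ℂ F] [FiniteDimensional ℂ F]
  (E : X → Type*) [TopologicalSpace (TotalSpace F E)] [∀ x, AddCommGroup (E x)]
  [∀ x, Module ℂ (E x)] [∀ x, TopologicalSpace (E x)] [FiberBundle F E] [VectorBundle ℂ F E]

/-- Transition matrices over `𝒪_{X₁}` lifting the transition functions of `E`. -/
structure IsThickCocycle (U : ∀ x : X, OpenNhdsOf x)
    (g : X → X → ∀ p, Matrix (Fin (Module.finrank ℂ F)) (Fin (Module.finrank ℂ F))
      (ThickStalk ι p)) : Prop where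
  subset : ∀ x, (U x : Set X) ⊆ (trivializationAt F E x).baseSet
  thickAt : ∀ x y, ∀ p ∈ (U x : Set X) ∩ U y, ∀ i j, ThickAt ι (fun q => g x y q i j) p
  mul : ∀ x y z, ∀ p ∈ (U x : Set X) ∩ U y ∩ U z, g x y p * g y z p = g x z p
  self : ∀ x, ∀ p ∈ (U x : Set X), g x x p = 1
  value : ∀ x y, ∀ p ∈ (U x : Set X) ∩ U y, ∀ i j,
    thickValue ι p (g x y p i j) = entryCLM F i j (bundleTransition F E x y p)

variable [∀ x, IsTopologicalAddGroup (E x)] [∀ x, ContinuousSMul ℂ (E x)]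
  [ContMDiffVectorBundle ω F E 𝓘(ℂ, EX)]

omit [IsManifold 𝓘(ℂ, EX) ω X] [IsManifold 𝓘(ℂ, EY) ω Y] [FiniteDimensional ℂ F]
  [ContMDiffVectorBundle ω F E 𝓘(ℂ, EX)] in
lemma conjForm_apply (x y p : X) (Λ : X → EY →L[ℂ] (F →L[ℂ] F)) (v : EY) (w : E p) :
    conjForm ι F E x y Λ p v w = (trivializationAt F E x).symmL ℂ p
      (Λ p v ((trivializationAt F E y).continuousLinearMapAt ℂ p w)) := rfl

omit [IsManifold 𝓘(ℂ, EX) ω X] [IsManifold 𝓘(ℂ, EY) ω Y] [FiniteDimensional ℂ F]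
  [ContMDiffVectorBundle ω F E 𝓘(ℂ, EX)] in
lemma unconjForm_apply (x y p : X) (B : ∀ p, AmbientTangent ι p →L[ℂ] EndBundle E p) (v : EY)
    (w : F) : unconjForm ι F E x y B p v w = (trivializationAt F E x).continuousLinearMapAt ℂ p
      (B p v ((trivializationAt F E y).symmL ℂ p w)) := rfl

lemma mfderiv_entry_bundleTransition {x y p : X} (hx : p ∈ (trivializationAt F E x).baseSet)
    (hy : p ∈ (trivializationAt F E y).baseSet) (i j : Fin (Module.finrank ℂ F)) (v : EX) :
    (mfderiv 𝓘(ℂ, EX) 𝓘(ℂ) (fun q => entryCLM F i j (bundleTransition F E x y q)) p : EX →L[ℂ] ℂ) v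
      = entryCLM F i j (transitionDeriv F E x y p v) := by
  have h1 := ((contMDiffAt_bundleTransition (EX := EX) F E hx hy).mdifferentiableAt
    (by simp)).hasMFDerivAt
  have h2 := HasMFDerivAt.comp (I' := 𝓘(ℂ, F →L[ℂ] F)) p
    ((entryCLM F i j).hasFDerivAt (x := bundleTransition F E x y p)).hasMFDerivAt h1
  exact congrArg (fun L : EX →L[ℂ] ℂ => L v) h2.mfderiv

/-- The lift is `e_x⁻¹ ∘ Λ_xy ∘ e_y`, where `Λ_xy` consists of the differentials along `X` of the
matrix entries. -/
theorem IsThickCocycle.exists_atiyahLift {U : ∀ x : X, OpenNhdsOf x}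
    {g : X → X → ∀ p, Matrix (Fin (Module.finrank ℂ F)) (Fin (Module.finrank ℂ F)) (ThickStalk ι p)}
    (hg : IsThickCocycle ι F E U g) : ∃ B, IsAtiyahLift ι F E U B := by
  let Λ : X → X → X → EY →L[ℂ] (F →L[ℂ] F) := fun x y p =>
    endFormOfEntries fun i j => thickDeriv ι p (g x y p i j)
  have hΛe : ∀ x y p v i j, entryCLM F i j (Λ x y p v) = thickDeriv ι p (g x y p i j) v :=
    fun x y p v i j => entryCLM_endFormOfEntries _ v i j
  refine ⟨fun x y => conjForm ι F E x y (Λ x y), hg.subset, ?_, ?_, ?_⟩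
  · intro x y p hp
    refine conjForm_mem_germs ι F E (hg.subset x hp.1) (hg.subset y hp.2) ?_
    exact HolFormAt.sum fun k _ => HolFormAt.sum fun l _ =>
      HolFormAt.clm_comp contMDiffAt_const (hg.thickAt x y p hp k l).holFormAt
  · intro x y z p hp
    have hx := hg.subset x hp.1.1
    have hy := hg.subset y hp.1.2
    have hz := hg.subset z hp.2
    -- The Leibniz rule for `g_xy g_yz = g_xz` in `𝒪_{X₁}`; conjugation by the frames removes the
    -- twist.
    have h1 : ∀ v, Λ x z p v = (bundleTransition F E x y p).comp (Λ y z p v) +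
        (Λ x y p v).comp (bundleTransition F E y z p) := by
      intro v
      refine ext_entryCLM fun i j => ?_
      rw [hΛe, ← hg.mul x y z p hp, Matrix.mul_apply, thickDeriv_sum, map_add, entryCLM_comp,
        entryCLM_comp, ← Finset.sum_add_distrib, sum_apply]
      refine Finset.sum_congr rfl fun k _ => ?_
      rw [thickDeriv_mul, hg.value x y p hp.1, hg.value y z p ⟨hp.1.2, hp.2⟩, hΛe, hΛe]
      simp only [add_apply, smul_apply, smul_eq_mul]
      ring
    refine ContinuousLinearMap.ext fun v : EY => ContinuousLinearMap.ext fun w : E p => ?_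
    change conjForm ι F E x z (Λ x z) p v w =
      conjForm ι F E x y (Λ x y) p v w + conjForm ι F E y z (Λ y z) p v w
    simp only [conjForm_apply, h1, add_apply, ContinuousLinearMap.comp_apply, map_add]
    rw [bundleTransition_apply F E hx hy, bundleTransition_apply F E hy hz,
      Trivialization.symmL_continuousLinearMapAt _ hx,
      Trivialization.symmL_continuousLinearMapAt _ hz, add_comm]
  · intro x y p hp v
    have hx := hg.subset x hp.1
    have hy := hg.subset y hp.2
    -- On `T_X` the differential of an entry depends only on its value along `X`, which is an entry
    -- of the transition function.
    have h1 : Λ x y p (tangentInclusion ι p v) = transitionDeriv F E x y p v := by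
      refine ext_entryCLM fun i j => ?_
      refine Eq.trans ?_ (mfderiv_entry_bundleTransition (EX := EX) F E hx hy i j v)
      refine (hΛe x y p _ i j).trans (((hg.thickAt x y p hp i j).deriv_tangentInclusion v).trans ?_)
      have h2 : (fun q => thickValue ι q (g x y q i j)) =ᶠ[𝓝 p]
          fun q => entryCLM F i j (bundleTransition F E x y q) := by
        filter_upwards [((U x).is_open'.inter (U y).is_open').mem_nhds hp] with q hq
        exact hg.value x y q hq i j
      exact congrArg (fun L : EX →L[ℂ] ℂ => L v) h2.mfderiv_eq
    refine ContinuousLinearMap.ext fun w : E p => ?_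
    exact congrArg (fun L : F →L[ℂ] F => (trivializationAt F E x).symmL ℂ p
      (L ((trivializationAt F E y).continuousLinearMapAt ℂ p w))) h1

/-- Each matrix entry is the section with value an entry of `g_xy` and differential the
corresponding entry of `e_x ∘ B_xy ∘ e_y⁻¹`. The cocycle identities over `𝒪_{X₁}` are then verified
on jets. -/
theorem IsAtiyahLift.exists_thickCocycle [FiniteDimensional ℂ EY]
    (hι : Manifold.IsSmoothEmbedding 𝓘(ℂ, EX) 𝓘(ℂ, EY) ω ι) {U : ∀ x : X, OpenNhdsOf x}
    {B : X → X → ∀ p, AmbientTangent ι p →L[ℂ] EndBundle E p}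
    (hB : IsAtiyahLift ι F E U B) : ∃ g, IsThickCocycle ι F E U g := by
  let Λ : X → X → X → EY →L[ℂ] (F →L[ℂ] F) := fun x y => unconjForm ι F E x y (B x y)
  have hex : ∀ x y i j, ∃ s : ∀ p : X, ThickStalk ι p, ∀ p ∈ (U x : Set X) ∩ U y,
      ThickAt ι s p ∧ thickValue ι p (s p) = entryCLM F i j (bundleTransition F E x y p) ∧
      thickDeriv ι p (s p) = (entryCLM F i j).comp (Λ x y p) := by
    intro x y i j
    -- The compatibility of value and differential is the condition that `B` restricts to the Atiyah
    -- cocycle.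
    refine exists_thick_of_jet_on ι hι
      (f := fun p => entryCLM F i j (bundleTransition F E x y p))
      (l := fun p => (entryCLM F i j).comp (Λ x y p)) ((U x).is_open'.inter (U y).is_open') ?_ ?_ ?_
    · intro p hp
      exact ContMDiffAt.comp (I' := 𝓘(ℂ, F →L[ℂ] F)) p (entryCLM F i j).contMDiff.contMDiffAt
        (contMDiffAt_bundleTransition F E (hB.subset x hp.1) (hB.subset y hp.2))
    · intro p hp
      exact HolFormAt.clm_comp contMDiffAt_const (holFormAt_unconjForm ι F E (hB.subset x hp.1)
        (hB.subset y hp.2) (hB.isSection x y p hp))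
    · intro p hp v
      have hx := hB.subset x hp.1
      have hy := hB.subset y hp.2
      refine Eq.trans ?_ (mfderiv_entry_bundleTransition (EX := EX) F E hx hy i j v).symm
      refine congrArg (entryCLM F i j) (ContinuousLinearMap.ext fun w : F => ?_)
      refine (congrArg (fun L : EndBundle E p => (trivializationAt F E x).continuousLinearMapAt ℂ p
        (L ((trivializationAt F E y).symmL ℂ p w))) (hB.lift x y p hp v)).trans ?_
      rw [atiyahCochain_apply, Trivialization.continuousLinearMapAt_symmL _ hx,
        Trivialization.continuousLinearMapAt_symmL _ hy]
  choose s hs using hex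
  have hadd : ∀ x y z, ∀ p ∈ (U x : Set X) ∩ U y ∩ U z, ∀ v,
      Λ x z p v = (bundleTransition F E x y p).comp (Λ y z p v) +
        (Λ x y p v).comp (bundleTransition F E y z p) := by
    intro x y z p hp v
    have hx := hB.subset x hp.1.1
    have hy := hB.subset y hp.1.2
    have hz := hB.subset z hp.2
    refine ContinuousLinearMap.ext fun w : F => ?_
    let u : E p := (trivializationAt F E z).symmL ℂ p w
    let v' : AmbientTangent ι p := v
    have h1 : B x z p v' = B x y p v' + B y z p v' := congrArg (fun L => L v') (hB.cocycle x y z p hp)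
    have h2 : B x z p v' u = B x y p v' u + B y z p v' u := congrArg (fun L => L u) h1
    refine (congrArg ((trivializationAt F E x).continuousLinearMapAt ℂ p) h2).trans ?_
    rw [map_add]
    change _ = bundleTransition F E x y p (unconjForm ι F E y z (B y z) p v w) +
      unconjForm ι F E x y (B x y) p v (bundleTransition F E y z p w)
    rw [unconjForm_apply, unconjForm_apply, bundleTransition_apply F E hx hy,
      bundleTransition_apply F E hy hz, Trivialization.symmL_continuousLinearMapAt _ hy,
      Trivialization.symmL_continuousLinearMapAt _ hy, add_comm]
  have huniq : ∀ (O : Set X), IsOpen O → ∀ s t : ∀ p : X, ThickStalk ι p,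
      (∀ p ∈ O, ThickAt ι s p ∧ ThickAt ι t p ∧ thickValue ι p (s p) = thickValue ι p (t p) ∧
        thickDeriv ι p (s p) = thickDeriv ι p (t p)) → ∀ p ∈ O, s p = t p := by
    intro O hO s t h p hp
    refine sub_eq_zero.1 (ThickAt.eq_zero (s := fun q => s q - t q) hι
      ((h p hp).1.sub (h p hp).2.1) ?_ ?_)
    · filter_upwards [hO.mem_nhds hp] with q hq
      rw [map_sub, (h q hq).2.2.1, sub_self]
    · filter_upwards [hO.mem_nhds hp] with q hq
      rw [thickDeriv_sub, (h q hq).2.2.2, sub_self]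
  refine ⟨fun x y p => Matrix.of fun i j => s x y i j p, hB.subset,
    fun x y p hp i j => (hs x y i j p hp).1, ?_, ?_, fun x y p hp i j => (hs x y i j p hp).2.1⟩
  · intro x y z p hp
    ext i j
    rw [Matrix.mul_apply]
    refine huniq _ (((U x).is_open'.inter (U y).is_open').inter (U z).is_open')
      (fun q => ∑ k, s x y i k q * s y z k j q) (fun q => s x z i j q) (fun q hq => ?_) p hp
    have hxy := fun i j => hs x y i j q hq.1
    have hyz := fun i j => hs y z i j q ⟨hq.1.2, hq.2⟩
    have hxz := fun i j => hs x z i j q ⟨hq.1.1, hq.2⟩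
    refine ⟨ThickAt.sum fun k _ => (hxy i k).1.mul (hyz k j).1, (hxz i j).1, ?_, ?_⟩
    · rw [(hxz i j).2.1, bundleTransition_comp F E (hB.subset x hq.1.1) (hB.subset y hq.1.2)
        (hB.subset z hq.2), entryCLM_comp, map_sum]
      exact Finset.sum_congr rfl fun k _ => by rw [map_mul, (hxy i k).2.1, (hyz k j).2.1]
    · refine ContinuousLinearMap.ext fun v : EY => ?_
      rw [(hxz i j).2.2, thickDeriv_sum, sum_apply, ContinuousLinearMap.comp_apply,
        hadd x y z q hq, map_add, entryCLM_comp, entryCLM_comp, ← Finset.sum_add_distrib]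
      refine Finset.sum_congr rfl fun k _ => ?_
      rw [thickDeriv_mul, (hxy i k).2.1, (hxy i k).2.2, (hyz k j).2.1, (hyz k j).2.2]
      simp only [add_apply, smul_apply, smul_eq_mul, ContinuousLinearMap.comp_apply]
      ring
  · intro x p hp
    ext i j
    refine huniq _ (U x).is_open' (fun q => s x x i j q)
      (fun q => (1 : Matrix _ _ (ThickStalk ι q)) i j) (fun q hq => ?_) p hp
    have hxx := hs x x i j q ⟨hq, hq⟩
    have h1 : bundleTransition F E x x q = ContinuousLinearMap.id ℂ F := by
      refine ContinuousLinearMap.ext fun w => ?_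
      rw [bundleTransition_apply F E (hB.subset x hq) (hB.subset x hq),
        Trivialization.continuousLinearMapAt_symmL _ (hB.subset x hq)]
      rfl
    have h2 : ∀ v, Λ x x q v = 0 := by
      intro v
      -- As `g_xx` is the identity, the cocycle rule reads `Λ_xx = Λ_xx + Λ_xx`.
      have h3 := hadd x x x q ⟨⟨hq, hq⟩, hq⟩ v
      rw [h1, ContinuousLinearMap.id_comp, ContinuousLinearMap.comp_id] at h3
      exact left_eq_add.1 h3
    have h4 : thickDeriv ι q (s x x i j q) = 0 := by
      rw [hxx.2.2]
      refine ContinuousLinearMap.ext fun v : EY => ?_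
      rw [ContinuousLinearMap.comp_apply, h2, map_zero]
      rfl
    refine ⟨hxx.1, ?_, ?_, ?_⟩
    · by_cases hij : i = j
      · subst hij
        simpa using thickAt_one ι q
      · simpa [Matrix.one_apply_ne hij] using thickAt_zero ι q
    · rw [hxx.2.1, h1, entryCLM_id]
      by_cases hij : i = j
      · subst hij
        simp
      · simp [Matrix.one_apply_ne hij]
    · rw [h4]
      by_cases hij : i = j
      · subst hij
        rw [Matrix.one_apply_eq, thickDeriv_one]
      · rw [Matrix.one_apply_ne hij, thickDeriv_zero]

end CocycleJets

/-! ### Extension by zero of families defined on open sets. -/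

section ExtendZero

variable {X : Type u} [TopologicalSpace X]

open Classical in
/-- Extension by zero of a family defined on an open set. -/
noncomputable def extendZero {V : X → Type*} [∀ x, Zero (V x)] {U : Opens X} (s : ∀ x : U, V x)
    (x : X) : V x :=
  if h : x ∈ U then s ⟨x, h⟩ else 0

lemma extendZero_apply {V : X → Type*} [∀ x, Zero (V x)] {U : Opens X} (s : ∀ x : U, V x) {x : X}
    (h : x ∈ U) : extendZero s x = s ⟨x, h⟩ := dif_pos h

lemma extendZero_restrict {V : X → Type*} [∀ x, Zero (V x)] {U W : Opens X} (h : W ≤ U)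
    (s : ∀ x : U, V x) {x : X} (hx : x ∈ W) :
    extendZero (fun y : W => s (Opens.inclusion h y)) x = extendZero s x := by
  rw [extendZero_apply _ hx, extendZero_apply _ (h hx)]

lemma eventually_mem_opens {U : Opens X} {x : X} (h : x ∈ U) : ∀ᶠ p in 𝓝 x, p ∈ U :=
  U.isOpen.mem_nhds h

lemma eventually_subtype_iff {U : Opens X} (x : U) (P : X → Prop) :
    (∀ᶠ p : U in 𝓝 x, P p) ↔ ∀ᶠ p in 𝓝 (x : X), P p := by
  rw [← U.isOpen.isOpenEmbedding_subtypeVal.map_nhds_eq x, Filter.eventually_map]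
  rfl

end ExtendZero

open Matrix in
lemma mulVec_mul_left_apply {R : Type*} [CommRing R] {n : ℕ} (A : Matrix (Fin n) (Fin n) R) (c : R)
    (v : Fin n → R) (i : Fin n) : (A *ᵥ fun k => c * v k) i = c * (A *ᵥ v) i :=
  congrFun (mulVec_smul A c v) i

/-! ### The sheaf of modules glued from free modules by transition matrices. -/

section GluedSheaf

variable {EX : Type*} [NormedAddCommGroup EX] [NormedSpace ℂ EX]
  {EY : Type*} [NormedAddCommGroup EY] [NormedSpace ℂ EY]
  {X Y : Type u} [TopologicalSpace X] [ChartedSpace EX X]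
  [TopologicalSpace Y] [ChartedSpace EY Y]
  (ι : C^ω⟮𝓘(ℂ, EX), X; 𝓘(ℂ, EY), Y⟯)

/-- Near a point of `U` the extension by zero is the family itself, so the stalkwise calculus of
`ThickAt` applies to sections over `U`. -/
lemma mem_thickSections_iff {U : Opens X} (s : ∀ x : U, ThickStalk ι (x : X)) :
    s ∈ thickSections ι U ↔ ∀ x ∈ U, ThickAt ι (extendZero s) x := by
  have key : ∀ (x : U) (f : Y → ℂ), (∀ᶠ x' : U in 𝓝 x,
      ∃ hf : ContMDiffAt 𝓘(ℂ, EY) 𝓘(ℂ) ω f (ι x'), s x' = thickGerm ι x' f hf) ↔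
      ∀ᶠ p in 𝓝 (x : X), ∃ hf : ContMDiffAt 𝓘(ℂ, EY) 𝓘(ℂ) ω f (ι p),
        extendZero s p = thickGerm ι p f hf := by
    intro x f
    rw [← eventually_subtype_iff x]
    refine Filter.eventually_congr (.of_forall fun p => ?_)
    rw [extendZero_apply s p.2]
  constructor
  · intro h x hx
    obtain ⟨f, hf⟩ := h ⟨x, hx⟩
    exact ⟨f, (key ⟨x, hx⟩ f).1 hf⟩
  · intro h x
    obtain ⟨f, hf⟩ := h x x.2
    exact ⟨f, (key x f).2 hf⟩

open Matrix

variable {n : ℕ} (g : X → X → ∀ p : X, Matrix (Fin n) (Fin n) (ThickStalk ι p))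

noncomputable instance (p : X) : CommRing (ThickStalk ι p) := inferInstance

/-- A family of vectors is an admissible section at `x` of the module glued from free modules by
`g`.  The value at `p` is expressed in the frame with index `p`. -/
def GluedAt (s : ∀ p : X, Fin n → ThickStalk ι p) (x : X) : Prop :=
  ∀ i, ThickAt ι (fun p => (g x p p *ᵥ s p) i) x

variable {ι g} in
lemma GluedAt.congr {s t : ∀ p : X, Fin n → ThickStalk ι p} {x : X} (hs : GluedAt ι g s x)
    (h : ∀ᶠ p in 𝓝 x, s p = t p) : GluedAt ι g t x := fun i => (hs i).congr (by
  filter_upwards [h] with p hp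
  rw [hp])

/-- Families of vectors of length `n` with entries in the stalks of `𝒪_{X₁}`. -/
def ThickVec (U : Opens X) (n : ℕ) : Type u := ∀ p : U, Fin n → ThickStalk ι (p : X)

noncomputable instance (U : Opens X) (n : ℕ) : AddCommGroup (ThickVec ι U n) :=
  inferInstanceAs (AddCommGroup (∀ p : U, Fin n → ThickStalk ι (p : X)))

noncomputable instance (U : Opens X) (n : ℕ) : Module (thickSections ι U) (ThickVec ι U n) where
  smul a s := fun p i => a.1 p * s p i
  one_smul s := funext fun p => funext fun i => one_mul (s p i)
  mul_smul a b s := funext fun p => funext fun i => mul_assoc (a.1 p) (b.1 p) (s p i)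
  smul_zero a := funext fun p => funext fun _ => mul_zero (a.1 p)
  smul_add a s t := funext fun p => funext fun i => mul_add (a.1 p) (s p i) (t p i)
  add_smul a b s := funext fun p => funext fun i => add_mul (a.1 p) (b.1 p) (s p i)
  zero_smul s := funext fun p => funext fun i => zero_mul (s p i)

lemma extendZero_thickVec_apply {U : Opens X} (s : ThickVec ι U n) {p : X} (hp : p ∈ U) :
    extendZero (V := fun p => Fin n → ThickStalk ι p) s p = s ⟨p, hp⟩ := extendZero_apply _ hp

/-- The sections over `U` of the glued module. -/
noncomputable def gluedSections (U : Opens X) : Submodule (thickSections ι U) (ThickVec ι U n) where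
  carrier := {s | ∀ x ∈ U, GluedAt ι g (extendZero (V := fun p => Fin n → ThickStalk ι p) s) x}
  zero_mem' := fun x hx _ => (thickAt_zero ι x).congr (by
    filter_upwards [eventually_mem_opens hx] with p hp
    rw [extendZero_thickVec_apply ι _ hp]
    exact (congrFun (mulVec_zero (g x p p)) _).symm)
  add_mem' := fun {s t} hs ht x hx i => ((hs x hx i).add (ht x hx i)).congr (by
    filter_upwards [eventually_mem_opens hx] with p hp
    simp only [extendZero_thickVec_apply ι _ hp]
    exact (congrFun (mulVec_add (g x p p) (s ⟨p, hp⟩) (t ⟨p, hp⟩)) i).symm)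
  smul_mem' := fun a s hs x hx i =>
    (((mem_thickSections_iff ι a.1).1 a.2 x hx).mul (hs x hx i)).congr (by
      filter_upwards [eventually_mem_opens hx] with p hp
      simp only [extendZero_thickVec_apply ι _ hp]
      rw [extendZero_apply _ hp]
      exact (mulVec_mul_left_apply (g x p p) (a.1 ⟨p, hp⟩) (s ⟨p, hp⟩) i).symm)

lemma gluedSections_res {U W : Opens X} (h : W ≤ U) {s : ThickVec ι U n}
    (hs : s ∈ gluedSections ι g U) :
    (fun p : W => s (Opens.inclusion h p) : ThickVec ι W n) ∈ gluedSections ι g W := fun x hx =>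
  (hs x (h hx)).congr (by
    filter_upwards [eventually_mem_opens hx] with p hp
    exact (extendZero_restrict (V := fun p => Fin n → ThickStalk ι p) h s hp).symm)

/-- Membership in `gluedSections` is a local condition. -/
def gluedLocalPredicate : TopCat.LocalPredicate
    (fun x : TopCat.of X => Fin n → ThickStalk ι (x : X)) where
  pred {U} s := s ∈ gluedSections ι g U
  res i s hs := gluedSections_res ι g (leOfHom i) hs
  locality := by
    intro U s hs x hx
    obtain ⟨W, hxW, i, hW⟩ := hs ⟨x, hx⟩
    refine (hW x hxW).congr ?_
    filter_upwards [eventually_mem_opens hxW] with p hp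
    exact extendZero_restrict (V := fun p => Fin n → ThickStalk ι p) (leOfHom i) s hp

/-- The module of sections over `U` of the glued module. -/
def GluedModule (U : Opens X) : Type u := gluedSections ι g U

namespace GluedModule

noncomputable instance (U : Opens X) : AddCommGroup (GluedModule ι g U) :=
  inferInstanceAs (AddCommGroup (gluedSections ι g U))

noncomputable instance instModule (U : Opens X) : Module (thickSections ι U) (GluedModule ι g U) :=
  Submodule.module (gluedSections ι g U)

noncomputable instance (U : Opens X) : SMul (thickSections ι U) (GluedModule ι g U) :=
  (instModule ι g U).toSMul

variable {ι g}

/-- The entries of a section at a point. -/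
noncomputable def eval {U : Opens X} (p : U) : GluedModule ι g U →+ (Fin n → ThickStalk ι (p : X)) where
  toFun s := s.1 p
  map_zero' := rfl
  map_add' _ _ := rfl

/-- A section as a total function. -/
noncomputable def extend {U : Opens X} (s : GluedModule ι g U) (p : X) : Fin n → ThickStalk ι p :=
  extendZero (V := fun p => Fin n → ThickStalk ι p) s.1 p

lemma extend_apply {U : Opens X} (s : GluedModule ι g U) (p : U) : s.extend p = eval p s :=
  extendZero_thickVec_apply ι s.1 p.2

lemma gluedAt {U : Opens X} (s : GluedModule ι g U) {x : X} (hx : x ∈ U) : GluedAt ι g s.extend x :=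
  s.2 x hx

lemma ext {U : Opens X} {s t : GluedModule ι g U} (h : ∀ p, eval p s = eval p t) : s = t :=
  Subtype.ext (funext h)

variable (ι) in
/-- The section given by a family of vectors. -/
noncomputable def mk {U : Opens X} (s : ∀ p : X, Fin n → ThickStalk ι p)
    (hs : ∀ x ∈ U, GluedAt ι g s x) : GluedModule ι g U :=
  ⟨fun p => s p, fun x hx => (hs x hx).congr (by
    filter_upwards [eventually_mem_opens hx] with p hp
    exact (extendZero_thickVec_apply ι (fun p : U => s p) hp).symm)⟩

/-- The restriction maps of the glued module. -/
noncomputable def res {U W : Opens X} (h : W ≤ U) : GluedModule ι g U →+ GluedModule ι g W where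
  toFun s := ⟨fun p => s.1 (Opens.inclusion h p), gluedSections_res ι g h s.2⟩
  map_zero' := rfl
  map_add' _ _ := rfl

lemma eval_sum_smul {W : Opens X} (a : Fin n → thickSections ι W)
    (e : Fin n → GluedModule ι g W) (p : W) (k : Fin n) :
    eval p (∑ i, a i • e i) k = ∑ i, (a i).1 p * eval p (e i) k := by
  rw [map_sum, Finset.sum_apply]
  rfl

end GluedModule

noncomputable instance (U : (Opens (TopCat.of X))ᵒᵖ) :
    Module ((thickSheaf ι).obj.obj U) (GluedModule ι g U.unop) :=
  GluedModule.instModule ι g U.unop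

/-- The presheaf of modules of sections of the glued module. -/
noncomputable def gluedPresheaf : PresheafOfModules.{u} (thickSheaf ι).obj where
  obj U := ModuleCat.of ((thickSheaf ι).obj.obj U) (GluedModule ι g U.unop)
  map {U W} i := ModuleCat.ofHom
    (X := ModuleCat.of ((thickSheaf ι).obj.obj U) (GluedModule ι g U.unop))
    (Y := (ModuleCat.restrictScalars ((thickSheaf ι).obj.map i).hom).obj
      (ModuleCat.of ((thickSheaf ι).obj.obj W) (GluedModule ι g W.unop)))
    { toFun := GluedModule.res (leOfHom i.unop)
      map_add' := fun _ _ => rfl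
      map_smul' := fun _ _ => rfl }
  map_id _ := rfl
  map_comp _ _ := rfl

/-- The sheaf of modules glued from free modules by `g`. -/
noncomputable def gluedSheaf : SheafOfModules.{u} (thickSheaf ι) where
  val := gluedPresheaf ι g
  isSheaf := by
    -- The sheaf condition concerns only the underlying sets, and there it is the locality of
    -- membership.
    rw [CategoryTheory.Presheaf.isSheaf_iff_isSheaf_forget _ _ (CategoryTheory.forget Ab)]
    exact (TopCat.subsheafToTypes (gluedLocalPredicate ι g)).property

end GluedSheaf

/-! ### The glued sheaf is locally free and restricts to `E`. -/

section GluedBundle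

open Matrix

variable {EX : Type*} [NormedAddCommGroup EX] [NormedSpace ℂ EX]
  {EY : Type*} [NormedAddCommGroup EY] [NormedSpace ℂ EY]
  {X Y : Type u} [TopologicalSpace X] [ChartedSpace EX X]
  [TopologicalSpace Y] [ChartedSpace EY Y]
  (ι : C^ω⟮𝓘(ℂ, EX), X; 𝓘(ℂ, EY), Y⟯)

/-- Pulling `f` back along a local holomorphic retraction of `Y` onto `X` gives a representative, so
`𝒪_{X₁} → 𝒪_X` is locally surjective. -/
lemma exists_thickAt_of_value [IsManifold 𝓘(ℂ, EX) ω X] [IsManifold 𝓘(ℂ, EY) ω Y]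
    (hι : Manifold.IsSmoothEmbedding 𝓘(ℂ, EX) 𝓘(ℂ, EY) ω ι) {f : X → ℂ} {x : X}
    (hf : ContMDiffAt 𝓘(ℂ, EX) 𝓘(ℂ) ω f x) :
    ∃ s, ThickAt ι s x ∧ ∀ᶠ p in 𝓝 x, thickValue ι p (s p) = f p := by
  obtain ⟨ψ, ψ', P, r, -, hψ, -, -, -, -, hr, hrψ⟩ := exists_slice_chart ι hι x
  have hrx := hrψ.self_of_nhds
  have hf' : ContMDiffAt 𝓘(ℂ, EX) 𝓘(ℂ) ω f ((r ∘ ψ) (ι x)) := by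
    rw [Function.comp_apply, hrx]
    exact hf
  obtain ⟨s, hs, hs'⟩ := exists_thickAt_of_contMDiffAt ι
    (ContMDiffAt.comp (ι x) hf' (ContMDiffAt.comp (ι x) hr hψ))
  refine ⟨s, hs, ?_⟩
  filter_upwards [hs', hrψ] with p hp hp'
  rw [hp.1, Function.comp_apply, Function.comp_apply, hp']

lemma restrict_mem_thickSections {W : Opens X} {s : ∀ p : X, ThickStalk ι p}
    (h : ∀ x ∈ W, ThickAt ι s x) : (fun p : W => s p) ∈ thickSections ι W :=
  (mem_thickSections_iff ι _).2 fun x hx => (h x hx).congr (by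
    filter_upwards [eventually_mem_opens hx] with p hp
    rw [extendZero_apply _ hp])

variable (F : Type*) [NormedAddCommGroup F] [NormedSpace ℂ F] [FiniteDimensional ℂ F]

/-- The vector of `F` whose coordinates are the values of the given stalk elements. -/
noncomputable def valueVec (p : X) : (Fin (Module.finrank ℂ F) → ThickStalk ι p) →+ F where
  toFun a := ∑ i, thickValue ι p (a i) • Module.finBasis ℂ F i
  map_zero' := by simp
  map_add' a b := by simp [add_smul, Finset.sum_add_distrib]

variable {F}

lemma coordCLM_valueVec {p : X} (a : Fin (Module.finrank ℂ F) → ThickStalk ι p)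
    (i : Fin (Module.finrank ℂ F)) : coordCLM F i (valueVec ι F p a) = thickValue ι p (a i) := by
  change coordCLM F i (∑ i, thickValue ι p (a i) • Module.finBasis ℂ F i) = _
  simp [coordCLM_basis]

lemma ext_coordCLM {v w : F} (h : ∀ i, coordCLM F i v = coordCLM F i w) : v = w := by
  rw [← sum_coordCLM_smul v, ← sum_coordCLM_smul w]
  exact Finset.sum_congr rfl fun i _ => by rw [h]

lemma valueVec_mul_left {p : X} (c : ThickStalk ι p)
    (a : Fin (Module.finrank ℂ F) → ThickStalk ι p) :
    valueVec ι F p (fun i => c * a i) = thickValue ι p c • valueVec ι F p a :=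
  ext_coordCLM fun i => by simp only [coordCLM_valueVec, map_smul, map_mul, smul_eq_mul]

variable (F) (E : X → Type*) [TopologicalSpace (TotalSpace F E)] [∀ x, AddCommGroup (E x)]
  [∀ x, Module ℂ (E x)] [∀ x, TopologicalSpace (E x)] [FiberBundle F E] [VectorBundle ℂ F E]

namespace IsThickCocycle

variable {ι F E}
  {U : ∀ x : X, OpenNhdsOf x}
  {g : X → X → ∀ p, Matrix (Fin (Module.finrank ℂ F)) (Fin (Module.finrank ℂ F)) (ThickStalk ι p)}
  (hg : IsThickCocycle ι F E U g)

include hg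

lemma mul_self {x p : X} (hp : p ∈ U x) : g p x p * g x p p = 1 := by
  rw [hg.mul p x p p ⟨⟨(U p).mem, hp⟩, (U p).mem⟩, hg.self p p (U p).mem]

lemma self_mul {x p : X} (hp : p ∈ U x) : g x p p * g p x p = 1 := by
  rw [hg.mul x p x p ⟨⟨hp, (U p).mem⟩, hp⟩, hg.self x p hp]

lemma valueVec_mulVec {x y p : X} (hx : p ∈ U x) (hy : p ∈ U y)
    (a : Fin (Module.finrank ℂ F) → ThickStalk ι p) :
    valueVec ι F p (g x y p *ᵥ a) = bundleTransition F E x y p (valueVec ι F p a) :=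
  ext_coordCLM fun i => by
    rw [coordCLM_valueVec, coordCLM_apply_eq_sum]
    simp only [coordCLM_valueVec, ← hg.value x y p ⟨hx, hy⟩, ← map_mul, ← map_sum]
    rfl

/-- Admissibility at `q` concerns coordinates in the frame `q`; the matrix `g_xq` carries them to
the frame `x`, because `g_xq g_qp = g_xp`. -/
lemma thickAt_coeff {W : Opens X} {x : X} (hW : ∀ p ∈ W, p ∈ U x) (s : GluedModule ι g W)
    (i : Fin (Module.finrank ℂ F)) {q : X} (hq : q ∈ W) :
    ThickAt ι (fun p => (g x p p *ᵥ s.extend p) i) q := by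
  refine (ThickAt.sum (t := Finset.univ) fun k _ =>
    (hg.thickAt x q q ⟨hW q hq, (U q).mem⟩ i k).mul (s.gluedAt hq k)).congr ?_
  filter_upwards [eventually_mem_opens hq, (U q).is_open'.mem_nhds (U q).mem] with p hp hp'
  rw [← hg.mul x q p p ⟨⟨hW p hp, hp'⟩, (U p).mem⟩, ← mulVec_mulVec]
  rfl

/-- The coefficients of a section with respect to the frame with index `x`. -/
noncomputable def coeff {W : Opens X} {x : X} (hW : ∀ p ∈ W, p ∈ U x) (s : GluedModule ι g W)
    (i : Fin (Module.finrank ℂ F)) : thickSections ι W :=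
  ⟨_, restrict_mem_thickSections ι fun _ hq => hg.thickAt_coeff hW s i hq⟩

lemma coeff_apply {W : Opens X} {x : X} (hW : ∀ p ∈ W, p ∈ U x) (s : GluedModule ι g W)
    (i : Fin (Module.finrank ℂ F)) (p : W) :
    (hg.coeff hW s i).1 p = (g x p p *ᵥ GluedModule.eval p s) i := by
  rw [← s.extend_apply]
  rfl

/-- The frame with index `x`. -/
noncomputable def frame (x : X) (i : Fin (Module.finrank ℂ F)) :
    GluedModule ι g (U x).toOpens :=
  -- In the frame indexed by `p`, the `i`-th vector of the frame `x` is the `i`-th column of `g_px`.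
  .mk ι (fun p k => g p x p k i) fun q hq k => (hg.thickAt q x q ⟨(U q).mem, hq⟩ k i).congr (by
    filter_upwards [eventually_mem_opens hq, (U q).is_open'.mem_nhds (U q).mem] with p hp hp'
    rw [← hg.mul q p x p ⟨⟨hp', (U p).mem⟩, hp⟩]
    rfl)

lemma eval_sum_smul_frame {W : Opens X} {x : X} (hW : W ≤ (U x).toOpens)
    (a : Fin (Module.finrank ℂ F) → thickSections ι W) (p : W) :
    GluedModule.eval p (∑ i, a i • GluedModule.res hW (hg.frame x i)) =
      g p x p *ᵥ fun i => (a i).1 p := by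
  funext k
  rw [GluedModule.eval_sum_smul]
  exact Finset.sum_congr rfl fun i _ => mul_comm _ _

lemma eq_sum_coeff {W : Opens X} {x : X} (hW : W ≤ (U x).toOpens) (s : GluedModule ι g W) :
    s = ∑ i, hg.coeff hW s i • GluedModule.res hW (hg.frame x i) := by
  refine GluedModule.ext fun p => ?_
  rw [hg.eval_sum_smul_frame hW]
  simp only [hg.coeff_apply]
  change _ = g p x p *ᵥ (g x p p *ᵥ GluedModule.eval p s)
  rw [mulVec_mulVec, hg.mul_self (hW p.2), one_mulVec]

lemma eq_coeff {W : Opens X} {x : X} (hW : W ≤ (U x).toOpens)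
    (a : Fin (Module.finrank ℂ F) → thickSections ι W) :
    a = hg.coeff hW (∑ i, a i • GluedModule.res hW (hg.frame x i)) := by
  refine funext fun i => Subtype.ext (funext fun p => ?_)
  rw [hg.coeff_apply, hg.eval_sum_smul_frame hW, mulVec_mulVec, hg.self_mul (hW p.2), one_mulVec]

theorem isLocallyFree : IsLocallyFreeOfFiniteRank ι (gluedSheaf ι g) := fun x =>
  ⟨(U x).toOpens, (U x).mem, Module.finrank ℂ F, hg.frame x, fun _ h s =>
    ⟨_, hg.eq_sum_coeff h s, fun a ha => (hg.eq_coeff h a).trans (congrArg (hg.coeff h) ha.symm)⟩⟩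

omit hg in
variable (E) in
/-- The map from the glued module to the sections of `E`. -/
noncomputable def fiberMap {W : Opens X} (s : GluedModule ι g W) (x : W) : E (x : X) :=
  (trivializationAt F E (x : X)).symmL ℂ (x : X) (valueVec ι F x (GluedModule.eval x s))

omit hg in
lemma fiberMap_zero {W : Opens X} : fiberMap E (0 : GluedModule ι g W) = 0 :=
  funext fun _ => (congrArg _ (map_zero _)).trans (map_zero _)

omit hg in
lemma fiberMap_add {W : Opens X} (s t : GluedModule ι g W) :
    fiberMap E (s + t) = fiberMap E s + fiberMap E t :=
  funext fun _ => (congrArg _ (map_add _ _ _)).trans (map_add _ _ _)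

/-- In the single trivialization at `q` the image has as coordinates the values of `g_qp s_p`, since
the values of `g_qp` are the transition function of `E`. These coordinates are holomorphic by
admissibility at `q`. -/
lemma contMDiff_fiberMap [∀ x, IsTopologicalAddGroup (E x)] [∀ x, ContinuousSMul ℂ (E x)]
    [ContMDiffVectorBundle ω F E 𝓘(ℂ, EX)] {W : Opens X} (s : GluedModule ι g W) :
    ContMDiff 𝓘(ℂ, EX) (𝓘(ℂ, EX).prod 𝓘(ℂ, F)) ω (fun x : W => TotalSpace.mk' F (x : X)
      (fiberMap E s x)) := by
  intro q
  let t : ∀ p : X, E p := fun p => (trivializationAt F E p).symmL ℂ p (valueVec ι F p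
    (s.extend p))
  have ht : ContMDiffAt 𝓘(ℂ, EX) (𝓘(ℂ, EX).prod 𝓘(ℂ, F)) ω
      (fun x => TotalSpace.mk' F x (t x)) (q : X) := by
    rw [(trivializationAt F E (q : X)).contMDiffAt_section_iff
      (FiberBundle.mem_baseSet_trivializationAt F E (q : X))]
    have h1 : ContMDiffAt 𝓘(ℂ, EX) 𝓘(ℂ, F) ω (fun p => ∑ i, thickValue ι p
        ((g q p p *ᵥ s.extend p) i)
          • Module.finBasis ℂ F i) (q : X) :=
      contMDiffAt_finsetSum fun i _ => (ThickAt.value (s.gluedAt q.2 i)).smul contMDiffAt_const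
    refine h1.congr_of_eventuallyEq ?_
    filter_upwards [eventually_mem_opens q.2, (U q).is_open'.mem_nhds (U q).mem] with p hp hp'
    refine (congrFun (Trivialization.coe_linearMapAt_of_mem (R := ℂ) _ (hg.subset _ hp'))
      (t p)).symm.trans ?_
    exact (bundleTransition_apply F E (hg.subset _ hp') (hg.subset _ (U p).mem) _).symm.trans
      (hg.valueVec_mulVec hp' (U p).mem _).symm
  refine (contMDiffAt_subtype_iff.2 ht).congr_of_eventuallyEq (.of_forall fun p => ?_)
  change TotalSpace.mk' F (p : X) _ = TotalSpace.mk' F (p : X) (t p)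
  simp only [t, fiberMap]
  rw [s.extend_apply]

omit hg in
lemma fiberMap_smul {W : Opens X} (a : thickSections ι W) (s : GluedModule ι g W) (x : W) :
    fiberMap E (a • s) x = thickValue ι (x : X) (a.1 x) • fiberMap E s x :=
  (congrArg _ (valueVec_mul_left ι (a.1 x) (GluedModule.eval x s))).trans (map_smul _ _ _)

/-- The coordinates of `t` in the trivialization at `x` lift locally to `𝒪_{X₁}`, and the lifts
serve as coefficients for the frame `x`. -/
lemma fiberMap_locally_surjective [IsManifold 𝓘(ℂ, EX) ω X] [IsManifold 𝓘(ℂ, EY) ω Y]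
    [∀ x, IsTopologicalAddGroup (E x)] [∀ x, ContinuousSMul ℂ (E x)]
    [ContMDiffVectorBundle ω F E 𝓘(ℂ, EX)]
    (hι : Manifold.IsSmoothEmbedding 𝓘(ℂ, EX) 𝓘(ℂ, EY) ω ι) {O : Opens X} {t : ∀ x : O, E (x : X)}
    (ht : ContMDiff 𝓘(ℂ, EX) (𝓘(ℂ, EX).prod 𝓘(ℂ, F)) ω
      (fun x : O => TotalSpace.mk' F (x : X) (t x))) {x : X} (hx : x ∈ O) :
    ∃ (W : Opens X) (h : W ≤ O) (s : GluedModule ι g W), x ∈ W ∧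
      ∀ y : W, fiberMap E s y = t (Opens.inclusion h y) := by
  have ht' : ContMDiffAt 𝓘(ℂ, EX) (𝓘(ℂ, EX).prod 𝓘(ℂ, F)) ω
      (fun p => TotalSpace.mk' F p (extendZero t p)) x := by
    refine (contMDiffAt_subtype_iff (x := (⟨x, hx⟩ : O))).1
      ((ht ⟨x, hx⟩).congr_of_eventuallyEq (.of_forall fun p => ?_))
    change TotalSpace.mk' F (p : X) (extendZero t p) = _
    rw [extendZero_apply t p.2]
  rw [(trivializationAt F E x).contMDiffAt_section_iff
    (FiberBundle.mem_baseSet_trivializationAt F E x)] at ht'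
  have hex : ∀ i, ∃ s, ThickAt ι s x ∧ ∀ᶠ p in 𝓝 x, thickValue ι p (s p) =
      coordCLM F i (trivializationAt F E x ⟨p, extendZero t p⟩).2 := fun i =>
    exists_thickAt_of_value ι hι
      (ContMDiffAt.comp (I' := 𝓘(ℂ, F)) x (coordCLM F i).contMDiff.contMDiffAt ht')
  choose s hs hv using hex
  have hall : ∀ᶠ p in 𝓝 x, (∀ i, ThickAt ι (s i) p) ∧ (∀ i, thickValue ι p (s i p) =
      coordCLM F i (trivializationAt F E x ⟨p, extendZero t p⟩).2) ∧ p ∈ O ∧ p ∈ U x :=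
    (Filter.eventually_all.2 fun i => (hs i).eventually).and
      ((Filter.eventually_all.2 hv).and ((eventually_mem_opens hx).and
        ((U x).is_open'.mem_nhds (U x).mem)))
  obtain ⟨W, hW, hWo, hxW⟩ := eventually_nhds_iff.1 hall
  let W' : Opens X := ⟨W, hWo⟩
  have hWU : W' ≤ (U x).toOpens := fun p hp => (hW p hp).2.2.2
  refine ⟨W', fun p hp => (hW p hp).2.2.1, ∑ i, (⟨_, restrict_mem_thickSections ι
    fun p hp => (hW p hp).1 i⟩ : thickSections ι W') • GluedModule.res hWU (hg.frame x i), hxW,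
    fun y => ?_⟩
  have hy := hW y y.2
  change (trivializationAt F E (y : X)).symmL ℂ (y : X) (valueVec ι F y _) = _
  rw [hg.eval_sum_smul_frame hWU, hg.valueVec_mulVec (U (y : X)).mem hy.2.2.2,
    bundleTransition_apply F E (hg.subset _ (U (y : X)).mem) (hg.subset _ hy.2.2.2),
    Trivialization.symmL_continuousLinearMapAt _ (hg.subset _ (U (y : X)).mem)]
  have hvec : valueVec ι F (y : X) (fun i => s i y) =
      (trivializationAt F E x).continuousLinearMapAt ℂ (y : X) (extendZero t y) :=
    ext_coordCLM fun i => by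
      rw [coordCLM_valueVec, hy.2.1 i, Trivialization.continuousLinearMapAt_apply,
        Trivialization.coe_linearMapAt_of_mem _ (hg.subset _ hy.2.2.2)]
  refine (congrArg _ hvec).trans ?_
  rw [Trivialization.symmL_continuousLinearMapAt _ (hg.subset _ hy.2.2.2),
    extendZero_apply t hy.2.2.1]

lemma coeff_mem_thickIdeal {W : Opens X} {x : X} (hW : W ≤ (U x).toOpens)
    {s : GluedModule ι g W} (hs : fiberMap E s = 0) (i : Fin (Module.finrank ℂ F)) :
    hg.coeff hW s i ∈ thickIdeal ι W := by
  intro p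
  have h0 : (trivializationAt F E (p : X)).symmL ℂ (p : X) (valueVec ι F p (GluedModule.eval p s)) = 0 :=
    congrFun hs p
  have h1 : valueVec ι F p (GluedModule.eval p s) = 0 := by
    rw [← Trivialization.continuousLinearMapAt_symmL (R := ℂ) (trivializationAt F E (p : X))
      (hg.subset _ (U (p : X)).mem) (valueVec ι F p (GluedModule.eval p s)), h0, map_zero]
  rw [hg.coeff_apply, ← coordCLM_valueVec, hg.valueVec_mulVec (hW p.2) (U (p : X)).mem, h1,
    map_zero, map_zero]

/-- A section with zero image in `E` has coefficients vanishing along `X`, so its expansion in the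
frame exhibits it as an element of `𝒥 M`. -/
lemma gluedRes_mem_span {O W : Opens X} {x : X} (hW : W ≤ (U x).toOpens) (hWO : W ≤ O)
    {s : GluedModule ι g O} (hs : fiberMap E s = 0) : GluedModule.res hWO s ∈
      Submodule.span (thickSections ι W) {m : GluedModule ι g W | ∃ a ∈ thickIdeal ι W,
        ∃ m' : GluedModule ι g W, m = a • m'} := by
  have hs' : fiberMap E (GluedModule.res hWO s) = 0 :=
    funext fun p => congrFun hs (Opens.inclusion hWO p)
  have key : ∀ m : GluedModule ι g W,
      m = ∑ i, hg.coeff hW (GluedModule.res hWO s) i • GluedModule.res hW (hg.frame x i) →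
      m ∈ Submodule.span (thickSections ι W) {m : GluedModule ι g W | ∃ a ∈ thickIdeal ι W,
        ∃ m' : GluedModule ι g W, m = a • m'} := by
    rintro _ rfl
    exact Submodule.sum_mem _ fun i _ =>
      Submodule.subset_span ⟨_, hg.coeff_mem_thickIdeal hW hs' i, _, rfl⟩
  exact key _ (hg.eq_sum_coeff hW _)

/-- The glued module restricts to `E`. -/
noncomputable def gluedPullbackIso [IsManifold 𝓘(ℂ, EX) ω X] [IsManifold 𝓘(ℂ, EY) ω Y]
    [∀ x, IsTopologicalAddGroup (E x)] [∀ x, ContinuousSMul ℂ (E x)]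
    [ContMDiffVectorBundle ω F E 𝓘(ℂ, EX)]
    (hι : Manifold.IsSmoothEmbedding 𝓘(ℂ, EX) 𝓘(ℂ, EY) ω ι) :
    PullbackIso ι F E (gluedSheaf ι g) where
  toFun O :=
    { toFun := fun s : GluedModule ι g O => fiberMap E s
      map_zero' := fiberMap_zero
      map_add' := fiberMap_add }
  holomorphic _ s := hg.contMDiff_fiberMap s
  map_smul _ a s x := fiberMap_smul a s x
  map_res _ _ _ _ _ := rfl
  locally_surjective _ _ ht _ hx := hg.fiberMap_locally_surjective hι ht hx
  ker_le O _ hs x hx := ⟨O ⊓ (U x).toOpens, inf_le_left, ⟨hx, (U x).mem⟩,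
    hg.gluedRes_mem_span inf_le_right inf_le_left hs⟩

theorem extendsToFirstThickening [IsManifold 𝓘(ℂ, EX) ω X] [IsManifold 𝓘(ℂ, EY) ω Y]
    [∀ x, IsTopologicalAddGroup (E x)] [∀ x, ContinuousSMul ℂ (E x)]
    [ContMDiffVectorBundle ω F E 𝓘(ℂ, EX)]
    (hι : Manifold.IsSmoothEmbedding 𝓘(ℂ, EX) 𝓘(ℂ, EY) ω ι) :
    ExtendsToFirstThickening ι F E :=
  ⟨gluedSheaf ι g, hg.isLocallyFree, ⟨hg.gluedPullbackIso hι⟩⟩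

end IsThickCocycle

end GluedBundle

/-! ### Nakayama's lemma for an ideal of square zero. -/

section FrameChange

variable {R M : Type*} [CommRing R] [AddCommGroup M] [Module R M]

lemma sum_smul_sum_smul {m n : ℕ} (a : Fin m → R) (B : Fin m → Fin n → R) (s : Fin n → M) :
    ∑ j, a j • ∑ i, B j i • s i = ∑ i, (∑ j, a j * B j i) • s i := by
  simp only [Finset.smul_sum, smul_smul, Finset.sum_smul]
  exact Finset.sum_comm

/-- Vectors which generate a free module modulo a square-zero ideal `J`, and are independent
modulo `J`, form a basis. -/
lemma existsUnique_sum_smul_of_sq_zero {J : Ideal R} (hJ : ∀ a ∈ J, ∀ b ∈ J, a * b = 0) {m n : ℕ}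
    {e : Fin m → M} (he : ∀ t : M, ∃! a : Fin m → R, t = ∑ i, a i • e i) {s : Fin n → M}
    {A : Fin m → Fin n → R} {C : Fin m → Fin m → R} (hC : ∀ j k, C j k ∈ J)
    (h : ∀ j, e j = ∑ i, A j i • s i + ∑ k, C j k • e k)
    (hs : ∀ a : Fin n → R, ∑ i, a i • s i = 0 → ∀ i, a i ∈ J) (t : M) :
    ∃! a : Fin n → R, t = ∑ i, a i • s i := by
  -- Inserting the relation `h` into itself leaves a remainder with coefficients in `J² = 0`, so the
  -- error term already lies in the span of `s`.
  have hCe : ∀ j, ∑ k, C j k • e k = ∑ i, (∑ k, C j k * A k i) • s i := by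
    intro j
    have h1 : ∑ k, C j k • e k = ∑ k, C j k • ∑ i, A k i • s i + ∑ k, C j k • ∑ l, C k l • e l := by
      rw [← Finset.sum_add_distrib]
      exact Finset.sum_congr rfl fun k _ => by rw [← smul_add, ← h]
    rw [h1, sum_smul_sum_smul, sum_smul_sum_smul]
    refine add_eq_left.2 (Finset.sum_eq_zero fun l _ => ?_)
    rw [Finset.sum_eq_zero fun k _ => hJ _ (hC j k) _ (hC k l), zero_smul]
  have hQ : ∀ j, e j = ∑ i, (A j i + ∑ k, C j k * A k i) • s i := by
    intro j
    simp only [add_smul, Finset.sum_add_distrib]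
    rw [← hCe, ← h]
  set Q : Fin m → Fin n → R := fun j i => A j i + ∑ k, C j k * A k i
  have hgen : ∀ b : Fin m → R, ∑ j, b j • e j = ∑ i, (∑ j, b j * Q j i) • s i := by
    intro b
    rw [← sum_smul_sum_smul]
    exact Finset.sum_congr rfl fun j _ => by rw [← hQ]
  choose P hP using fun i => (he (s i)).exists
  -- Let `P` express `s` in `e`, and `Q` express `e` in `s`. A relation `a` on `s` gives `a P = 0`
  -- by freeness of `e`. Both `a` and `P Q - 1` have entries in `J` by independence modulo `J`, so
  -- `a = a P Q = 0`. The lengths `m` and `n` are never compared.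
  have hzero : ∀ a : Fin n → R, ∑ i, a i • s i = 0 → a = 0 := by
    intro a ha
    have haP : (fun j => ∑ i, a i * P i j) = 0 := by
      refine (he 0).unique ?_ (by simp)
      rw [← sum_smul_sum_smul, ← ha]
      exact Finset.sum_congr rfl fun i _ => by rw [← hP]
    have hPQ : ∀ i k, ∑ j, P i j * Q j k - (if i = k then 1 else 0) ∈ J := by
      intro i
      refine hs _ ?_
      simp only [sub_smul, Finset.sum_sub_distrib, ite_smul, one_smul, zero_smul]
      rw [← hgen, ← hP]
      simp
    funext k
    have h1 : ∑ i, a i * (∑ j, P i j * Q j k - (if i = k then 1 else 0)) = 0 :=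
      Finset.sum_eq_zero fun i _ => hJ _ (hs a ha i) _ (hPQ i k)
    have h2 : ∑ i, a i * ∑ j, P i j * Q j k = 0 := by
      simp only [Finset.mul_sum, ← mul_assoc]
      rw [Finset.sum_comm]
      refine Finset.sum_eq_zero fun j _ => ?_
      rw [← Finset.sum_mul, show ∑ i, a i * P i j = 0 from congrFun haP j, zero_mul]
    simpa [mul_sub, Finset.sum_sub_distrib, h2] using h1
  obtain ⟨b, hb, -⟩ := he t
  refine ⟨_, hb.trans (hgen b), fun a ha => ?_⟩
  refine sub_eq_zero.1 (hzero _ ?_)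
  simp only [Pi.sub_apply, sub_smul, Finset.sum_sub_distrib]
  rw [← ha, ← hgen, ← hb, sub_self]

/-- Expanding `t'` in a multiple `a • t'` with `a ∈ J` gives coefficients in `J`, and such
combinations are closed under the module operations. -/
lemma exists_sum_smul_of_mem_span {J : Ideal R} {m : ℕ} {e : Fin m → M}
    (he : ∀ t : M, ∃ a : Fin m → R, t = ∑ i, a i • e i) {t : M}
    (ht : t ∈ Submodule.span R {t | ∃ a ∈ J, ∃ t' : M, t = a • t'}) :
    ∃ c : Fin m → R, (∀ i, c i ∈ J) ∧ t = ∑ i, c i • e i := by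
  induction ht using Submodule.span_induction with
  | mem t ht =>
    obtain ⟨a, ha, t', rfl⟩ := ht
    obtain ⟨b, rfl⟩ := he t'
    exact ⟨fun i => a * b i, fun i => J.mul_mem_right _ ha, by simp [Finset.smul_sum, smul_smul]⟩
  | zero => exact ⟨0, fun _ => J.zero_mem, by simp⟩
  | add t t' _ _ h h' =>
    obtain ⟨c, hc, rfl⟩ := h
    obtain ⟨c', hc', rfl⟩ := h'
    exact ⟨c + c', fun i => J.add_mem (hc i) (hc' i), by
      simp [add_smul, Finset.sum_add_distrib]⟩
  | smul a t _ h =>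
    obtain ⟨c, hc, rfl⟩ := h
    exact ⟨fun i => a * c i, fun i => J.mul_mem_left _ (hc i), by simp [Finset.smul_sum, smul_smul]⟩

end FrameChange
-- Sections of a given module over `X₁` and their images in `E`.
section ModuleSections

variable {EX : Type*} [NormedAddCommGroup EX] [NormedSpace ℂ EX]
  {EY : Type*} [NormedAddCommGroup EY] [NormedSpace ℂ EY]
  {X Y : Type u} [TopologicalSpace X] [ChartedSpace EX X]
  [TopologicalSpace Y] [ChartedSpace EY Y]
  {ι : C^ω⟮𝓘(ℂ, EX), X; 𝓘(ℂ, EY), Y⟯}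

noncomputable instance (U : Opens X) : CommRing (thickSections ι U) := inferInstance

/-- The sections over `U` of a sheaf of `𝒪_{X₁}`-modules. -/
def ModuleSections (M : SheafOfModules.{u} (thickSheaf ι)) (U : Opens X) : Type u :=
  M.val.obj (op (U : Opens (TopCat.of X)))

namespace ModuleSections

variable {M : SheafOfModules.{u} (thickSheaf ι)}

noncomputable instance (U : Opens X) : AddCommGroup (ModuleSections M U) :=
  inferInstanceAs (AddCommGroup (M.val.obj (op (U : Opens (TopCat.of X)))))

noncomputable instance instModule (U : Opens X) : Module (thickSections ι U) (ModuleSections M U) :=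
  (M.val.obj (op (U : Opens (TopCat.of X)))).isModule

noncomputable instance (U : Opens X) : SMul (thickSections ι U) (ModuleSections M U) :=
  (instModule U).toSMul

/-- The restriction of sections. -/
noncomputable def res {U W : Opens X} (h : W ≤ U) : ModuleSections M U →+ ModuleSections M W where
  toFun s := (M.val.map (homOfLE (show (W : Opens (TopCat.of X)) ≤ U from h)).op s :
    M.val.obj (op (W : Opens (TopCat.of X))))
  map_zero' := map_zero _
  map_add' := map_add _

lemma res_smul {U W : Opens X} (h : W ≤ U) (a : thickSections ι U) (s : ModuleSections M U) :
    res h (a • s) = thickRes ι h a • res h s :=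
  PresheafOfModules.map_smul M.val (homOfLE (show (W : Opens (TopCat.of X)) ≤ U from h)).op a s

lemma res_res {U V W : Opens X} (h : V ≤ U) (h' : W ≤ V) (s : ModuleSections M U) :
    res h' (res h s) = res (h'.trans h) s :=
  (PresheafOfModules.map_comp_apply M.val (homOfLE (show (V : Opens (TopCat.of X)) ≤ U from h)).op
    (homOfLE (show (W : Opens (TopCat.of X)) ≤ V from h')).op s).symm

lemma res_sum_smul {U W : Opens X} (h : W ≤ U) {n : ℕ} (a : Fin n → thickSections ι U)
    (s : Fin n → ModuleSections M U) :
    res h (∑ i, a i • s i) = ∑ i, thickRes ι h (a i) • res h (s i) := by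
  rw [map_sum]
  exact Finset.sum_congr rfl fun i _ => res_smul h _ _

lemma exists_frame (hM : IsLocallyFreeOfFiniteRank ι M) (x : X) :
    ∃ U : Opens X, x ∈ U ∧ ∃ (n : ℕ) (e : Fin n → ModuleSections M U), ∀ (W : Opens X) (h : W ≤ U)
      (s : ModuleSections M W), ∃! a : Fin n → thickSections ι W, s = ∑ i, a i • res h (e i) :=
  hM x

variable {F : Type*} [NormedAddCommGroup F] [NormedSpace ℂ F]
  {E : X → Type*} [TopologicalSpace (TotalSpace F E)] [∀ x, AddCommGroup (E x)]
  [∀ x, Module ℂ (E x)] [∀ x, TopologicalSpace (E x)] [FiberBundle F E] [VectorBundle ℂ F E]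
  (φ : PullbackIso ι F E M)

/-- The value in the fibre of `E` of a section. -/
noncomputable def fib {U : Opens X} (x : U) : ModuleSections M U →+ E (x : X) :=
  (Pi.evalAddMonoidHom (fun x : U => E (x : X)) x).comp (φ.toFun U)

lemma fib_smul {U : Opens X} (a : thickSections ι U) (s : ModuleSections M U) (x : U) :
    fib φ x (a • s) = thickValue ι (x : X) (a.1 x) • fib φ x s := φ.map_smul U a s x

lemma fib_res {U W : Opens X} (h : W ≤ U) (s : ModuleSections M U) (x : W) :
    fib φ x (res h s) = fib φ (Opens.inclusion h x) s := φ.map_res U W h s x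

lemma fib_sum_smul {U : Opens X} (x : U) {n : ℕ} (a : Fin n → thickSections ι U)
    (s : Fin n → ModuleSections M U) :
    fib φ x (∑ i, a i • s i) = ∑ i, thickValue ι (x : X) ((a i).1 x) • fib φ x (s i) := by
  rw [map_sum]
  exact Finset.sum_congr rfl fun i _ => fib_smul φ _ _ _

lemma contMDiff_fib {U : Opens X} (s : ModuleSections M U) :
    ContMDiff 𝓘(ℂ, EX) (𝓘(ℂ, EX).prod 𝓘(ℂ, F)) ω
      (fun x : U => TotalSpace.mk' F (x : X) (fib φ x s)) := φ.holomorphic U s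

lemma exists_lift {U : Opens X} {t : ∀ x : U, E (x : X)}
    (ht : ContMDiff 𝓘(ℂ, EX) (𝓘(ℂ, EX).prod 𝓘(ℂ, F)) ω
      (fun x : U => TotalSpace.mk' F (x : X) (t x))) {x : X} (hx : x ∈ U) :
    ∃ (W : Opens X) (h : W ≤ U) (s : ModuleSections M W), x ∈ W ∧
      ∀ y : W, fib φ y s = t (Opens.inclusion h y) := φ.locally_surjective U t ht x hx

lemma exists_res_mem_span {U : Opens X} {s : ModuleSections M U} (hs : ∀ x, fib φ x s = 0) {x : X}
    (hx : x ∈ U) : ∃ (W : Opens X) (h : W ≤ U), x ∈ W ∧ res h s ∈ Submodule.span (thickSections ι W)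
      {m : ModuleSections M W | ∃ a ∈ thickIdeal ι W, ∃ m' : ModuleSections M W, m = a • m'} :=
  φ.ker_le U s (funext hs) x hx

end ModuleSections

end ModuleSections

/-! ### Bases of an extension that lift the local frames of `E`. -/

section AdaptedFrames

variable {EX : Type*} [NormedAddCommGroup EX] [NormedSpace ℂ EX]
  {EY : Type*} [NormedAddCommGroup EY] [NormedSpace ℂ EY]
  {X Y : Type u} [TopologicalSpace X] [ChartedSpace EX X]
  [TopologicalSpace Y] [ChartedSpace EY Y]
  {ι : C^ω⟮𝓘(ℂ, EX), X; 𝓘(ℂ, EY), Y⟯}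

lemma exists_opens_le_forall {n : ℕ} {V : Opens X} {W : Fin n → Opens X} {x : X} (hV : x ∈ V)
    (hW : ∀ j, x ∈ W j) : ∃ O : Opens X, x ∈ O ∧ O ≤ V ∧ ∀ j, O ≤ W j := by
  obtain ⟨O, hO, hO', hx⟩ := eventually_nhds_iff.1 ((eventually_mem_opens hV).and
    (Filter.eventually_all.2 fun j => eventually_mem_opens (hW j)))
  exact ⟨⟨O, hO'⟩, hx, fun p hp => (hO p hp).1, fun j p hp => (hO p hp).2 j⟩

lemma thickIdeal_mul_eq_zero (hι : Manifold.IsSmoothEmbedding 𝓘(ℂ, EX) 𝓘(ℂ, EY) ω ι) {U : Opens X}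
    {a b : thickSections ι U} (ha : a ∈ thickIdeal ι U) (hb : b ∈ thickIdeal ι U) : a * b = 0 := by
  refine Subtype.ext (funext fun x => ?_)
  have h : ∀ c ∈ thickIdeal ι U, ∀ᶠ p in 𝓝 (x : X), thickValue ι p (extendZero c.1 p) = 0 := by
    intro c hc
    filter_upwards [eventually_mem_opens x.2] with p hp
    rw [extendZero_apply _ hp]
    exact hc ⟨p, hp⟩
  have key := ThickAt.mul_eq_zero hι ((mem_thickSections_iff ι a.1).1 a.2 x x.2)
    ((mem_thickSections_iff ι b.1).1 b.2 x x.2) (h a ha) (h b hb)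
  rw [extendZero_apply _ x.2, extendZero_apply _ x.2] at key
  exact key

lemma thickRes_mem_thickIdeal {U W : Opens X} (h : W ≤ U) {a : thickSections ι U}
    (ha : a ∈ thickIdeal ι U) : thickRes ι h a ∈ thickIdeal ι W :=
  fun x => ha (Opens.inclusion h x)

variable {F : Type*} [NormedAddCommGroup F] [NormedSpace ℂ F] [FiniteDimensional ℂ F]
  {E : X → Type*} [TopologicalSpace (TotalSpace F E)] [∀ x, AddCommGroup (E x)]
  [∀ x, Module ℂ (E x)] [∀ x, TopologicalSpace (E x)] [FiberBundle F E] [VectorBundle ℂ F E]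
  {M : SheafOfModules.{u} (thickSheaf ι)} (φ : PullbackIso ι F E M)

open ModuleSections

/-- Sections of a module which lift the local frame of `E` given by the preferred trivialization
at `x`. -/
structure LiftsFrame (x : X) {W : Opens X}
    (s : Fin (Module.finrank ℂ F) → ModuleSections M W) : Prop where
  subset : ∀ p ∈ W, p ∈ (trivializationAt F E x).baseSet
  fib_eq : ∀ (p : W) (i), fib φ p (s i) =
    (trivializationAt F E x).symmL ℂ (p : X) (Module.finBasis ℂ F i)

namespace LiftsFrame

variable {φ} {x : X} {W : Opens X} {s : Fin (Module.finrank ℂ F) → ModuleSections M W}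

lemma res (hs : LiftsFrame φ x s) {O : Opens X} (h : O ≤ W) :
    LiftsFrame φ x fun i => ModuleSections.res h (s i) where
  subset p hp := hs.subset p (h hp)
  fib_eq p i := (fib_res φ h _ p).trans (hs.fib_eq _ i)

lemma fib_sum_smul (hs : LiftsFrame φ x s) (a : Fin (Module.finrank ℂ F) → thickSections ι W)
    (p : W) : fib φ p (∑ i, a i • s i) =
      (trivializationAt F E x).symmL ℂ (p : X) (valueVec ι F p fun i => (a i).1 p) := by
  rw [ModuleSections.fib_sum_smul]
  simp only [hs.fib_eq]
  change _ = (trivializationAt F E x).symmL ℂ (p : X)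
    (∑ i, thickValue ι (p : X) ((a i).1 p) • Module.finBasis ℂ F i)
  rw [map_sum]
  exact Finset.sum_congr rfl fun i _ => (map_smul _ _ _).symm

/-- In each fibre of `E` the images of the `s i` are a basis, so the coefficients of a relation have
value zero at every point of `W`. -/
lemma mem_thickIdeal (hs : LiftsFrame φ x s) {a : Fin (Module.finrank ℂ F) → thickSections ι W}
    (ha : ∑ i, a i • s i = 0) (i : Fin (Module.finrank ℂ F)) : a i ∈ thickIdeal ι W := by
  intro p
  have h := hs.fib_sum_smul a p
  rw [ha, map_zero] at h
  have h1 := Trivialization.continuousLinearMapAt_symmL (R := ℂ) (trivializationAt F E x)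
    (hs.subset p p.2) (valueVec ι F p fun i => (a i).1 p)
  rw [← h, map_zero] at h1
  rw [← coordCLM_valueVec ι (fun i => (a i).1 p) i, ← h1, map_zero]

end LiftsFrame

variable [IsManifold 𝓘(ℂ, EX) ω X] [IsManifold 𝓘(ℂ, EY) ω Y]
  [ContMDiffVectorBundle ω F E 𝓘(ℂ, EX)]

omit [IsManifold 𝓘(ℂ, EX) ω X] [IsManifold 𝓘(ℂ, EY) ω Y] in
-- The frame vectors of `E` are lifted one at a time by local surjectivity; there are finitely many,
-- so the lifts share a neighbourhood.
lemma exists_liftsFrame (x : X) : ∃ (W : Opens X) (s : Fin (Module.finrank ℂ F) →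
    ModuleSections M W), x ∈ W ∧ LiftsFrame φ x s := by
  let U : Opens X := (baseNhds F E x).toOpens
  have hex : ∀ i, ∃ (W : Opens X) (h : W ≤ U) (s : ModuleSections M W), x ∈ W ∧
      ∀ y : W, fib φ y s = (trivializationAt F E x).symmL ℂ (y : X) (Module.finBasis ℂ F i) := by
    intro i
    refine exists_lift φ (U := U) (t := fun p => (trivializationAt F E x).symmL ℂ (p : X)
      (Module.finBasis ℂ F i)) (fun q => ?_) (baseNhds F E x).mem
    refine contMDiffAt_subtype_iff (f := fun p => TotalSpace.mk' F p
      ((trivializationAt F E x).symmL ℂ p (Module.finBasis ℂ F i))).2 ?_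
    rw [(trivializationAt F E x).contMDiffAt_section_iff q.2]
    refine (contMDiffAt_const (c := Module.finBasis ℂ F i)).congr_of_eventuallyEq ?_
    filter_upwards [eventually_mem_opens q.2] with p hp
    refine (congrFun (Trivialization.coe_linearMapAt_of_mem (R := ℂ) _ hp) _).symm.trans ?_
    exact Trivialization.continuousLinearMapAt_symmL _ hp _
  choose W hW s hx hs using hex
  obtain ⟨O, hxO, hOU, hO⟩ := exists_opens_le_forall (V := U) (baseNhds F E x).mem hx
  exact ⟨O, fun i => ModuleSections.res (hO i) (s i), hxO, fun p hp => hOU hp,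
    fun p i => (fib_res φ (hO i) _ p).trans (hs i _)⟩

variable {φ}

/-- The coordinates of the image of `t` in the trivialization at `x` are lifted to coefficients in
`𝒪_{X₁}`. -/
lemma LiftsFrame.exists_fib_eq (hι : Manifold.IsSmoothEmbedding 𝓘(ℂ, EX) 𝓘(ℂ, EY) ω ι) {x : X}
    {V : Opens X} {s : Fin (Module.finrank ℂ F) → ModuleSections M V} (hs : LiftsFrame φ x s)
    (t : ModuleSections M V) {q : X} (hq : q ∈ V) :
    ∃ (W : Opens X) (h : W ≤ V) (a : Fin (Module.finrank ℂ F) → thickSections ι W), q ∈ W ∧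
      ∀ p : W, fib φ p (ModuleSections.res h t - ∑ i, a i • ModuleSections.res h (s i)) = 0 := by
  have ht : ContMDiffAt 𝓘(ℂ, EX) (𝓘(ℂ, EX).prod 𝓘(ℂ, F)) ω
      (fun p => TotalSpace.mk' F p (extendZero (fun p : V => fib φ p t) p)) q := by
    refine (contMDiffAt_subtype_iff (x := (⟨q, hq⟩ : V))).1
      ((contMDiff_fib φ t ⟨q, hq⟩).congr_of_eventuallyEq (.of_forall fun p => ?_))
    change TotalSpace.mk' F (p : X) (extendZero (fun p : V => fib φ p t) p) = _
    rw [extendZero_apply (fun p : V => fib φ p t) p.2]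
  rw [(trivializationAt F E x).contMDiffAt_section_iff (hs.subset q hq)] at ht
  have hex : ∀ i, ∃ s, ThickAt ι s q ∧ ∀ᶠ p in 𝓝 q, thickValue ι p (s p) = coordCLM F i
      (trivializationAt F E x ⟨p, extendZero (fun p : V => fib φ p t) p⟩).2 := fun i =>
    exists_thickAt_of_value ι hι
      (ContMDiffAt.comp (I' := 𝓘(ℂ, F)) q (coordCLM F i).contMDiff.contMDiffAt ht)
  choose a ha hv using hex
  have hall : ∀ᶠ p in 𝓝 q, (∀ i, ThickAt ι (a i) p) ∧ (∀ i, thickValue ι p (a i p) = coordCLM F i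
      (trivializationAt F E x ⟨p, extendZero (fun p : V => fib φ p t) p⟩).2) ∧ p ∈ V :=
    (Filter.eventually_all.2 fun i => (ha i).eventually).and
      ((Filter.eventually_all.2 hv).and (eventually_mem_opens hq))
  obtain ⟨W, hW, hWo, hqW⟩ := eventually_nhds_iff.1 hall
  let W' : Opens X := ⟨W, hWo⟩
  have hWV : W' ≤ V := fun p hp => (hW p hp).2.2
  refine ⟨W', hWV, fun i => ⟨_, restrict_mem_thickSections ι fun p hp => (hW p hp).1 i⟩, hqW,
    fun p => ?_⟩
  have hp := hW p p.2
  have hb := hs.subset p hp.2.2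
  rw [map_sub, (hs.res hWV).fib_sum_smul, fib_res, sub_eq_zero]
  have hvec : valueVec ι F (p : X) (fun i => a i p) =
      (trivializationAt F E x).continuousLinearMapAt ℂ (p : X)
        (extendZero (fun p : V => fib φ p t) p) :=
    ext_coordCLM fun i => by
      rw [coordCLM_valueVec, hp.2.1 i, Trivialization.continuousLinearMapAt_apply,
        Trivialization.coe_linearMapAt_of_mem _ hb]
  refine Eq.symm ((congrArg _ hvec).trans ?_)
  rw [Trivialization.symmL_continuousLinearMapAt _ hb,
    extendZero_apply (fun p : V => fib φ p t) hp.2.2]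

/-- The error left by `LiftsFrame.exists_fib_eq` maps to zero in `E`, so it lies locally in `𝒥 M`
and is a combination of the `e k` with coefficients in `𝒥`. -/
lemma LiftsFrame.exists_res_eq (hι : Manifold.IsSmoothEmbedding 𝓘(ℂ, EX) 𝓘(ℂ, EY) ω ι) {x : X}
    {V : Opens X} {s : Fin (Module.finrank ℂ F) → ModuleSections M V} (hs : LiftsFrame φ x s)
    {m : ℕ} {e : Fin m → ModuleSections M V}
    (he : ∀ (W : Opens X) (h : W ≤ V) (t : ModuleSections M W),
      ∃! a : Fin m → thickSections ι W, t = ∑ i, a i • ModuleSections.res h (e i))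
    (t : ModuleSections M V) {q : X} (hq : q ∈ V) :
    ∃ (W : Opens X) (h : W ≤ V) (a : Fin (Module.finrank ℂ F) → thickSections ι W)
      (c : Fin m → thickSections ι W), q ∈ W ∧ (∀ k, c k ∈ thickIdeal ι W) ∧
      ModuleSections.res h t =
        ∑ i, a i • ModuleSections.res h (s i) + ∑ k, c k • ModuleSections.res h (e k) := by
  obtain ⟨W, h, a, hqW, hW⟩ := hs.exists_fib_eq hι t hq
  obtain ⟨W', h', hqW', hspan⟩ := exists_res_mem_span φ hW hqW
  obtain ⟨c, hc, hc'⟩ := exists_sum_smul_of_mem_span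
    (e := fun i => ModuleSections.res (h'.trans h) (e i)) (fun t => (he W' _ t).exists) hspan
  refine ⟨W', h'.trans h, fun i => thickRes ι h' (a i), c, hqW', hc, ?_⟩
  rw [← hc', map_sub, res_sum_smul, res_res]
  simp only [res_res]
  exact (add_sub_cancel _ _).symm

/-- The square-zero Nakayama lemma applied over every open set inside one neighbourhood of `x`,
which shows in particular that `M` has a local basis indexed by the rank of `E`. -/
theorem exists_liftsFrame_existsUnique (hι : Manifold.IsSmoothEmbedding 𝓘(ℂ, EX) 𝓘(ℂ, EY) ω ι)
    (hM : IsLocallyFreeOfFiniteRank ι M) (φ : PullbackIso ι F E M) (x : X) :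
    ∃ (W : Opens X) (s : Fin (Module.finrank ℂ F) → ModuleSections M W), x ∈ W ∧
      LiftsFrame φ x s ∧ ∀ (O : Opens X) (h : O ≤ W) (t : ModuleSections M O),
        ∃! a : Fin (Module.finrank ℂ F) → thickSections ι O,
          t = ∑ i, a i • ModuleSections.res h (s i) := by
  obtain ⟨V₁, s, hx₁, hs⟩ := exists_liftsFrame φ x
  obtain ⟨V₂, hx₂, m, e, he⟩ := exists_frame hM x
  have h₁ : V₁ ⊓ V₂ ≤ V₁ := inf_le_left
  have h₂ : V₁ ⊓ V₂ ≤ V₂ := inf_le_right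
  have hs' := hs.res h₁
  have he' : ∀ (W : Opens X) (h : W ≤ V₁ ⊓ V₂) (t : ModuleSections M W), ∃! a : Fin m →
      thickSections ι W, t = ∑ i, a i • ModuleSections.res h (ModuleSections.res h₂ (e i)) := by
    intro W h t
    simp only [res_res]
    exact he W _ t
  have hx : x ∈ V₁ ⊓ V₂ := ⟨hx₁, hx₂⟩
  -- Only the finitely many basis vectors `e j` are decomposed, so one neighbourhood `O` serves for
  -- all of them and restriction yields the relations over every smaller open set.
  choose W hW A C hxW hC hAC using fun j =>
    hs'.exists_res_eq hι he' (ModuleSections.res h₂ (e j)) hx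
  obtain ⟨O, hxO, hOV, hO⟩ := exists_opens_le_forall hx hxW
  refine ⟨O, _, hxO, hs'.res hOV, fun O' h t => ?_⟩
  refine existsUnique_sum_smul_of_sq_zero (J := thickIdeal ι O')
    (fun a ha b hb => thickIdeal_mul_eq_zero hι ha hb) (he' O' (h.trans hOV))
    (A := fun j i => thickRes ι (h.trans (hO j)) (A j i))
    (C := fun j k => thickRes ι (h.trans (hO j)) (C j k))
    (fun j k => thickRes_mem_thickIdeal _ (hC j k)) (fun j => ?_)
    (fun a ha => ((hs'.res hOV).res h).mem_thickIdeal ha) t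
  have hj := congrArg (ModuleSections.res (h.trans (hO j))) (hAC j)
  rw [map_add, res_sum_smul, res_sum_smul] at hj
  simp only [res_res] at hj ⊢
  exact hj

end AdaptedFrames

/-! ### The transition matrices of an extension. -/

section CocycleOfExtension

variable {EX : Type*} [NormedAddCommGroup EX] [NormedSpace ℂ EX]
  {EY : Type*} [NormedAddCommGroup EY] [NormedSpace ℂ EY]
  {X Y : Type u} [TopologicalSpace X] [ChartedSpace EX X] [IsManifold 𝓘(ℂ, EX) ω X]
  [TopologicalSpace Y] [ChartedSpace EY Y] [IsManifold 𝓘(ℂ, EY) ω Y]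
  {ι : C^ω⟮𝓘(ℂ, EX), X; 𝓘(ℂ, EY), Y⟯}
  {F : Type*} [NormedAddCommGroup F] [NormedSpace ℂ F] [FiniteDimensional ℂ F]
  {E : X → Type*} [TopologicalSpace (TotalSpace F E)] [∀ x, AddCommGroup (E x)]
  [∀ x, Module ℂ (E x)] [∀ x, TopologicalSpace (E x)] [∀ x, IsTopologicalAddGroup (E x)]
  [∀ x, ContinuousSMul ℂ (E x)] [FiberBundle F E] [VectorBundle ℂ F E]

open ModuleSections

omit [IsManifold 𝓘(ℂ, EX) ω X] [IsManifold 𝓘(ℂ, EY) ω Y] in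
-- Mapping the relation between two lifted frames to the fibres of `E` gives the relation between
-- the two trivializations, and coefficients in a fibre basis are unique.
lemma LiftsFrame.thickValue_eq {M : SheafOfModules.{u} (thickSheaf ι)} {φ : PullbackIso ι F E M}
    {x y : X} {W : Opens X} {s t : Fin (Module.finrank ℂ F) → ModuleSections M W}
    (hs : LiftsFrame φ x s) (ht : LiftsFrame φ y t) {j : Fin (Module.finrank ℂ F)}
    {a : Fin (Module.finrank ℂ F) → thickSections ι W} (ha : t j = ∑ i, a i • s i) (p : W)
    (i : Fin (Module.finrank ℂ F)) :
    thickValue ι (p : X) ((a i).1 p) = entryCLM F i j (bundleTransition F E x y p) := by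
  have h := ht.fib_eq p j
  rw [ha, hs.fib_sum_smul] at h
  rw [entryCLM_apply, bundleTransition_apply F E (hs.subset p p.2) (ht.subset p p.2), ← h,
    Trivialization.continuousLinearMapAt_symmL _ (hs.subset p p.2), coordCLM_valueVec]

/-- The base changes between adapted frames are the matrices; uniqueness of coefficients over triple
intersections gives the cocycle identity. -/
theorem ExtendsToFirstThickening.exists_thickCocycle [ContMDiffVectorBundle ω F E 𝓘(ℂ, EX)]
    (hι : Manifold.IsSmoothEmbedding 𝓘(ℂ, EX) 𝓘(ℂ, EY) ω ι) (h : ExtendsToFirstThickening ι F E) :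
    ∃ U g, IsThickCocycle ι F E U g := by
  obtain ⟨M, hM, ⟨φ⟩⟩ := h
  choose W s hxW hs huniq using exists_liftsFrame_existsUnique hι hM φ
  have hl : ∀ x y, W x ⊓ W y ≤ W x := fun x y => inf_le_left
  have hr : ∀ x y, W x ⊓ W y ≤ W y := fun x y => inf_le_right
  have hG : ∀ x y j, ∃ a : Fin (Module.finrank ℂ F) → thickSections ι (W x ⊓ W y),
      res (hr x y) (s y j) = ∑ i, a i • res (hl x y) (s x i) := fun x y j =>
    (huniq x (W x ⊓ W y) (hl x y) (res (hr x y) (s y j))).exists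
  choose G hG using hG
  have hGO : ∀ x y (O : Opens X) (hO : O ≤ W x ⊓ W y) j, res (hO.trans (hr x y)) (s y j) =
      ∑ i, thickRes ι hO (G x y j i) • res (hO.trans (hl x y)) (s x i) := by
    intro x y O hO j
    have h := congrArg (res hO) (hG x y j)
    rw [res_sum_smul] at h
    simpa only [res_res] using h
  have happ : ∀ x y i j p (hp : p ∈ W x ⊓ W y),
      extendZero (G x y j i).1 p = (G x y j i).1 ⟨p, hp⟩ := fun x y i j p hp =>
    extendZero_apply (G x y j i).1 hp
  -- `G x y j i` is the coefficient of `s x i` in `s y j`, so it becomes the entry `(i, j)`: the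
  -- columns are the vectors of the frame `y` expressed in the frame `x`.
  refine ⟨fun x => ⟨W x, hxW x⟩, fun x y p => Matrix.of fun i j => extendZero (G x y j i).1 p,
    fun x => (hs x).subset, fun x y p hp i j => (mem_thickSections_iff ι _).1 (G x y j i).2 p hp,
    fun x y z p hp => ?_, fun x p hp => ?_, fun x y p hp i j => ?_⟩
  · let O : Opens X := W x ⊓ W y ⊓ W z
    have hxy : O ≤ W x ⊓ W y := inf_le_left
    have hyz : O ≤ W y ⊓ W z := le_inf (hxy.trans (hr x y)) inf_le_right
    have hxz : O ≤ W x ⊓ W z := le_inf (hxy.trans (hl x y)) inf_le_right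
    ext i j
    rw [Matrix.mul_apply]
    -- `s z` is expanded first in `s y` and then in `s x`. The factors appear in the order opposite
    -- to the matrix product, which does not matter over a commutative ring.
    have h1 : res (hxz.trans (hr x z)) (s z j) = ∑ i, (∑ k, thickRes ι hyz (G y z j k) *
        thickRes ι hxy (G x y k i)) • res (hxz.trans (hl x z)) (s x i) := by
      rw [← sum_smul_sum_smul, hGO y z O hyz j]
      exact Finset.sum_congr rfl fun k _ => congrArg _ (hGO x y O hxy k)
    have h2 := congrFun ((huniq x O (hxz.trans (hl x z)) _).unique h1 (hGO x z O hxz j)) i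
    have h3 : ∑ k, (G y z j k).1 ⟨p, hyz hp⟩ * (G x y k i).1 ⟨p, hxy hp⟩ =
        (G x z j i).1 ⟨p, hxz hp⟩ := by
      have h4 := congrArg ((Pi.evalRingHom (fun q : O => ThickStalk ι (q : X)) ⟨p, hp⟩).comp
        (thickSections ι O).subtype) h2
      rw [map_sum] at h4
      exact h4
    refine Eq.trans (Finset.sum_congr rfl fun k _ => ?_) (h3.trans (happ x z i j p (hxz hp)).symm)
    refine (congrArg₂ (· * ·) (happ x y i k p (hxy hp)) (happ y z k j p (hyz hp))).trans ?_
    exact mul_comm _ _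
  · have hx : W x ≤ W x ⊓ W x := le_inf le_rfl le_rfl
    ext i j
    have h1 : res (hx.trans (hr x x)) (s x j) =
        ∑ i, (if j = i then 1 else 0 : thickSections ι (W x)) • res (hx.trans (hl x x)) (s x i) := by
      simp
    have h2 := congrFun ((huniq x (W x) (hx.trans (hl x x)) _).unique (hGO x x _ hx j) h1) i
    refine (happ x x i j p (hx hp)).trans ?_
    refine (congrFun (congrArg Subtype.val h2) ⟨p, hp⟩).trans ?_
    rw [Matrix.one_apply]
    by_cases hij : i = j
    · rw [if_pos hij, if_pos hij.symm]
      rfl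
    · rw [if_neg hij, if_neg (Ne.symm hij)]
      rfl
  · refine (congrArg (thickValue ι p) (happ x y i j p hp)).trans ?_
    exact ((hs x).res (hl x y)).thickValue_eq ((hs y).res (hr x y)) (hG x y j) ⟨p, hp⟩ i

end CocycleOfExtension

/-! ### The main theorem. -/

theorem mainTheorem1
    {EX : Type*} [NormedAddCommGroup EX] [NormedSpace ℂ EX] [FiniteDimensional ℂ EX]
    {EY : Type*} [NormedAddCommGroup EY] [NormedSpace ℂ EY] [FiniteDimensional ℂ EY]
    {X : Type u} [TopologicalSpace X] [ChartedSpace EX X] [IsManifold 𝓘(ℂ, EX) ω X]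
    [CompactSpace X]
    {Y : Type u} [TopologicalSpace Y] [ChartedSpace EY Y] [IsManifold 𝓘(ℂ, EY) ω Y]
    [T2Space Y]
    (ι : C^ω⟮𝓘(ℂ, EX), X; 𝓘(ℂ, EY), Y⟯)
    (hι : Manifold.IsSmoothEmbedding 𝓘(ℂ, EX) 𝓘(ℂ, EY) ω ι)
    (F : Type*) [NormedAddCommGroup F] [NormedSpace ℂ F] [FiniteDimensional ℂ F]
    (E : X → Type*) [TopologicalSpace (TotalSpace F E)] [∀ x, AddCommGroup (E x)]
    [∀ x, Module ℂ (E x)] [∀ x, TopologicalSpace (E x)] [∀ x, IsTopologicalAddGroup (E x)]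
    [∀ x, ContinuousSMul ℂ (E x)] [FiberBundle F E] [VectorBundle ℂ F E]
    [ContMDiffVectorBundle ω F E 𝓘(ℂ, EX)] :
    ExtendsToFirstThickening ι F E ↔
      (tracePairing F E ι).cup (atiyahClass F E) (kodairaSpencerClass ι hι) = 0 := by
  rw [cup_eq_zero_iff_exists_atiyahLift ι F E hι]
  constructor
  · intro h
    obtain ⟨U, g, hg⟩ := h.exists_thickCocycle hι
    exact ⟨U, hg.exists_atiyahLift ι F E⟩
  · rintro ⟨U, B, hB⟩
    obtain ⟨g, hg⟩ := hB.exists_thickCocycle ι F E hι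
    exact hg.extendsToFirstThickening hι
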